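/- Let $k$ be a field of characteristic $0$, $K=k[[h]]$, and let $A$ be a topological Hopf algebra over $K$: a $K$-algebra that is topologically free as a $K$-module (i.e. $h$-torsion free, separated and complete for the $h$-adic topology), with a comultiplication $\Delta:A\to A\,\widehat\otimes_K A$ (an algebra morphism to the $h$-adically completed tensor product), a counit $\varepsilon:A\to K$ and an antipode $S$ satisfying the Hopf algebra axioms. Assume that $S$ is bijective. Put $A_0=A/hA$, and let $k$ be the left $A_0$-module defined by the counit reduced modulo $h$. Assume that $A_0$ is noetherian and that there is an integer $d$ with $$\mathrm{Ext}^i_{A_0}(k,A_0)=0\ \ (i\ne d),\qquad \mathrm{Ext}^d_{A_0}(k,A_0)\simeq k .$$ Let $\widehat{A^e}=A\,\widehat\otimes_K A^{op}$, which acts on $A$ on the left by $(a\otimes b)\cdot x=axb$ and on the right by $x\cdot(a\otimes b)=bxa$ (extended by continuity). For an $\widehat{A^e}$-module $M$ put $HH^i(M)=\mathrm{Ext}^i_{\widehat{A^e}}(A,M)$ and $HH_i(M)=\mathrm{Tor}_i^{\widehat{A^e}}(A,M)$ (both $0$ for $i<0$). Assume moreover that $A_0\otimes_k A_0^{op}$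 is noetherian and that the $\widehat{A^e}$-module $A$ has finite projective dimension. Let $U=HH^d(\widehat{A^e})=\mathrm{Ext}^d_{\widehat{A^e}}(A,\widehat{A^e})$, a right $\widehat{A^e}$-module through right multiplication on the coefficients, i.e. an $A$-bimodule by $a\,u\,b=u\cdot(b\otimes a)$. Then for every left $\widehat{A^e}$-module $M$: (1) $U\otimes_A M$ has exactly one $\widehat{A^e}$-module structure with the following property: for all $x\in\widehat{A^e}$, $u\in U$, and every $w\in U\otimes_A\widehat{A^e}$ which is the limit of $r\cdot(u\otimes 1)$ as $r\in A\otimes_K A^{op}$ tends to $x$ (i.e. $w-r\cdot(u\otimes1)\in h^n(U\otimes_A\widehat{A^e})$ for all $n$ and all $r\equiv x$ modulo $h^n$), where $(a\otimes b)\cdot(u\otimes 1)=au\otimes(1\otimes b)$, the element $x\cdot(u\otimes m)$ is, for every $m\in M$, the image of $w$ under the map $U\otimes_A\widehat{A^e}\to U\otimes_A M$, $u'\otimes y\mapsto u'\otimes ym$. In particular $(a\otimes b)\cdot(u\otimes m)=au\otimes(1\otimes b)m$. (2) With this structure, for every integer $i$ there is an isomorphism of $K$-modules $$HH^i(M)\simeq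 HH_{d-i}(U\otimes_A M).$$ In particular $HH^i(M)=0$ for $i>d$ and $HH_j(U\otimes_A M)=0$ for $j>d$. -/

import Mathlib

open scoped TensorProduct PowerSeries ModuleCat.Algebra
open CategoryTheory MulOpposite

universe u

namespace HopfDuality

/-! ### The `h`-adic completion of an algebra -/

section Completion

variable {K : Type u} [CommRing K] (h : K)

/-- The two-sided ideal `hⁿR` of a `K`-algebra `R`. -/
def powIdeal (R : Type u) [Ring R] [Algebra K R] (n : ℕ) : Ideal R where
  carrier := {x | ∃ y : R, h ^ n • y = x}
  add_mem' := by
    rintro _ _ ⟨a, rfl⟩ ⟨b, rfl⟩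
    exact ⟨a + b, smul_add _ _ _⟩
  zero_mem' := ⟨0, smul_zero _⟩
  smul_mem' := by
    rintro c _ ⟨a, rfl⟩
    exact ⟨c * a, by simp⟩

instance powIdeal_isTwoSided (R : Type u) [Ring R] [Algebra K R] (n : ℕ) :
    (powIdeal h R n).IsTwoSided where
  mul_mem_of_left := by
    rintro _ b ⟨a, rfl⟩
    exact ⟨a * b, by simp⟩

theorem powIdeal_anti (R : Type u) [Ring R] [Algebra K R] {m n : ℕ} (hmn : m ≤ n) :
    powIdeal h R n ≤ powIdeal h R m := by
  rintro _ ⟨a, rfl⟩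
  exact ⟨h ^ (n - m) • a, by rw [smul_smul, ← pow_add, Nat.add_sub_cancel' hmn]⟩

/-- The inverse limit of the rings `R / hⁿR`, inside their product. -/
def completionSubalgebra (R : Type u) [Ring R] [Algebra K R] :
    Subalgebra K (∀ n : ℕ, R ⧸ powIdeal h R n) where
  carrier := {f | ∀ (m n : ℕ) (hmn : m ≤ n),
    Ideal.Quotient.factor (powIdeal_anti h R hmn) (f n) = f m}
  mul_mem' := by
    intro f g hf hg m n hmn
    simp [hf m n hmn, hg m n hmn]
  add_mem' := by
    intro f g hf hg m n hmn
    simp [hf m n hmn, hg m n hmn]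
  algebraMap_mem' := by
    intro r m n hmn
    rfl

/-- The `h`-adic completion `lim R / hⁿR` of a `K`-algebra `R`. -/
def Completion (R : Type u) [Ring R] [Algebra K R] : Type u :=
  ↥(completionSubalgebra h R)

noncomputable instance (R : Type u) [Ring R] [Algebra K R] : Ring (Completion h R) :=
  inferInstanceAs (Ring ↥(completionSubalgebra h R))

noncomputable instance (R : Type u) [Ring R] [Algebra K R] : Algebra K (Completion h R) :=
  inferInstanceAs (Algebra K ↥(completionSubalgebra h R))

namespace Completion

variable {R S : Type u} [Ring R] [Algebra K R] [Ring S] [Algebra K S]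

variable {h} in
/-- The `n`-th component of an element of the completion, in `R / hⁿR`. -/
def proj (x : Completion h R) (n : ℕ) : R ⧸ powIdeal h R n := x.1 n

/-- `x ≡ r` modulo `hⁿ`. -/
def Approx (x : Completion h R) (n : ℕ) (r : R) : Prop :=
  Ideal.Quotient.mk (powIdeal h R n) r = x.proj n

theorem ext' {x y : Completion h R} (H : ∀ n, x.proj n = y.proj n) : x = y :=
  Subtype.ext (funext H)

/-- The canonical map from `R` to its completion. -/
noncomputable def of : R →ₐ[K] Completion h R :=
  AlgHom.codRestrict
    (S := completionSubalgebra h R)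
    (AlgHom.pi fun n => Ideal.Quotient.mkₐ K (powIdeal h R n))
    (fun _ _ _ _ => rfl)

theorem proj_of (r : R) (n : ℕ) :
    (of h r).proj n = Ideal.Quotient.mk (powIdeal h R n) r := rfl

theorem exists_approx (x : Completion h R) (n : ℕ) : ∃ r : R, Approx h x n r :=
  Ideal.Quotient.mk_surjective _

variable {h}

theorem Approx.mono {x : Completion h R} {m n : ℕ} {r : R} (hx : Approx h x n r)
    (hmn : m ≤ n) : Approx h x m r := by
  have := x.2 m n hmn
  unfold Approx proj at *
  rw [← this, ← hx]
  rfl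

theorem Approx.add {x y : Completion h R} {n : ℕ} {r s : R} (hx : Approx h x n r)
    (hy : Approx h y n s) : Approx h (x + y) n (r + s) := by
  unfold Approx at *
  rw [map_add, hx, hy]
  rfl

theorem Approx.mul {x y : Completion h R} {n : ℕ} {r s : R} (hx : Approx h x n r)
    (hy : Approx h y n s) : Approx h (x * y) n (r * s) := by
  unfold Approx at *
  rw [map_mul, hx, hy]
  rfl

theorem Approx.smul {x : Completion h R} {n : ℕ} {r : R} (c : K) (hx : Approx h x n r) :
    Approx h (c • x) n (c • r) := by
  unfold Approx at *
  exact congrArg (fun z => c • z) hx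

theorem Approx.of (r : R) (n : ℕ) : Approx h (of h r) n r := rfl

theorem Approx.sub_eq {x : Completion h R} {n : ℕ} {r s : R} (hr : Approx h x n r)
    (hs : Approx h x n s) : ∃ t : R, r - s = h ^ n • t := by
  unfold Approx at *
  obtain ⟨t, ht⟩ := Ideal.Quotient.eq.1 (hr.trans hs.symm)
  exact ⟨t, ht.symm⟩

/-- A representative in `R` of `x` modulo `hⁿ`. -/
noncomputable def rep (x : Completion h R) (n : ℕ) : R := (exists_approx h x n).choose

theorem approx_rep (x : Completion h R) (n : ℕ) : Approx h x n (x.rep n) :=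
  (exists_approx h x n).choose_spec

theorem proj_congr (φ : R →ₗ[K] Completion h S) {x : Completion h R} {m n : ℕ} (hmn : m ≤ n)
    {r s : R} (hr : Approx h x m r) (hs : Approx h x n s) :
    (φ r).proj m = (φ s).proj m := by
  obtain ⟨t, ht⟩ := hr.sub_eq (hs.mono hmn)
  obtain ⟨w, hw⟩ := exists_approx h (φ t) m
  have h1 : φ r = φ s + h ^ m • φ t := by
    rw [← map_smul, ← map_add, ← ht]; congr 1; abel
  obtain ⟨v, hv⟩ := exists_approx h (φ s) m
  have h2 : Approx h (φ r) m (v + h ^ m • w) := by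
    rw [h1]; exact hv.add (hw.smul _)
  rw [← hv, ← h2]
  exact Ideal.Quotient.eq.2 ⟨w, by abel⟩

/-- The continuous extension to the completion of a linear map from `R` to the completion
of `S`. -/
noncomputable def extend (φ : R →ₗ[K] Completion h S) : Completion h R →ₗ[K] Completion h S where
  toFun x := ⟨fun n => (φ (x.rep n)).proj n, fun m n hmn => by
    change _ = (φ (x.rep m)).proj m
    rw [proj_congr φ hmn (x.approx_rep m) (x.approx_rep n)]
    exact (φ (x.rep n)).2 m n hmn⟩
  map_add' x y := by
    refine ext' h fun n => ?_
    have := proj_congr φ le_rfl ((x + y).approx_rep n) ((x.approx_rep n).add (y.approx_rep n))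
    rw [map_add] at this
    exact this
  map_smul' c x := by
    refine ext' h fun n => ?_
    have := proj_congr φ le_rfl ((c • x).approx_rep n) ((x.approx_rep n).smul c)
    rw [map_smul] at this
    exact this

theorem proj_extend (φ : R →ₗ[K] Completion h S) {x : Completion h R} {n : ℕ} {r : R}
    (hr : Approx h x n r) : (extend φ x).proj n = (φ r).proj n :=
  proj_congr φ le_rfl (x.approx_rep n) hr

/-- The completion of linear maps, itself linear in the map. -/
noncomputable def map : (R →ₗ[K] S) →ₗ[K] Completion h R →ₗ[K] Completion h S where
  toFun f := extend ((of h).toLinearMap ∘ₗ f)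
  map_add' f g := by
    ext x
    exact ext' h fun n => rfl
  map_smul' c f := by
    ext x
    exact ext' h fun n => rfl

end Completion

end Completion

/-! ### Topologically free modules and the action of the completion -/

/-- A `K`-module is topologically free (with respect to `h`) if it is separated and complete for
the `h`-adic topology and has no `h`-torsion. Over `k⟦h⟧` this says that it is
isomorphic to `V⟦h⟧` for some `k`-vector space `V`. -/
class IsTopologicallyFree {K : Type u} [CommRing K] (h : K) (N : Type u) [AddCommGroup N]
    [Module K N] : Prop extends IsAdicComplete (Ideal.span {h}) N where
  eq_zero_of_smul : ∀ x : N, h • x = 0 → x = 0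

section Action

variable {K : Type u} [CommRing K] {h : K} {R : Type u} [Ring R] [Algebra K R]
  {N : Type u} [AddCommGroup N] [Module K N]

theorem mem_pow_smul_top {n : ℕ} {x : N} :
    x ∈ (Ideal.span {h} ^ n • ⊤ : Submodule K N) ↔ ∃ y : N, x = h ^ n • y := by
  rw [Ideal.span_singleton_pow, Submodule.ideal_span_singleton_smul,
    Submodule.mem_smul_pointwise_iff_exists]
  simp [eq_comm]

theorem eq_of_forall_sub [IsAdicComplete (Ideal.span {h}) N] {x y : N}
    (H : ∀ n : ℕ, ∃ z : N, x - y = h ^ n • z) : x = y := by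
  rw [← sub_eq_zero]
  refine IsHausdorff.haus (I := Ideal.span {h}) inferInstance _ fun n => ?_
  rw [SModEq.zero]
  exact mem_pow_smul_top.2 (H n)

theorem exists_lim [IsAdicComplete (Ideal.span {h}) N] (φ : R →ₗ[K] N) (x : Completion h R) :
    ∃ y : N, ∀ (n : ℕ) (r : R), x.Approx h n r → ∃ z : N, y - φ r = h ^ n • z := by
  have key : ∀ {m n : ℕ} {r s : R}, m ≤ n → x.Approx h m r → x.Approx h n s →
      ∃ z : N, φ r - φ s = h ^ m • z := by
    intro m n r s hmn hr hs
    obtain ⟨t, ht⟩ := hr.sub_eq (hs.mono hmn)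
    exact ⟨φ t, by rw [← map_sub, ht, map_smul]⟩
  obtain ⟨L, hL⟩ := IsPrecomplete.prec' (I := Ideal.span {h}) (M := N) (fun n => φ (x.rep n))
    (fun {m n} hmn => by
      rw [SModEq.sub_mem]
      exact mem_pow_smul_top.2 (key hmn (x.approx_rep m) (x.approx_rep n)))
  refine ⟨L, fun n r hr => ?_⟩
  obtain ⟨a, ha⟩ := mem_pow_smul_top.1 (SModEq.sub_mem.1 (hL n))
  obtain ⟨b, hb⟩ := key le_rfl (x.approx_rep n) hr
  refine ⟨b - a, ?_⟩
  rw [smul_sub, ← ha, ← hb]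
  abel

variable [IsAdicComplete (Ideal.span {h}) N]

/-- The limit, in a complete module, of the values of a linear map along an element of the
completion. -/
noncomputable def lim (φ : R →ₗ[K] N) (x : Completion h R) : N := (exists_lim φ x).choose

theorem lim_spec (φ : R →ₗ[K] N) {x : Completion h R} {n : ℕ} {r : R} (hr : x.Approx h n r) :
    ∃ z : N, lim φ x - φ r = h ^ n • z :=
  (exists_lim φ x).choose_spec n r hr

theorem lim_unique (φ : R →ₗ[K] N) {x : Completion h R} {y : N}
    (H : ∀ n : ℕ, ∃ r : R, x.Approx h n r ∧ ∃ z : N, y - φ r = h ^ n • z) : lim φ x = y := by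
  refine eq_of_forall_sub (h := h) fun n => ?_
  obtain ⟨r, hr, z, hz⟩ := H n
  obtain ⟨w, hw⟩ := lim_spec φ hr
  exact ⟨w - z, by rw [smul_sub, ← hw, ← hz]; abel⟩

/-- The continuous extension to the completion of an action of `R` by endomorphisms of a complete
module. -/
noncomputable def extendEnd (β : R →ₗ[K] Module.End K N) :
    Completion h R →ₗ[K] Module.End K N where
  toFun x :=
    { toFun := fun m => lim (β.flip m) x
      map_add' := fun m m' => lim_unique _ fun n => by
        obtain ⟨a, ha⟩ := lim_spec (β.flip m) (x.approx_rep n)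
        obtain ⟨b, hb⟩ := lim_spec (β.flip m') (x.approx_rep n)
        refine ⟨_, x.approx_rep n, a + b, ?_⟩
        rw [smul_add, ← ha, ← hb, map_add, LinearMap.add_apply]
        abel
      map_smul' := fun c m => lim_unique _ fun n => by
        obtain ⟨a, ha⟩ := lim_spec (β.flip m) (x.approx_rep n)
        refine ⟨_, x.approx_rep n, c • a, ?_⟩
        rw [smul_comm, ← ha, map_smul, LinearMap.smul_apply, smul_sub]
        rfl }
  map_add' x y := by
    ext m
    refine lim_unique _ fun n => ?_
    obtain ⟨a, ha⟩ := lim_spec (β.flip m) (x.approx_rep n)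
    obtain ⟨b, hb⟩ := lim_spec (β.flip m) (y.approx_rep n)
    refine ⟨_, (x.approx_rep n).add (y.approx_rep n), a + b, ?_⟩
    rw [smul_add, ← ha, ← hb, map_add]
    change lim (β.flip m) x + lim (β.flip m) y - _ = _
    abel
  map_smul' c x := by
    ext m
    refine lim_unique _ fun n => ?_
    obtain ⟨a, ha⟩ := lim_spec (β.flip m) (x.approx_rep n)
    refine ⟨_, (x.approx_rep n).smul c, c • a, ?_⟩
    rw [smul_comm, ← ha, map_smul, smul_sub]
    rfl

theorem extendEnd_spec (β : R →ₗ[K] Module.End K N) {x : Completion h R} {n : ℕ} {r : R}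
    (hr : x.Approx h n r) (m : N) : ∃ z : N, extendEnd β x m - β r m = h ^ n • z :=
  lim_spec (β.flip m) hr

theorem extendEnd_unique (β : R →ₗ[K] Module.End K N) {x : Completion h R} {m y : N}
    (H : ∀ n : ℕ, ∃ r : R, x.Approx h n r ∧ ∃ z : N, y - β r m = h ^ n • z) :
    extendEnd β x m = y :=
  lim_unique (β.flip m) H

theorem extendEnd_one {β : R →ₗ[K] Module.End K N} (hβ : β 1 = 1) :
    extendEnd (h := h) β 1 = 1 := by
  ext m
  refine extendEnd_unique _ fun n => ⟨1, ?_, 0, by simp [hβ]⟩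
  exact Completion.Approx.of 1 n

theorem extendEnd_comp (β : R →ₗ[K] Module.End K N) {x y : Completion h R} {n : ℕ} {r s : R}
    (hr : x.Approx h n r) (hs : y.Approx h n s) (m : N) :
    ∃ z : N, extendEnd β x (extendEnd β y m) - β r (β s m) = h ^ n • z := by
  obtain ⟨a, ha⟩ := extendEnd_spec β hs m
  obtain ⟨b, hb⟩ := extendEnd_spec β hr (extendEnd β y m)
  refine ⟨b + β r a, ?_⟩
  rw [smul_add, ← hb, ← map_smul, ← ha, map_sub]
  abel

theorem extendEnd_mul {β : R →ₗ[K] Module.End K N} (hβ : ∀ r s m, β (r * s) m = β r (β s m))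
    (x y : Completion h R) (m : N) :
    extendEnd β (x * y) m = extendEnd β x (extendEnd β y m) :=
  extendEnd_unique β fun n => ⟨_, (x.approx_rep n).mul (y.approx_rep n), by
    rw [hβ]; exact extendEnd_comp β (x.approx_rep n) (y.approx_rep n) m⟩

theorem extendEnd_mul_rev {β : R →ₗ[K] Module.End K N}
    (hβ : ∀ r s m, β (r * s) m = β s (β r m)) (x y : Completion h R) (m : N) :
    extendEnd β (x * y) m = extendEnd β y (extendEnd β x m) :=
  extendEnd_unique β fun n => ⟨_, (x.approx_rep n).mul (y.approx_rep n), by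
    rw [hβ]; exact extendEnd_comp β (y.approx_rep n) (x.approx_rep n) m⟩

end Action

/-! ### Topological Hopf algebras -/

section Hopf

variable {K : Type u} [CommRing K] (h : K) (A : Type u) [Ring A] [Algebra K A]

/-- The completed tensor product `A ⊗̂ A`. -/
abbrev CompletedSquare : Type u := Completion h (A ⊗[K] A)

variable {h A}

/-- The map `Δ ⊗̂ id : A ⊗̂ A → (A ⊗ A) ⊗̂ A`, determined by `a ⊗ b ↦ Δ a ⊗ b`. -/
noncomputable def comulTensorId (Δ : A →ₗ[K] CompletedSquare h A) :
    CompletedSquare h A →ₗ[K] Completion h ((A ⊗[K] A) ⊗[K] A) :=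
  Completion.extend (TensorProduct.lift
    (((Completion.map ∘ₗ (TensorProduct.mk K (A ⊗[K] A) A).flip).compl₂ Δ).flip))

/-- The map `id ⊗̂ Δ : A ⊗̂ A → A ⊗̂ (A ⊗ A)`, determined by `a ⊗ b ↦ a ⊗ Δ b`. -/
noncomputable def idTensorComul (Δ : A →ₗ[K] CompletedSquare h A) :
    CompletedSquare h A →ₗ[K] Completion h (A ⊗[K] (A ⊗[K] A)) :=
  Completion.extend (TensorProduct.lift
    ((Completion.map ∘ₗ TensorProduct.mk K A (A ⊗[K] A)).compl₂ Δ))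

variable (h A)

/-- A topological Hopf algebra structure on the `K`-algebra `A`: the comultiplication takes its
values in the `h`-adically completed tensor product, and the axioms hold after completion. -/
structure TopologicalHopfAlgebra where
  /-- the comultiplication `Δ : A → A ⊗̂ A` -/
  comul : A →ₐ[K] CompletedSquare h A
  /-- the counit `ε : A → K` -/
  counit : A →ₐ[K] K
  /-- the antipode `S : A → A` -/
  antipode : A →ₗ[K] A
  coassoc : ∀ a : A,
    Completion.map (TensorProduct.assoc K A A A).toLinearMap
      (comulTensorId comul.toLinearMap (comul a)) = idTensorComul comul.toLinearMap (comul a)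
  counit_comul : ∀ a : A,
    Completion.map ((TensorProduct.lid K A).toLinearMap ∘ₗ
      counit.toLinearMap.rTensor A) (comul a) = Completion.of h a
  comul_counit : ∀ a : A,
    Completion.map ((TensorProduct.rid K A).toLinearMap ∘ₗ
      counit.toLinearMap.lTensor A) (comul a) = Completion.of h a
  antipode_mul : ∀ a : A,
    Completion.map (LinearMap.mul' K A ∘ₗ antipode.rTensor A) (comul a) =
      Completion.of h (algebraMap K A (counit a))
  mul_antipode : ∀ a : A,
    Completion.map (LinearMap.mul' K A ∘ₗ antipode.lTensor A) (comul a) =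
      Completion.of h (algebraMap K A (counit a))

end Hopf

/-! ### The completed enveloping algebra and its actions on `A` -/

section Env

variable {K : Type u} [CommRing K] (h : K) (A : Type u) [Ring A] [Algebra K A]

/-- The completed enveloping algebra `A ⊗̂ Aᵒᵖ`. -/
abbrev Env : Type u := Completion h (A ⊗[K] Aᵐᵒᵖ)

variable {A}

/-- The algebra map `A → A ⊗̂ Aᵒᵖ`, `a ↦ a ⊗ 1`. -/
noncomputable def inclLeft : A →ₐ[K] Env h A :=
  (Completion.of h).comp Algebra.TensorProduct.includeLeft

/-- The algebra map `Aᵒᵖ → A ⊗̂ Aᵒᵖ`, `a ↦ 1 ⊗ a`. -/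
noncomputable def inclRight : Aᵐᵒᵖ →ₐ[K] Env h A :=
  (Completion.of h).comp Algebra.TensorProduct.includeRight

variable (A)

/-- The left action of `A ⊗ Aᵒᵖ` on `A`: `(a ⊗ b) · x = a x b`. -/
noncomputable def leftAction : A ⊗[K] Aᵐᵒᵖ →ₗ[K] Module.End K A :=
  TensorProduct.lift (LinearMap.mk₂ K
    (fun (a : A) (b : Aᵐᵒᵖ) => LinearMap.mulLeft K a ∘ₗ LinearMap.mulRight K b.unop)
    (fun a a' b => by ext x; simp [add_mul])
    (fun c a b => by ext x; simp)
    (fun a b b' => by ext x; simp [mul_add])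
    (fun c a b => by ext x; simp))

/-- The right action of `A ⊗ Aᵒᵖ` on `A`: `x · (a ⊗ b) = b x a`. -/
noncomputable def rightAction : A ⊗[K] Aᵐᵒᵖ →ₗ[K] Module.End K A :=
  TensorProduct.lift (LinearMap.mk₂ K
    (fun (a : A) (b : Aᵐᵒᵖ) => LinearMap.mulLeft K b.unop ∘ₗ LinearMap.mulRight K a)
    (fun a a' b => by ext x; simp [mul_add])
    (fun c a b => by ext x; simp)
    (fun a b b' => by ext x; simp [add_mul])
    (fun c a b => by ext x; simp))

variable {A}

theorem leftAction_tmul (a : A) (b : Aᵐᵒᵖ) (x : A) :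
    leftAction (K := K) A (a ⊗ₜ b) x = a * (x * b.unop) := rfl

theorem rightAction_tmul (a : A) (b : Aᵐᵒᵖ) (x : A) :
    rightAction (K := K) A (a ⊗ₜ b) x = b.unop * (x * a) := rfl

theorem leftAction_mul (r s : A ⊗[K] Aᵐᵒᵖ) (x : A) :
    leftAction A (r * s) x = leftAction A r (leftAction A s x) := by
  induction r with
  | zero => simp
  | add r r' hr hr' => simp [add_mul, hr, hr']
  | tmul a b =>
    induction s with
    | zero => simp
    | add s s' hs hs' => simp [mul_add, hs, hs']
    | tmul c d => simp [leftAction_tmul, mul_assoc]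

theorem rightAction_mul (r s : A ⊗[K] Aᵐᵒᵖ) (x : A) :
    rightAction A (r * s) x = rightAction A s (rightAction A r x) := by
  induction r with
  | zero => simp
  | add r r' hr hr' => simp [add_mul, hr, hr']
  | tmul a b =>
    induction s with
    | zero => simp
    | add s s' hs hs' => simp [mul_add, hs, hs']
    | tmul c d => simp [rightAction_tmul, mul_assoc]

variable [IsAdicComplete (Ideal.span {h}) A]

/-- The ring homomorphism to the endomorphisms of `A` that extends `(a ⊗ b) · x = a x b`. -/
noncomputable def leftEnd : Env h A →+* Module.End K A where
  toFun x := extendEnd (h := h) (leftAction A) x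
  map_one' := extendEnd_one (by ext x; simp [Algebra.TensorProduct.one_def, leftAction_tmul])
  map_mul' x y := LinearMap.ext fun m => extendEnd_mul leftAction_mul x y m
  map_zero' := map_zero _
  map_add' := map_add _

/-- The ring anti-homomorphism to the endomorphisms of `A` that extends
`x · (a ⊗ b) = b x a`. -/
noncomputable def rightEnd : (Env h A)ᵐᵒᵖ →+* Module.End K A where
  toFun x := extendEnd (h := h) (rightAction A) x.unop
  map_one' := extendEnd_one (by ext x; simp [Algebra.TensorProduct.one_def, rightAction_tmul])
  map_mul' x y := LinearMap.ext fun m => extendEnd_mul_rev rightAction_mul y.unop x.unop m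
  map_zero' := map_zero _
  map_add' x y := map_add _ x.unop y.unop

/-- `A` as a left module over its completed enveloping algebra. -/
noncomputable instance envModule : Module (Env h A) A :=
  Module.compHom A (leftEnd (A := A) h)

/-- `A` as a right module over its completed enveloping algebra. -/
noncomputable instance envOpModule : Module (Env h A)ᵐᵒᵖ A :=
  Module.compHom A (rightEnd (A := A) h)

theorem env_smul_def (x : Env h A) (m : A) :
    x • m = extendEnd (h := h) (leftAction A) x m := rfl

theorem env_op_smul_def (x : Env h A) (m : A) :
    op x • m = extendEnd (h := h) (rightAction A) x m := rfl

end Env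

/-! ### Tensor products over a noncommutative ring, and Tor -/

section Tensor

variable {K : Type u} [CommRing K] {S B : Type u} [Ring S] [Algebra K S] [Ring B] [Algebra K B]
  (f : S →ₐ[K] B)
  (N : Type u) [AddCommGroup N] [Module K N] [Module Bᵐᵒᵖ N]

/-- The relations `n s ⊗ m = n ⊗ s m`, for `s` in `S` acting through `f : S → B`. -/
def balancedRelations (M : Type u) [AddCommGroup M] [Module K M] [Module B M] :
    Submodule K (N ⊗[K] M) :=
  Submodule.span K {z | ∃ (s : S) (n : N) (m : M),
    z = (op (f s) • n) ⊗ₜ[K] m - n ⊗ₜ[K] (f s • m)}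

/-- The tensor product `N ⊗_S M` of a right `B`-module `N` and a left `B`-module `M`, both
viewed as `S`-modules through `f : S → B`. -/
abbrev BalancedTensor (M : Type u) [AddCommGroup M] [Module K M] [Module B M] : Type u :=
  (N ⊗[K] M) ⧸ balancedRelations f N M

namespace BalancedTensor

variable {M M' : Type u} [AddCommGroup M] [Module K M] [Module B M]
  [AddCommGroup M'] [Module K M'] [Module B M']

variable {N} in
/-- The class `n ⊗ m`. -/
def tmul (n : N) (m : M) : BalancedTensor f N M :=
  (balancedRelations f N M).mkQ (n ⊗ₜ[K] m)

/-- The map `id ⊗ g` on balanced tensor products. -/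
def map [IsScalarTower K B M] [IsScalarTower K B M'] (g : M →ₗ[B] M') : BalancedTensor f N M →ₗ[K] BalancedTensor f N M' :=
  Submodule.mapQ _ _ (LinearMap.lTensor N (g.restrictScalars K)) <| by
    rw [balancedRelations, Submodule.span_le]
    rintro _ ⟨s, n, m, rfl⟩
    refine Submodule.subset_span ⟨s, n, g m, ?_⟩
    simp

theorem map_tmul [IsScalarTower K B M] [IsScalarTower K B M'] (g : M →ₗ[B] M') (n : N) (m : M) :
    map f N g (tmul f n m) = tmul f n (g m) := rfl

theorem hom_ext {P : Type u} [AddCommGroup P] [Module K P]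
    {a b : BalancedTensor f N M →ₗ[K] P} (H : ∀ n m, a (tmul f n m) = b (tmul f n m)) :
    a = b := by
  refine Submodule.linearMap_qext _ (TensorProduct.ext' fun n m => H n m)

end BalancedTensor

/-- The functor `N ⊗_B -` from left `B`-modules to `K`-modules. -/
noncomputable def tensorFunctor : ModuleCat.{u} B ⥤ ModuleCat.{u} K where
  obj M := ModuleCat.of K (BalancedTensor (AlgHom.id K B) N M)
  map g := ModuleCat.ofHom (BalancedTensor.map (AlgHom.id K B) N g.hom)
  map_id M := by
    ext1
    exact BalancedTensor.hom_ext _ _ fun n m => rfl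
  map_comp g g' := by
    ext1
    exact BalancedTensor.hom_ext _ _ fun n m => rfl

instance : (tensorFunctor (K := K) (B := B) N).Additive where
  map_add {M M' g g'} := by
    ext1
    refine BalancedTensor.hom_ext _ _ fun n m => ?_
    change (balancedRelations _ N M').mkQ (n ⊗ₜ[K] (g.hom m + g'.hom m)) =
      (balancedRelations _ N M').mkQ (n ⊗ₜ[K] (g.hom m)) +
        (balancedRelations _ N M').mkQ (n ⊗ₜ[K] (g'.hom m))
    rw [TensorProduct.tmul_add, map_add]

/-- `Tor_i^B(N, M)`: the `i`-th left derived functor of `N ⊗_B -`, applied to `M`. -/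
noncomputable def Tor (i : ℕ) (M : ModuleCat.{u} B) : ModuleCat.{u} K :=
  ((tensorFunctor (K := K) N).leftDerived i).obj M

end Tensor

/-! ### Hochschild (co)homology and the dualizing bimodule -/

section Hochschild

variable {K : Type u} [CommRing K] (h : K) (A : Type u) [Ring A] [Algebra K A]
  [IsAdicComplete (Ideal.span {h}) A]

/-- The `i`-th Hochschild cohomology of `A` with coefficients in `M`. -/
abbrev HHcoh (i : ℕ) (M : ModuleCat.{u} (Env h A)) : Type u :=
  Abelian.Ext (ModuleCat.of (Env h A) A) M i

/-- The `i`-th Hochschild homology of `A` with coefficients in `M`. -/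
noncomputable abbrev HHhom (i : ℕ) (M : ModuleCat.{u} (Env h A)) : ModuleCat.{u} K :=
  Tor (K := K) (B := Env h A) A i M

/-- The dualizing bimodule `U`: the Hochschild cohomology in degree `d` of `A ⊗̂ Aᵒᵖ`. -/
abbrev DualizingBimodule (d : ℕ) : Type u :=
  HHcoh h A d (ModuleCat.of (Env h A) (Env h A))

variable {A} in
/-- Right multiplication by `b`, an endomorphism of the left module `A ⊗̂ Aᵒᵖ`. -/
noncomputable def mulRightHom (b : Env h A) :
    ModuleCat.of (Env h A) (Env h A) ⟶ ModuleCat.of (Env h A) (Env h A) :=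
  ModuleCat.ofHom (LinearMap.toSpanSingleton (Env h A) (Env h A) b)

/-- The right module structure of `U` over `A ⊗̂ Aᵒᵖ`, induced by right multiplication on the
coefficients. In terms of bimodules, `u · (b ⊗ a) = a u b`. -/
noncomputable instance dualizingModule (d : ℕ) :
    Module (Env h A)ᵐᵒᵖ (DualizingBimodule h A d) where
  smul b u := Abelian.Ext.comp u (Abelian.Ext.mk₀ (mulRightHom h b.unop))
    (add_zero d)
  one_smul u := by
    change Abelian.Ext.comp u (Abelian.Ext.mk₀ (mulRightHom h 1)) _ = u
    have : mulRightHom h (1 : Env h A) = 𝟙 _ := by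
      ext1; ext1; simp [mulRightHom]
    rw [this]
    exact Abelian.Ext.comp_mk₀_id _
  mul_smul b c u := by
    change Abelian.Ext.comp u
        (Abelian.Ext.mk₀ (mulRightHom h (c.unop * b.unop))) _ =
      Abelian.Ext.comp (Abelian.Ext.comp u
        (Abelian.Ext.mk₀ (mulRightHom h c.unop)) _) (Abelian.Ext.mk₀ (mulRightHom h b.unop)) _
    have : mulRightHom h (c.unop * b.unop) = mulRightHom h c.unop ≫ mulRightHom h b.unop := by
      ext1; ext1; simp [mulRightHom]
    rw [this, Abelian.Ext.comp_assoc_of_third_deg_zero, Abelian.Ext.mk₀_comp_mk₀]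
  smul_zero b := Abelian.Ext.zero_comp _ _ _ _ (add_zero d)
  smul_add b u v := Abelian.Ext.add_comp _ _ _ _
  add_smul b c u := by
    change Abelian.Ext.comp u
        (Abelian.Ext.mk₀ (mulRightHom h (b.unop + c.unop))) _ =
      Abelian.Ext.comp u (Abelian.Ext.mk₀ (mulRightHom h b.unop)) _ +
      Abelian.Ext.comp u (Abelian.Ext.mk₀ (mulRightHom h c.unop)) _
    have : mulRightHom h (b.unop + c.unop) = mulRightHom h b.unop + mulRightHom h c.unop := by
      ext1; ext1; simp [mulRightHom]
    rw [this, Abelian.Ext.mk₀_add, Abelian.Ext.comp_add]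
  zero_smul u := by
    change Abelian.Ext.comp u (Abelian.Ext.mk₀ (mulRightHom h 0)) _ = 0
    have : mulRightHom h (0 : Env h A) = 0 := by
      ext1; ext1; simp [mulRightHom]
    rw [this, Abelian.Ext.mk₀_zero, Abelian.Ext.comp_zero]

instance (d : ℕ) : IsScalarTower K (Env h A)ᵐᵒᵖ (DualizingBimodule h A d) where
  smul_assoc c b u := by
    change Abelian.Ext.comp u
        (Abelian.Ext.mk₀ (mulRightHom h (c • b.unop))) _ =
      c • Abelian.Ext.comp u (Abelian.Ext.mk₀ (mulRightHom h b.unop)) _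
    have : Abelian.Ext.mk₀ (mulRightHom h (c • b.unop)) =
        c • Abelian.Ext.mk₀ (mulRightHom h b.unop) := by
      refine Eq.trans ?_ (Abelian.Ext.mk₀_smul c (mulRightHom h b.unop))
      congr 1
      ext1; ext1
      simp only [mulRightHom, ModuleCat.hom_ofHom, LinearMap.toSpanSingleton_apply, one_smul]
      refine (Algebra.smul_def c b.unop).trans ?_
      change _ = algebraMap K (Env h A) c • ((1 : Env h A) • b.unop)
      rw [one_smul, smul_eq_mul]
    rw [this, Abelian.Ext.comp_smul]

variable {h A}

/-- `U ⊗_A M`, formed with the right `A`-module structure `u · b = u · (b ⊗ 1)` of `U` and the left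
`A`-module structure `b · m = (b ⊗ 1) · m` of `M`. -/
abbrev DualizingTensor (d : ℕ) (M : Type u) [AddCommGroup M] [Module K M]
    [Module (Env h A) M] : Type u :=
  BalancedTensor (inclLeft (A := A) h) (DualizingBimodule h A d) M

/-- For `u` in `U`, the map `r ↦ r · (u ⊗ 1)` from `A ⊗ Aᵒᵖ` to `U ⊗_A (A ⊗̂ Aᵒᵖ)`, that is
`(a ⊗ b) · (u ⊗ 1) = a u ⊗ (1 ⊗ b)`. -/
noncomputable def actOnGenerator {d : ℕ} (u : DualizingBimodule h A d) :
    A ⊗[K] Aᵐᵒᵖ →ₗ[K] DualizingTensor (h := h) (A := A) d (Env h A) :=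
  TensorProduct.lift (LinearMap.mk₂ K
    (fun (a : A) (b : Aᵐᵒᵖ) => BalancedTensor.tmul (inclLeft (A := A) h)
      (op (inclRight h (op a)) • u) (inclRight h b))
    (fun a a' b => by
      simp only [MulOpposite.op_add, map_add, add_smul, BalancedTensor.tmul, TensorProduct.add_tmul])
    (fun c a b => by
      simp only [MulOpposite.op_smul, map_smul, smul_assoc, BalancedTensor.tmul,
        ← TensorProduct.smul_tmul'])
    (fun a b b' => by
      simp only [map_add, BalancedTensor.tmul, TensorProduct.tmul_add])
    (fun c a b => by
      simp only [map_smul, BalancedTensor.tmul, TensorProduct.tmul_smul]))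

/-- `w = x · (u ⊗ 1)` in `U ⊗_A (A ⊗̂ Aᵒᵖ)`, in the sense of limits: `w` is congruent to
`r · (u ⊗ 1)` modulo `hⁿ` whenever `r` in `A ⊗ Aᵒᵖ` is congruent to `x` modulo `hⁿ`. -/
def IsActionLimit {d : ℕ} (x : Env h A) (u : DualizingBimodule h A d)
    (w : DualizingTensor (h := h) (A := A) d (Env h A)) : Prop :=
  ∀ (n : ℕ) (r : A ⊗[K] Aᵐᵒᵖ), x.Approx h n r →
    ∃ v : DualizingTensor (h := h) (A := A) d (Env h A), w - actOnGenerator u r = h ^ n • v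

/-- The module structures on `U ⊗_A M` over the completed enveloping algebra that are natural
in `M` and continuous for the free module: `x · (u ⊗ m)` is the image of `x · (u ⊗ 1)` under the
map `U ⊗_A (A ⊗̂ Aᵒᵖ) → U ⊗_A M` induced by `y ↦ y m`. In particular
`(a ⊗ b) · (u ⊗ m) = a u ⊗ m b` for `a, b` in `A`. -/
def IsCanonicalAction (d : ℕ) (M : ModuleCat.{u} (Env h A))
    (inst : Module (Env h A) (DualizingTensor (h := h) (A := A) d M)) : Prop :=
  ∀ (x : Env h A) (u : DualizingBimodule h A d)
    (w : DualizingTensor (h := h) (A := A) d (Env h A)), IsActionLimit x u w →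
    ∀ m : M, inst.smul x (BalancedTensor.tmul (inclLeft h) u m) =
      BalancedTensor.map (inclLeft h) _ (LinearMap.toSpanSingleton (Env h A) M m) w

end Hochschild

/-! ### The reduction modulo `h` of a topological Hopf algebra over `k⟦h⟧` -/

section Reduction

variable {k : Type u} [Field k] (A : Type u) [Ring A] [Algebra k⟦X⟧ A]

variable (k) in
/-- The algebra `A₀ = A / hA`. -/
abbrev Reduction : Type u := A ⧸ powIdeal (PowerSeries.X : k⟦X⟧) A 1

variable {A}

/-- The character of `A₀ = A / hA` induced by the counit of `A`. -/
noncomputable def counitReduction (H : TopologicalHopfAlgebra (PowerSeries.X : k⟦X⟧) A) :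
    Reduction k A →+* k :=
  Ideal.Quotient.lift _ ((PowerSeries.constantCoeff (R := k)).comp H.counit.toRingHom) <| by
    rintro _ ⟨a, rfl⟩
    simp

/-- The one-dimensional left `A₀`-module `k` given by the counit. -/
noncomputable def trivialModule (H : TopologicalHopfAlgebra (PowerSeries.X : k⟦X⟧) A) :
    ModuleCat.{u} (Reduction k A) :=
  (ModuleCat.restrictScalars (counitReduction H)).obj (ModuleCat.of k k)

end Reduction

end HopfDuality

/-! Write B = A₀, Bᵉ = B ⊗ Bᵒᵖ and E for the completed enveloping algebra. Everything rests on an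
element u of U that generates U freely over A on either side.

Over k, the map δ(b) = b₁ ⊗ S(b₂) makes Bᵉ a free right B-module with Bᵉ ⊗_B k = B, so that Ext over
Bᵉ of B with values in N is Ext over B of k with values in N restricted along δ
(`extBaseChange_bijective_of_basis`). Through δ, Bᵉ is also free as a left B-module, on a basis of 1
⊗ B and, since S is bijective, also on a basis of B ⊗ 1. Hence Ext(B, Bᵉ) lives in degree d only,
and there a single class v gives bijections x ↦ v(x ⊗ 1) and y ↦ v(1 ⊗ y) from B
(`exists_generator_regularBimodule`).

As h is regular on A and on E, Ext over E of A with values in a Bᵉ-module is Ext over Bᵉ of B. The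
long exact sequence of 0 → E → E → Bᵉ → 0 and a Nakayama lemma for Ext (`ext_nakayama`) then lift
the vanishing to E and lift v to u (`exists_dualizing_generator`).

Comparing the two bijections from A to U gives an automorphism τ of A with u(1 ⊗ b) = u(τ(b) ⊗ 1)
(`exists_twist`). Consequently m ↦ u ⊗ m identifies U ⊗_A M with M twisted along τ ⊗̂ id, and the
canonical action can be nothing else (`isCanonicalAction_iff`).

Finite projective dimension gives Ext^i(A, -) = 0 for i > d, so Ext^d(A, -) is right exact. Both
Ext^d(A, M) and the tensor product over E of A with the twist of M are the quotient of M by the span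
of the elements xm with ux = 0, whence a natural isomorphism (`extTopEquiv`). Finally, the terms of
a projective resolution P of M have Ext from A in degree d only, so dimension shifting identifies
Ext^i(A, M) with the homology of Ext^d(A, P) in degree d - i (`nonempty_homology_equiv_ext`), which
is the Tor of the twist. -/

namespace HopfDuality

open Abelian

/-! ### Ext out of modules with finitely generated syzygies -/

section Syzygy

variable {R : Type u} [Ring R]

/-- The linear map `R → N` sending `1` to `x`. -/
abbrev elemHom {N : ModuleCat.{u} R} (x : N) : ModuleCat.of R R ⟶ N :=
  ModuleCat.ofHom (LinearMap.toSpanSingleton R N x)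

/-- A class of modules whose members are finitely generated with first syzygies in the class. -/
def SyzygyClosed (T : ModuleCat.{u} R → Prop) : Prop :=
  ∀ X, T X → ∃ (n : ℕ) (π : (Fin n → R) →ₗ[R] X), Function.Surjective π ∧
    T (ModuleCat.of R (LinearMap.ker π))

theorem syzygyClosed_finite (hR : IsNoetherianRing R) :
    SyzygyClosed (fun X : ModuleCat.{u} R => Module.Finite R X) := by
  intro X hX
  obtain ⟨n, π, hπ⟩ := Module.Finite.exists_fin' R X
  exact ⟨n, π, hπ, inferInstance⟩

/-- Dimension shifting: the connecting map is onto because Ext^{i+1}(P, N) = 0 for free P. -/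
theorem exists_extClass_comp {P X : Type u} [AddCommGroup P] [Module R P] [AddCommGroup X]
    [Module R X] [Module.Free R P] {π : P →ₗ[R] X} (hπ : Function.Surjective π)
    {N : ModuleCat.{u} R} {i : ℕ} (e : Ext (ModuleCat.of R X) N (i + 1)) :
    ∃ e' : Ext (ModuleCat.of R (LinearMap.ker π)) N i,
      (LinearMap.shortExact_shortComplexKer hπ).extClass.comp e' (add_comm 1 i) = e :=
  Ext.contravariant_sequence_exact₃ (LinearMap.shortExact_shortComplexKer hπ) N e
    ((Ext.subsingleton_of_projective (ModuleCat.of R P) N i).elim _ _) _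

/-- Ext out of a module with finitely generated syzygies commutes with direct sums of coefficients;
only the generation half is needed. It reduces free coefficients of any rank to R itself. -/
theorem ext_mem_closure_of_basis {T : ModuleCat.{u} R → Prop} (hT : SyzygyClosed T)
    {N : ModuleCat.{u} R} {I : Type*} (b : Module.Basis I R N) (i : ℕ) :
    ∀ (X : ModuleCat.{u} R) (_ : T X) (e : Ext X N i),
      e ∈ AddSubgroup.closure {e' : Ext X N i | ∃ (j : I) (v : Ext X (ModuleCat.of R R) i),
        e' = v.comp (Ext.mk₀ (elemHom (b j))) (add_zero i)} := by
  classical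
  induction i with
  | zero =>
    intro X hX e
    obtain ⟨n, π, hπ, -⟩ := hT X hX
    obtain ⟨f, rfl⟩ := (Ext.mk₀_bijective X N).2 e
    -- Finite generation of X confines the image of f to the span of finitely many basis vectors.
    let s : Finset I := Finset.univ.biUnion
      fun l : Fin n => (b.repr (f.hom (π (Pi.single l 1)))).support
    have hs : ∀ x : X, (b.repr (f.hom x)).support ⊆ s := by
      intro x
      obtain ⟨y, rfl⟩ := hπ x
      rw [← Finset.univ_sum_single y]
      simp only [map_sum]
      refine (Finsupp.support_finsetSum).trans (Finset.biUnion_subset.2 fun l _ => ?_)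
      have : Pi.single l (y l) = y l • (Pi.single l (1 : R) : Fin n → R) := by
        rw [← Pi.single_smul, smul_eq_mul, mul_one]
      rw [this]
      simp only [map_smul]
      exact Finsupp.support_smul.trans
        (Finset.subset_biUnion_of_mem
          (fun l : Fin n => (b.repr (f.hom (π (Pi.single l 1)))).support) (Finset.mem_univ l))
    have hf : f = ∑ j ∈ s, ModuleCat.ofHom (b.coord j ∘ₗ f.hom) ≫ elemHom (b j) := by
      ext x
      rw [ModuleCat.hom_sum, LinearMap.sum_apply]
      conv_lhs => rw [← b.linearCombination_repr (f.hom x), Finsupp.linearCombination_apply,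
        Finsupp.sum_of_support_subset _ (hs x) _ (by simp)]
      rfl
    have h2 : Ext.mk₀ f = ∑ j ∈ s, Ext.mk₀ (ModuleCat.ofHom (b.coord j ∘ₗ f.hom) ≫
        elemHom (b j)) := by
      conv_lhs => rw [hf]
      exact map_sum Ext.addEquiv₀.symm _ _
    rw [h2]
    refine sum_mem fun j _ => AddSubgroup.subset_closure
      ⟨j, Ext.mk₀ (ModuleCat.ofHom (b.coord j ∘ₗ f.hom)), ?_⟩
    rw [Ext.mk₀_comp_mk₀]
  | succ i ih =>
    intro X hX e
    obtain ⟨n, π, hπ, hX'⟩ := hT X hX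
    obtain ⟨e', rfl⟩ := exists_extClass_comp hπ e
    have := ih _ hX' e'
    induction this using AddSubgroup.closure_induction with
    | mem x hx =>
      obtain ⟨j, v, rfl⟩ := hx
      refine AddSubgroup.subset_closure
        ⟨j, (LinearMap.shortExact_shortComplexKer hπ).extClass.comp v (add_comm 1 i), ?_⟩
      rw [Ext.comp_assoc_of_third_deg_zero]
    | zero => rw [Ext.comp_zero]; exact zero_mem _
    | add x y _ _ hx hy => rw [Ext.comp_add]; exact add_mem hx hy
    | neg x _ hx => rw [Ext.comp_neg]; exact neg_mem hx

theorem ext_eq_zero_of_basis {T : ModuleCat.{u} R → Prop} (hT : SyzygyClosed T)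
    {N : ModuleCat.{u} R} {I : Type*} (b : Module.Basis I R N) {i : ℕ} {X : ModuleCat.{u} R}
    (hX : T X) (h0 : ∀ v : Ext X (ModuleCat.of R R) i, v = 0) (e : Ext X N i) : e = 0 := by
  induction ext_mem_closure_of_basis hT b i X hX e using AddSubgroup.closure_induction with
  | mem x hx => obtain ⟨j, v, rfl⟩ := hx; rw [h0 v, Ext.zero_comp]
  | zero => rfl
  | add x y _ _ hx hy => rw [hx, hy, add_zero]
  | neg x _ hx => rw [hx, neg_zero]

/-- An element `δ` of `Ext i X X'` through which all of `Ext i X` is represented by morphisms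
from `X'`, those that factor through `ι : X' ⟶ P` giving zero. -/
theorem exists_ext_representation {T : ModuleCat.{u} R → Prop} (hT : SyzygyClosed T) (i : ℕ) :
    ∀ (X : ModuleCat.{u} R) (_ : T X), ∃ (X' : ModuleCat.{u} R) (m : ℕ) (δ : Ext X X' i)
      (ι : X' ⟶ ModuleCat.of R (Fin m → R)), δ.comp (Ext.mk₀ ι) (add_zero i) = 0 ∧
      ∀ N : ModuleCat.{u} R, (∀ e : Ext X N i, ∃ f : X' ⟶ N,
          e = δ.comp (Ext.mk₀ f) (add_zero i)) ∧
        ∀ f : X' ⟶ N, δ.comp (Ext.mk₀ f) (add_zero i) = 0 → ∃ g, f = ι ≫ g := by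
  -- In degree one X' is the first syzygy and ι its inclusion into a free module. In higher degree
  -- the data of the syzygy are multiplied by the extension class, whose product is injective since
  -- Ext of a free module vanishes in positive degree.
  have key : ∀ i (X : ModuleCat.{u} R) (_ : T X), ∃ (X' : ModuleCat.{u} R) (m : ℕ)
      (δ : Ext X X' (i + 1))
      (ι : X' ⟶ ModuleCat.of R (Fin m → R)), δ.comp (Ext.mk₀ ι) (add_zero (i + 1)) = 0 ∧
      ∀ N : ModuleCat.{u} R, (∀ e : Ext X N (i + 1), ∃ f : X' ⟶ N,
          e = δ.comp (Ext.mk₀ f) (add_zero (i + 1))) ∧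
        ∀ f : X' ⟶ N, δ.comp (Ext.mk₀ f) (add_zero (i + 1)) = 0 → ∃ g, f = ι ≫ g := by
    intro i
    induction i with
    | zero =>
      intro X hX
      obtain ⟨n, π, hπ, hX'⟩ := hT X hX
      refine ⟨_, n, (LinearMap.shortExact_shortComplexKer hπ).extClass,
        π.shortComplexKer.f, ShortComplex.ShortExact.extClass_comp _, fun N => ⟨fun e => ?_,
          fun f hf => ?_⟩⟩
      · obtain ⟨e', rfl⟩ := exists_extClass_comp hπ e
        obtain ⟨f, rfl⟩ := (Ext.mk₀_bijective _ _).2 e'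
        exact ⟨f, rfl⟩
      · obtain ⟨x, hx⟩ := Ext.contravariant_sequence_exact₁
          (LinearMap.shortExact_shortComplexKer hπ) N (Ext.mk₀ f) (add_zero 1) hf
        obtain ⟨g, rfl⟩ := (Ext.mk₀_bijective _ _).2 x
        rw [Ext.mk₀_comp_mk₀] at hx
        exact ⟨g, ((Ext.mk₀_bijective _ _).1 hx).symm⟩
    | succ i ih =>
      intro X hX
      obtain ⟨n, π, hπ, hX'⟩ := hT X hX
      obtain ⟨X', m, δ, ι, h0, H⟩ := ih _ hX'
      have hS := LinearMap.shortExact_shortComplexKer hπ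
      refine ⟨X', m, hS.extClass.comp δ (add_comm 1 (i + 1)), ι, ?_, fun N => ⟨fun e => ?_,
          fun f hf => ?_⟩⟩
      · rw [Ext.comp_assoc_of_third_deg_zero, h0, Ext.comp_zero]
      · obtain ⟨e', rfl⟩ := exists_extClass_comp hπ e
        obtain ⟨f, rfl⟩ := (H N).1 e'
        exact ⟨f, by rw [Ext.comp_assoc_of_third_deg_zero]⟩
      · rw [Ext.comp_assoc_of_third_deg_zero] at hf
        obtain ⟨x, hx⟩ := Ext.contravariant_sequence_exact₁ hS N _ (add_comm 1 (i + 1)) hf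
        refine (H N).2 f ?_
        rw [← hx, (Ext.subsingleton_of_projective (ModuleCat.of R (Fin n → R)) N i).elim x 0,
          Ext.comp_zero]
  cases i with
  | zero =>
    intro X _
    -- In degree zero a class is a morphism, so the free module is taken to be R⁰ = 0 and factoring
    -- through ι means vanishing.
    refine ⟨X, 0, Ext.mk₀ (𝟙 X), 0, by simp, fun N => ⟨fun e => ?_, fun f hf => ?_⟩⟩
    · obtain ⟨f, rfl⟩ := (Ext.mk₀_bijective _ _).2 e
      exact ⟨f, by simp⟩
    · exact ⟨0, by simpa using hf⟩
  | succ i => exact key i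

end Syzygy

end HopfDuality

namespace HopfDuality

open Abelian

/-! ### Comparison of Ext groups under a change of rings -/

section BaseChange

variable {R S : Type u} [Ring R] [Ring S] (f : R →+* S)

instance restrictScalars_preservesFiniteLimits :
    Limits.PreservesFiniteLimits (ModuleCat.restrictScalars.{u} f) :=
  ⟨fun _ _ _ => ⟨inferInstance⟩⟩

/-- The comparison map `Ext_S(Y, N) → Ext_R(X, N)` induced by a map of `R`-modules `X → Y`. -/
noncomputable def extBaseChange {X : ModuleCat.{u} R} {Y : ModuleCat.{u} S}
    (v : X ⟶ (ModuleCat.restrictScalars f).obj Y) (N : ModuleCat.{u} S) (i : ℕ) :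
    Ext Y N i →+ Ext X ((ModuleCat.restrictScalars f).obj N) i :=
  ((Ext.mk₀ v).precomp _ (zero_add i)).comp ((ModuleCat.restrictScalars f).mapExtAddHom Y N i)

theorem extBaseChange_apply {X : ModuleCat.{u} R} {Y : ModuleCat.{u} S}
    (v : X ⟶ (ModuleCat.restrictScalars f).obj Y) (N : ModuleCat.{u} S) (i : ℕ) (e : Ext Y N i) :
    extBaseChange f v N i e =
      (Ext.mk₀ v).comp (e.mapExactFunctor (ModuleCat.restrictScalars f)) (zero_add i) := rfl

theorem extBaseChange_comp_mk₀ {X : ModuleCat.{u} R} {Y : ModuleCat.{u} S}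
    (v : X ⟶ (ModuleCat.restrictScalars f).obj Y) {N N' : ModuleCat.{u} S} (i : ℕ) (e : Ext Y N i)
    (g : N ⟶ N') :
    extBaseChange f v N' i (e.comp (Ext.mk₀ g) (add_zero i)) =
      (extBaseChange f v N i e).comp (Ext.mk₀ ((ModuleCat.restrictScalars f).map g))
        (add_zero i) := by
  rw [extBaseChange_apply, extBaseChange_apply, Ext.mapExactFunctor_comp, Ext.mapExactFunctor_mk₀,
    Ext.comp_assoc_of_third_deg_zero]

/-- The free presentation of a module on its own elements. -/
noncomputable abbrev selfPresentation (X : ModuleCat.{u} R) : (X →₀ R) →ₗ[R] X :=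
  Finsupp.linearCombination R id

theorem selfPresentation_surjective (X : ModuleCat.{u} R) :
    Function.Surjective (selfPresentation X) := fun x =>
  ⟨Finsupp.single x 1, by simp⟩

variable {f}
variable {X : ModuleCat.{u} R} {Y : ModuleCat.{u} S}

/-- A map of `R`-modules to the restriction of `Y`, as a function to `Y`. -/
noncomputable def resFun (v : X ⟶ (ModuleCat.restrictScalars f).obj Y) : X →+ Y := v.hom.toAddMonoidHom

theorem resFun_smul (v : X ⟶ (ModuleCat.restrictScalars f).obj Y) (r : R) (x : X) :
    resFun v (r • x) = f r • resFun v x := v.hom.map_smul r x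

/-- An additive map compatible with the scalars, as a morphism to the restriction of scalars. -/
noncomputable def homOfSemilinear {X Y : Type u} [AddCommGroup X] [Module R X] [AddCommGroup Y] [Module S Y]
    (φ : X →+ Y) (hφ : ∀ (r : R) x, φ (r • x) = f r • φ x) :
    ModuleCat.of R X ⟶ (ModuleCat.restrictScalars f).obj (ModuleCat.of S Y) :=
  ModuleCat.ofHom (Y := (ModuleCat.restrictScalars f).obj (ModuleCat.of S Y))
    { toFun := φ, map_add' := φ.map_add, map_smul' := hφ }

/-- The map on free presentations induced by `v`, on the second presentation. -/
noncomputable abbrev resPresentation (v : X ⟶ (ModuleCat.restrictScalars f).obj Y) :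
    (X →₀ S) →ₗ[S] Y :=
  Finsupp.linearCombination S (resFun v)

variable (f) in
/-- The change of coefficients on finitely supported functions. -/
noncomputable abbrev freeMap (X : Type u) : (X →₀ R) →+ (X →₀ S) :=
  Finsupp.mapRange.addMonoidHom f.toAddMonoidHom

theorem freeMap_smul (X : Type u) (r : R) (p : X →₀ R) :
    freeMap f X (r • p) = f r • freeMap f X p := by
  ext x; simp

theorem resPresentation_freeMap (v : X ⟶ (ModuleCat.restrictScalars f).obj Y) (p : X →₀ R) :
    resPresentation v (freeMap f X p) = resFun v (selfPresentation X p) := by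
  induction p using Finsupp.induction_linear with
  | zero => simp
  | add p q hp hq => rw [map_add, map_add, hp, hq, map_add, map_add]
  | single x r => simp [resFun_smul]

/-- The map induced by `v` on the kernels of the presentations. -/
noncomputable def syzygyFun (v : X ⟶ (ModuleCat.restrictScalars f).obj Y) :
    LinearMap.ker (selfPresentation X) →+ LinearMap.ker (resPresentation v) where
  toFun p := ⟨freeMap f X p, by
    rw [LinearMap.mem_ker, resPresentation_freeMap, LinearMap.mem_ker.1 p.2, map_zero]⟩
  map_zero' := by ext x; simp
  map_add' p q := by
    ext1
    exact map_add (freeMap f X) p.1 q.1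

/-- The map induced by `v` on the kernels of the presentations, as a morphism. -/
noncomputable def syzygyMap (v : X ⟶ (ModuleCat.restrictScalars f).obj Y) :
    ModuleCat.of R (LinearMap.ker (selfPresentation X)) ⟶
      (ModuleCat.restrictScalars f).obj (ModuleCat.of S (LinearMap.ker (resPresentation v))) :=
  homOfSemilinear (syzygyFun v) fun r p => Subtype.ext (freeMap_smul X r p.1)

/-- Surjectivity on free modules is all that the five lemma below asks for. In degree zero a map is
prescribed on basis vectors; in positive degree the target vanishes. -/
theorem freeMap_hom_surjective (X : Type u) (N : ModuleCat.{u} S) (i : ℕ) :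
    Function.Surjective (extBaseChange f
      (homOfSemilinear (f := f) (freeMap f X) (freeMap_smul X)) N i) := by
  cases i with
  | zero =>
    intro e
    obtain ⟨g, rfl⟩ := (Ext.mk₀_bijective _ _).2 e
    refine ⟨Ext.mk₀ (ModuleCat.ofHom
      (Finsupp.linearCombination S fun x => resFun g (Finsupp.single x 1))), ?_⟩
    rw [extBaseChange_apply, Ext.mapExactFunctor_mk₀, Ext.mk₀_comp_mk₀]
    congr 1
    ext1
    refine LinearMap.ext fun p => ?_
    change (Finsupp.linearCombination S fun x => resFun g (Finsupp.single x 1)) (freeMap f X p) =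
      resFun g p
    induction p using Finsupp.induction_linear with
    | zero => simp
    | add p q hp hq => rw [map_add, map_add, hp, hq, map_add]
    | single x r =>
      have : Finsupp.single x r = r • (Finsupp.single x (1 : R)) := by simp
      rw [this, resFun_smul]
      simp
  | succ i =>
    intro e
    exact ⟨0, (Ext.subsingleton_of_projective (ModuleCat.of R (X →₀ R)) _ i).elim _ _⟩

/-- The square of short exact sequences induced by `v` on the presentations. -/
noncomputable def presentationHom (v : X ⟶ (ModuleCat.restrictScalars f).obj Y) :
    (selfPresentation X).shortComplexKer ⟶
      (resPresentation v).shortComplexKer.map (ModuleCat.restrictScalars f) where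
  τ₁ := syzygyMap v
  τ₂ := homOfSemilinear (f := f) (freeMap f X) (freeMap_smul X)
  τ₃ := v
  comm₁₂ := rfl
  comm₂₃ := by
    ext1
    exact LinearMap.ext fun p => resPresentation_freeMap v p

/-- Bijectivity in degree zero propagates by dimension shifting along any class of maps stable under
syzygies. Both modules are presented on the same index set, the elements of X, so that the map of
presentations is a mere change of coefficients. -/
theorem extBaseChange_bijective
    (Good : ∀ (X : ModuleCat.{u} R) (Y : ModuleCat.{u} S),
      (X ⟶ (ModuleCat.restrictScalars f).obj Y) → Prop)
    (hhom : ∀ X Y v, Good X Y v → ∀ N : ModuleCat.{u} S,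
      Function.Bijective fun g : Y ⟶ N => v ≫ (ModuleCat.restrictScalars f).map g)
    (hsurj : ∀ X Y v, Good X Y v → Function.Surjective (resPresentation v))
    (hsyz : ∀ X Y v, Good X Y v → Good _ _ (syzygyMap v)) (N : ModuleCat.{u} S) (i : ℕ) :
    ∀ X Y v, Good X Y v → Function.Bijective (extBaseChange f v N i) := by
  induction i with
  | zero =>
    intro X Y v hv
    have h1 : ∀ g : Y ⟶ N, extBaseChange f v N 0 (Ext.mk₀ g) =
        Ext.mk₀ (v ≫ (ModuleCat.restrictScalars f).map g) := fun g => by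
      rw [extBaseChange_apply, Ext.mapExactFunctor_mk₀, Ext.mk₀_comp_mk₀]
    have h2 := (Ext.mk₀_bijective X ((ModuleCat.restrictScalars f).obj N)).comp (hhom X Y v hv N)
    refine (Function.Bijective.of_comp_iff _ (Ext.mk₀_bijective Y N)).1 ?_
    convert h2 using 1
    exact funext h1
  | succ i ih =>
    intro X Y v hv
    have hS := LinearMap.shortExact_shortComplexKer (selfPresentation_surjective X)
    have hS' := LinearMap.shortExact_shortComplexKer (hsurj X Y v hv)
    -- The rows are Ext^i(free) → Ext^i(syzygy) → Ext^{i+1} → 0, and the right exact form of the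
    -- five lemma applies.
    refine AddMonoidHom.bijective_of_surjective_of_bijective_of_right_exact
      ((Ext.mk₀ (resPresentation v).shortComplexKer.f).precomp N (zero_add i))
      (hS'.extClass.precomp N (add_comm 1 i))
      ((Ext.mk₀ (selfPresentation X).shortComplexKer.f).precomp _ (zero_add i))
      (hS.extClass.precomp _ (add_comm 1 i))
      (extBaseChange f (homOfSemilinear (f := f) (freeMap f X) (freeMap_smul X)) N i)
      (extBaseChange f (syzygyMap v) N i) (extBaseChange f v N (i + 1)) ?_ ?_
      ((ShortComplex.ab_exact_iff_function_exact _).1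
        (Ext.contravariant_sequence_exact₁' hS' N i (i + 1) (add_comm 1 i)))
      ((ShortComplex.ab_exact_iff_function_exact _).1
        (Ext.contravariant_sequence_exact₁' hS _ i (i + 1) (add_comm 1 i)))
      (freeMap_hom_surjective X N i) (ih _ _ _ (hsyz X Y v hv)) ?_ ?_
    · ext e
      change (Ext.mk₀ (selfPresentation X).shortComplexKer.f).comp
        (extBaseChange f (homOfSemilinear (f := f) (freeMap f X) (freeMap_smul X)) N i e)
          (zero_add i) =
        extBaseChange f (syzygyMap v) N i
          ((Ext.mk₀ (resPresentation v).shortComplexKer.f).comp e (zero_add i))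
      rw [extBaseChange_apply, extBaseChange_apply, Ext.mapExactFunctor_comp,
        Ext.mapExactFunctor_mk₀, Ext.mk₀_comp_mk₀_assoc, Ext.mk₀_comp_mk₀_assoc]
      rfl
    · ext e
      change hS.extClass.comp (extBaseChange f (syzygyMap v) N i e) (add_comm 1 i) =
        extBaseChange f v N (i + 1) (hS'.extClass.comp e (add_comm 1 i))
      rw [extBaseChange_apply, extBaseChange_apply, Ext.mapExactFunctor_comp,
        Ext.mapExactFunctor_extClass]
      have := ShortComplex.ShortExact.extClass_naturality hS (hS'.map_of_exact _)
        (presentationHom v)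
      rw [← Ext.comp_assoc_of_second_deg_zero]
      erw [this]
      exact Ext.comp_assoc _ _ _ _ _ (by lia)
    · exact fun e => exists_extClass_comp (hsurj X Y v hv) e
    · exact fun e => exists_extClass_comp (selfPresentation_surjective X) e

end BaseChange

end HopfDuality

namespace HopfDuality

open Abelian

section BaseChange

variable {R S : Type u} [Ring R] [Ring S] {f : R →+* S}

theorem resPresentation_surjective_of_closure {X : ModuleCat.{u} R} {Y : ModuleCat.{u} S}
    (v : X ⟶ (ModuleCat.restrictScalars f).obj Y)
    (H : ∀ y : Y, y ∈ Submodule.span S (Set.range (resFun v))) :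
    Function.Surjective (resPresentation v) := by
  intro y
  have := H y
  rwa [← Finsupp.range_linearCombination] at this

/-! #### Extension of scalars along a free right module -/

/-- The map `I →₀ X → Y`, `x ↦ ∑ sⱼ v(xⱼ)`. -/
noncomputable def basisMap {I : Type*} (s : I → S) {X : ModuleCat.{u} R} {Y : ModuleCat.{u} S}
    (v : X ⟶ (ModuleCat.restrictScalars f).obj Y) : (I →₀ X) →+ Y :=
  Finsupp.liftAddHom fun j => (DistribSMul.toAddMonoidHom Y (s j)).comp (resFun v)

theorem basisMap_single {I : Type*} (s : I → S) {X : ModuleCat.{u} R} {Y : ModuleCat.{u} S}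
    (v : X ⟶ (ModuleCat.restrictScalars f).obj Y) (j : I) (x : X) :
    basisMap s v (Finsupp.single j x) = s j • resFun v x := by
  simp [basisMap]

variable (f) in
/-- The map `I →₀ R → S`, `r ↦ ∑ sⱼ f(rⱼ)`. -/
noncomputable def scalarBasisMap {I : Type*} (s : I → S) : (I →₀ R) →+ S :=
  Finsupp.liftAddHom fun j => (AddMonoidHom.mulLeft (s j)).comp f.toAddMonoidHom

theorem scalarBasisMap_single {I : Type*} (s : I → S) (j : I) (r : R) :
    scalarBasisMap f s (Finsupp.single j r) = s j * f r := by
  simp [scalarBasisMap]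

section Free

variable {I : Type*} {s : I → S} (hs : Function.Bijective (scalarBasisMap f s))

include hs

/-- The hypotheses say that S is free as a right R-module on s and that Y is S ⊗_R X; this is the
universal property of extension of scalars. The additive extension is S-linear because every scalar
expands as ∑ sⱼ f(rⱼ). -/
theorem exists_hom_of_basis {X : ModuleCat.{u} R} {Y : ModuleCat.{u} S}
    {v : X ⟶ (ModuleCat.restrictScalars f).obj Y} (hv : Function.Bijective (basisMap s v))
    {N : ModuleCat.{u} S} (g : X ⟶ (ModuleCat.restrictScalars f).obj N) :
    ∃ g' : Y ⟶ N, v ≫ (ModuleCat.restrictScalars f).map g' = g := by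
  let e : (I →₀ X) ≃+ Y := AddEquiv.ofBijective (basisMap s v) hv
  let G : Y →+ N := (basisMap s g).comp e.symm.toAddMonoidHom
  have hG : ∀ x, G (basisMap s v x) = basisMap s g x := fun x => by
    change basisMap s g (e.symm (e x)) = _
    rw [e.symm_apply_apply]
  have key : ∀ (t : S) (x : X), G (t • resFun v x) = t • resFun g x := by
    intro t x
    obtain ⟨r, rfl⟩ := hs.2 t
    induction r using Finsupp.induction_linear with
    | zero => simp
    | add p q hp hq => rw [map_add, add_smul, map_add, hp, hq, add_smul]
    | single j r =>
      rw [scalarBasisMap_single, mul_smul, mul_smul, ← resFun_smul, ← resFun_smul,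
        ← basisMap_single, ← basisMap_single, hG]
  refine ⟨ModuleCat.ofHom { toFun := G, map_add' := G.map_add, map_smul' := fun t y => ?_ }, ?_⟩
  · obtain ⟨x, rfl⟩ := hv.2 y
    induction x using Finsupp.induction_linear with
    | zero => simp
    | add p q hp hq =>
      rw [map_add, smul_add, map_add, hp, hq, map_add]
      exact (smul_add _ _ _).symm
    | single j x =>
      rw [basisMap_single, ← mul_smul, key, key, mul_smul]
      rfl
  · ext1
    refine LinearMap.ext fun x => ?_
    have := key 1 x
    rw [one_smul, one_smul] at this
    exact this

omit hs in
theorem span_range_of_basis {X : ModuleCat.{u} R} {Y : ModuleCat.{u} S}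
    {v : X ⟶ (ModuleCat.restrictScalars f).obj Y} (hv : Function.Surjective (basisMap s v))
    (y : Y) : y ∈ Submodule.span S (Set.range (resFun v)) := by
  obtain ⟨x, rfl⟩ := hv y
  induction x using Finsupp.induction_linear with
  | zero => simp
  | add p q hp hq => rw [map_add]; exact add_mem hp hq
  | single j x =>
    rw [basisMap_single]
    exact Submodule.smul_mem _ _ (Submodule.subset_span ⟨x, rfl⟩)

omit hs in
theorem hom_ext_of_span {X : ModuleCat.{u} R} {Y : ModuleCat.{u} S}
    {v : X ⟶ (ModuleCat.restrictScalars f).obj Y}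
    (H : ∀ y : Y, y ∈ Submodule.span S (Set.range (resFun v)))
    {N : ModuleCat.{u} S} : Function.Injective
      fun g : Y ⟶ N => v ≫ (ModuleCat.restrictScalars f).map g := by
  intro g g' hg
  ext y
  have hg' : ∀ x, g.hom (resFun v x) = g'.hom (resFun v x) := fun x =>
    congrArg (fun (φ : X ⟶ (ModuleCat.restrictScalars f).obj N) => resFun φ x) hg
  induction H y using Submodule.span_induction with
  | mem x hx => obtain ⟨x, rfl⟩ := hx; exact hg' x
  | zero => simp
  | add x y _ _ hx hy => rw [map_add, map_add, hx, hy]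
  | smul a x _ hx => rw [map_smul, map_smul, hx]

theorem freeMap_basis_bijective (X : Type u) :
    Function.Bijective (basisMap s (homOfSemilinear (f := f) (freeMap f X) (freeMap_smul X))) := by
  set v := homOfSemilinear (f := f) (freeMap f X) (freeMap_smul X)
  have hcoord : ∀ (p : I →₀ (X →₀ R)) (x : X), (basisMap s v p : X →₀ S) x =
      scalarBasisMap f s (p.mapRange (fun q => q x) rfl) := by
    intro p x
    induction p using Finsupp.induction_linear with
    | zero => simp
    | add p q hp hq =>
      rw [map_add, Finsupp.mapRange_add (fun _ _ => rfl), map_add, ← hp, ← hq]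
      rfl
    | single j q =>
      rw [basisMap_single, Finsupp.mapRange_single, scalarBasisMap_single]
      rfl
  constructor
  · rw [injective_iff_map_eq_zero]
    intro p hp
    ext j x
    have h1 := hcoord p x
    rw [hp] at h1
    have h2 := (injective_iff_map_eq_zero _).1 hs.1 _ h1.symm
    exact DFunLike.congr_fun h2 j
  · intro q
    change (X →₀ S) at q
    induction q using Finsupp.induction_linear with
    | zero => exact ⟨0, map_zero _⟩
    | add p q hp hq =>
      obtain ⟨a, ha⟩ := hp
      obtain ⟨b, hb⟩ := hq
      exact ⟨a + b, by rw [map_add, ha, hb]⟩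
    | single x t =>
      obtain ⟨r, rfl⟩ := hs.2 t
      induction r using Finsupp.induction_linear with
      | zero => exact ⟨0, by simp⟩
      | add p q hp hq =>
        obtain ⟨a, ha⟩ := hp
        obtain ⟨b, hb⟩ := hq
        refine ⟨a + b, ?_⟩
        rw [map_add, ha, hb, map_add, Finsupp.single_add]
      | single j r =>
        refine ⟨Finsupp.single j (Finsupp.single x r), ?_⟩
        rw [basisMap_single, scalarBasisMap_single]
        change s j • freeMap f X (Finsupp.single x r) = _
        simp

/-- The relation "Y is S ⊗_R X" passes to syzygies because S is free, hence flat, on the right over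
R; the check is made coefficient by coefficient in the basis s. -/
theorem extBaseChange_bijective_of_basis {X : ModuleCat.{u} R} {Y : ModuleCat.{u} S}
    (v : X ⟶ (ModuleCat.restrictScalars f).obj Y) (hv : Function.Bijective (basisMap s v))
    (N : ModuleCat.{u} S) (i : ℕ) : Function.Bijective (extBaseChange f v N i) := by
  refine extBaseChange_bijective (fun X Y v => Function.Bijective (basisMap s v))
    (fun X Y v hv N => ⟨hom_ext_of_span (span_range_of_basis hv.2),
      fun g => exists_hom_of_basis hs hv g⟩)
    (fun X Y v hv => resPresentation_surjective_of_closure v (span_range_of_basis hv.2))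
    (fun X Y v hv => ?_) N i X Y v hv
  have hP := freeMap_basis_bijective hs X
  have h1 : ∀ p : I →₀ LinearMap.ker (selfPresentation X),
      ((basisMap s (syzygyMap v) p : LinearMap.ker (resPresentation v)) : X →₀ S) =
      basisMap s (homOfSemilinear (f := f) (freeMap f X) (freeMap_smul X))
        (p.mapRange Subtype.val rfl) := by
    intro p
    induction p using Finsupp.induction_linear with
    | zero => simp
    | add p q hp hq =>
      rw [map_add, Finsupp.mapRange_add (fun _ _ => rfl), map_add, ← hp, ← hq]
      rfl
    | single j x => rw [basisMap_single, Finsupp.mapRange_single, basisMap_single]; rfl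
  constructor
  · rw [injective_iff_map_eq_zero]
    intro p hp
    have h2 := h1 p
    rw [hp] at h2
    have h3 := (injective_iff_map_eq_zero _).1 hP.1 _ h2.symm
    ext1 j
    exact Subtype.ext (DFunLike.congr_fun h3 j)
  · rintro ⟨q, hq⟩
    obtain ⟨p, rfl⟩ := hP.2 q
    have h2 : ∀ p : I →₀ (X →₀ R), resPresentation v
        (basisMap s (homOfSemilinear (f := f) (freeMap f X) (freeMap_smul X)) p) =
        basisMap s v (p.mapRange (selfPresentation X) (map_zero _)) := by
      intro p
      induction p using Finsupp.induction_linear with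
      | zero => simp
      | add p q hp hq =>
        rw [map_add, Finsupp.mapRange_add (map_add _)]
        refine (map_add _ _ _).trans ?_
        rw [hp, hq]
        exact (map_add _ _ _).symm
      | single j x =>
        rw [basisMap_single, Finsupp.mapRange_single, basisMap_single]
        refine (map_smul _ _ _).trans (congrArg _ ?_)
        exact resPresentation_freeMap v x
    rw [LinearMap.mem_ker, h2] at hq
    have h3 := (injective_iff_map_eq_zero _).1 hv.1 _ hq
    -- Uniqueness of the coefficients in Y splits the relation into one for each basis index.
    have h4 : ∀ j, p j ∈ LinearMap.ker (selfPresentation X) := fun j =>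
      DFunLike.congr_fun h3 j
    classical
    refine ⟨Finsupp.onFinset p.support (fun j => ⟨p j, h4 j⟩) (fun j hj => ?_), ?_⟩
    · rw [Finsupp.mem_support_iff]
      exact fun h => hj (Subtype.ext h)
    · refine Subtype.ext ((h1 _).trans ?_)
      congr 1
      exact Finsupp.ext fun j => rfl

end Free

/-! #### Reduction modulo a central regular element -/

section Reduction

variable {c : R} (hreg : ∀ r : R, c * r = 0 → r = 0)
  (hf : Function.Surjective f) (hker : ∀ r, f r = 0 ↔ ∃ r', r = c * r')

include hreg hf hker

/-- The stable class consists of the maps X → X/cX with X free of c-torsion; torsion-freeness is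
what makes reduction exact on the syzygy sequence. In degree zero, c acts as zero on any restricted
S-module, so maps out of X factor through X/cX. -/
theorem extBaseChange_bijective_of_reduction {X : ModuleCat.{u} R} {Y : ModuleCat.{u} S}
    (v : X ⟶ (ModuleCat.restrictScalars f).obj Y) (htf : ∀ x : X, c • x = 0 → x = 0)
    (hv : Function.Surjective (resFun v)) (hvker : ∀ x, resFun v x = 0 ↔ ∃ x', x = c • x')
    (N : ModuleCat.{u} S) (i : ℕ) : Function.Bijective (extBaseChange f v N i) := by
  have hspan : ∀ {X : ModuleCat.{u} R} {Y : ModuleCat.{u} S}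
      {v : X ⟶ (ModuleCat.restrictScalars f).obj Y}, Function.Surjective (resFun v) →
      ∀ y : Y, y ∈ Submodule.span S (Set.range (resFun v)) := fun hv y =>
    Submodule.subset_span (hv y)
  refine extBaseChange_bijective (fun X Y v => (∀ x : X, c • x = 0 → x = 0) ∧
      Function.Surjective (resFun v) ∧ ∀ x, resFun v x = 0 ↔ ∃ x', x = c • x')
    (fun X Y v ⟨_, hv, hvker⟩ N => ⟨hom_ext_of_span (hspan hv), fun g => ?_⟩)
    (fun X Y v ⟨_, hv, _⟩ => resPresentation_surjective_of_closure v (hspan hv))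
    (fun X Y v ⟨htf, hv, hvker⟩ => ?_) N i X Y v ⟨htf, hv, hvker⟩
  · have hg : ∀ x x', resFun v x = resFun v x' → resFun g x = resFun g x' := by
      intro x x' h
      rw [← sub_eq_zero, ← map_sub, hvker] at h
      obtain ⟨y, hy⟩ := h
      rw [← sub_eq_zero, ← map_sub, hy, resFun_smul, (hker c).2 ⟨1, (mul_one c).symm⟩, zero_smul]
    have hG : ∀ x, resFun g (Function.surjInv hv (resFun v x)) = resFun g x := fun x =>
      hg _ _ (Function.surjInv_eq hv _)
    refine ⟨ModuleCat.ofHom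
      { toFun := fun y => resFun g (Function.surjInv hv y)
        map_add' := fun y y' => ?_
        map_smul' := fun t y => ?_ }, ?_⟩
    · obtain ⟨x, rfl⟩ := hv y
      obtain ⟨x', rfl⟩ := hv y'
      rw [← map_add, hG, hG, hG, map_add]
    · obtain ⟨x, rfl⟩ := hv y
      obtain ⟨r, rfl⟩ := hf t
      rw [← resFun_smul, hG, hG, resFun_smul]
      rfl
    · ext1
      exact LinearMap.ext hG
  · refine ⟨fun x hx => ?_, fun y => ?_, fun x => ⟨fun hx => ?_, ?_⟩⟩
    · refine Subtype.ext (Finsupp.ext fun z => hreg _ ?_)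
      exact DFunLike.congr_fun (congrArg Subtype.val hx) z
    · obtain ⟨q, hq⟩ := y
      obtain ⟨p, rfl⟩ := Finsupp.mapRange_surjective f.toAddMonoidHom (map_zero _) hf q
      change resPresentation v (freeMap f X p) = 0 at hq
      rw [resPresentation_freeMap, hvker] at hq
      obtain ⟨x, hx⟩ := hq
      obtain ⟨p', rfl⟩ := selfPresentation_surjective X x
      -- A lift p of a relation presents an element c x of X; subtracting c times a lift of x makes
      -- it a relation without changing its reduction.
      refine ⟨⟨p - c • p', ?_⟩, Subtype.ext ?_⟩
      · rw [LinearMap.mem_ker, map_sub, map_smul, hx, sub_self]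
      · change freeMap f X (p - c • p') = freeMap f X p
        rw [map_sub, freeMap_smul, (hker c).2 ⟨1, (mul_one c).symm⟩, zero_smul, sub_zero]
    · have h1 : ∀ z, f (x.1 z) = 0 := fun z =>
        DFunLike.congr_fun (congrArg Subtype.val hx) z
      choose r hr using fun z => (hker _).1 (h1 z)
      classical
      -- The coefficientwise quotient by c is again a relation: its image in X is killed by c.
      let p : X →₀ R := Finsupp.onFinset x.1.support r (fun z hz => by
        rw [Finsupp.mem_support_iff, hr z]
        exact fun h => hz (hreg _ h))
      have hp : x.1 = c • p := Finsupp.ext hr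
      refine ⟨⟨p, ?_⟩, Subtype.ext hp⟩
      have := LinearMap.mem_ker.1 x.2
      rw [hp, map_smul] at this
      exact htf _ this
    · rintro ⟨x', rfl⟩
      refine Subtype.ext ?_
      change freeMap f X (c • x'.1) = 0
      rw [freeMap_smul, (hker c).2 ⟨1, (mul_one c).symm⟩, zero_smul]

end Reduction

end BaseChange

end HopfDuality

namespace HopfDuality

open Abelian

/-! ### Finiteness and Nakayama over a complete ring -/

section Complete

/-- A ring is separated and complete for the topology defined by a central regular element. -/
structure CentralComplete {R : Type u} [Ring R] (c : R) : Prop where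
  comm : ∀ r, c * r = r * c
  reg : ∀ r, c * r = 0 → r = 0
  sep : ∀ r, (∀ n : ℕ, ∃ t, r = c ^ n * t) → r = 0
  lim : ∀ a : ℕ → R, ∃ r, ∀ n : ℕ, ∃ t, r = ∑ i ∈ Finset.range n, c ^ i * a i + c ^ n * t

variable {R S : Type u} [Ring R] [Ring S] {f : R →+* S} {c : R}

theorem CentralComplete.comm_pow (hc : CentralComplete c) (n : ℕ) (r : R) :
    c ^ n * r = r * c ^ n :=
  (Commute.pow_left (hc.comm r) n)

/-- The finitely generated modules that are torsion-free and separated with respect to `c`. -/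
def TorsionFreeClass (c : R) (X : ModuleCat.{u} R) : Prop :=
  Module.Finite R X ∧ (∀ x : X, c • x = 0 → x = 0) ∧
    ∀ x : X, (∀ n : ℕ, ∃ y, x = c ^ n • y) → x = 0

/-- Noetherianity is assumed of S = R/c only. The image of the syzygy in Sⁿ is finitely generated,
and lifts of its generators generate the syzygy by successive approximation. -/
theorem syzygyClosed_torsionFreeClass (hc : CentralComplete c) (hf : Function.Surjective f)
    (hker : ∀ r, f r = 0 ↔ ∃ r', r = c * r') (hS : IsNoetherianRing S) :
    SyzygyClosed (TorsionFreeClass c) := by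
  rintro X ⟨hfin, htf, hsep⟩
  obtain ⟨n, π, hπ⟩ := Module.Finite.exists_fin' R X
  refine ⟨n, π, hπ, ?_, fun x hx => ?_, fun x hx => ?_⟩
  · let W : Submodule S (Fin n → S) :=
      { carrier := {w | ∃ x : LinearMap.ker π, ∀ l, f (x.1 l) = w l}
        add_mem' := by
          rintro _ _ ⟨x, hx⟩ ⟨y, hy⟩
          exact ⟨x + y, fun l => by simp [← hx, ← hy]⟩
        zero_mem' := ⟨0, fun l => by simp⟩
        smul_mem' := by
          rintro t _ ⟨x, hx⟩
          obtain ⟨r, rfl⟩ := hf t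
          exact ⟨r • x, fun l => by simp [← hx]⟩ }
    obtain ⟨m, w, hw⟩ := Submodule.fg_iff_exists_fin_generating_family.1
      (IsNoetherian.noetherian W)
    have hwW : ∀ l, w l ∈ W := fun l => hw ▸ Submodule.subset_span ⟨l, rfl⟩
    choose y hy using hwW
    have step : ∀ x : LinearMap.ker π, ∃ (r : Fin m → R) (x' : LinearMap.ker π),
        x = ∑ l, r l • y l + c • x' := by
      intro x
      have hx : (fun l => f (x.1 l)) ∈ W := ⟨x, fun l => rfl⟩
      rw [← hw, Submodule.mem_span_range_iff_exists_fun] at hx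
      obtain ⟨t, ht⟩ := hx
      choose r hr using fun l => hf (t l)
      have h1 : ∀ i, f ((x - ∑ l, r l • y l).1 i) = 0 := by
        intro i
        have := congrFun ht i
        simp only [Finset.sum_apply, Pi.smul_apply, smul_eq_mul] at this
        simp only [AddSubgroupClass.coe_sub, Submodule.coe_sum, Submodule.coe_smul, Pi.sub_apply,
          Finset.sum_apply, Pi.smul_apply, smul_eq_mul, map_sub, map_sum, map_mul, hr, hy, this,
          sub_self]
      choose p hp using fun i => (hker _).1 (h1 i)
      have hp' : (x - ∑ l, r l • y l).1 = c • p := funext hp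
      -- The syzygy is saturated: if c p is a relation then so is p, because X has no c-torsion. The
      -- remainder is thus c times an element of the syzygy, and the approximation can go on.
      refine ⟨r, ⟨p, htf _ ?_⟩, ?_⟩
      · rw [← map_smul, ← hp']
        exact (x - ∑ l, r l • y l).2
      · rw [← sub_eq_iff_eq_add']
        exact Subtype.ext hp'
    choose r next hstep using step
    classical
    change Module.Finite R (LinearMap.ker π)
    refine ⟨⟨Finset.univ.image y, ?_⟩⟩
    rw [eq_top_iff]
    rintro x -
    rw [Finset.coe_image, Finset.coe_univ, Set.image_univ,
      Submodule.mem_span_range_iff_exists_fun]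
    let z : ℕ → LinearMap.ker π := fun k => next^[k] x
    have hz : ∀ k, z k = ∑ l, r (z k) l • y l + c • z (k + 1) := fun k => by
      have : z (k + 1) = next (z k) := Function.iterate_succ_apply' _ _ _
      rw [this]
      exact hstep _
    have hsum : ∀ k, x = ∑ l, (∑ i ∈ Finset.range k, c ^ i * r (z i) l) • y l + c ^ k • z k := by
      intro k
      induction k with
      | zero => simp [z]
      | succ k ih =>
        conv_lhs => rw [ih, hz k]
        simp only [Finset.sum_range_succ, add_smul, Finset.sum_add_distrib, smul_add,
          Finset.smul_sum, mul_smul, pow_succ]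
        abel
    -- The coefficients converge in R; equality with x is then tested in Rⁿ, where separatedness is
    -- available.
    choose a ha using fun l => hc.lim fun i => r (z i) l
    refine ⟨a, ?_⟩
    rw [← sub_eq_zero]
    refine Subtype.ext (funext fun i => hc.sep _ fun k => ?_)
    choose t ht using fun l => ha l k
    refine ⟨((∑ l, t l • y l) - z k).1 i, ?_⟩
    have : ∑ l, a l • y l - x = c ^ k • (∑ l, t l • y l - z k) := by
      conv_lhs => rw [hsum k]
      rw [smul_sub, Finset.smul_sum, ← sub_sub, ← Finset.sum_sub_distrib]
      congr 1
      refine Finset.sum_congr rfl fun l _ => ?_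
      rw [ht l, add_smul, mul_smul, add_sub_cancel_left]
    rw [this]
    rfl
  · refine Subtype.ext (funext fun l => hc.reg _ ?_)
    exact congrFun (congrArg Subtype.val hx) l
  · refine Subtype.ext (funext fun l => hc.sep _ fun n => ?_)
    obtain ⟨y, hy⟩ := hx n
    exact ⟨y.1 l, congrFun (congrArg Subtype.val hy) l⟩

/-- Right multiplication on `Ext i X R`. -/
noncomputable abbrev extMul {X : ModuleCat.{u} R} {i : ℕ} (e : Ext X (ModuleCat.of R R) i)
    (x : R) : Ext X (ModuleCat.of R R) i :=
  e.comp (Ext.mk₀ (elemHom (N := ModuleCat.of R R) x)) (add_zero i)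

theorem elemHom_comp {N N' : ModuleCat.{u} R} (x : N) (g : N ⟶ N') :
    elemHom x ≫ g = elemHom (g.hom x) := by
  ext
  simp

theorem extMul_comp_elemHom {X N : ModuleCat.{u} R} {i : ℕ} (e : Ext X (ModuleCat.of R R) i)
    (x : R) (m : N) : (extMul e x).comp (Ext.mk₀ (elemHom m)) (add_zero i) =
      e.comp (Ext.mk₀ (elemHom (x • m))) (add_zero i) := by
  rw [Ext.comp_assoc_of_third_deg_zero, Ext.mk₀_comp_mk₀, elemHom_comp]
  rfl

theorem extMul_mul {X : ModuleCat.{u} R} {i : ℕ} (e : Ext X (ModuleCat.of R R) i) (x y : R) :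
    extMul (extMul e x) y = extMul e (x * y) :=
  extMul_comp_elemHom e x (N := ModuleCat.of R R) y

/-- Nakayama's lemma for `Ext i X R` over a complete ring `R`. -/
theorem ext_nakayama (hc : CentralComplete c) {T : ModuleCat.{u} R → Prop} (hT : SyzygyClosed T)
    {X : ModuleCat.{u} R} (hX : T X) {i : ℕ} {A : Type*} [AddCommGroup A] (j : A →+ R)
    (hj : ∀ a : ℕ → A, ∃ a', ∀ n : ℕ, ∃ t,
      j a' = ∑ i ∈ Finset.range n, c ^ i * j (a i) + c ^ n * t)
    (v : Ext X (ModuleCat.of R R) i) (H : ∀ e, ∃ a e', e = extMul v (j a) + extMul e' c)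
    (e : Ext X (ModuleCat.of R R) i) : ∃ a, e = extMul v (j a) := by
  -- Ext carries no topology known to be separated or complete, so classes are replaced by morphisms
  -- X' → R, and the approximation takes place among values in R.
  obtain ⟨X', m, δ, ι, h0, hrep⟩ := exists_ext_representation hT i X hX
  obtain ⟨fv, rfl⟩ := (hrep _).1 v
  obtain ⟨f₀, rfl⟩ := (hrep _).1 e
  have step : ∀ g : X' ⟶ ModuleCat.of R R, ∃ (a : A) (b : Fin m → R)
      (g' : X' ⟶ ModuleCat.of R R), ∀ x : X', (g.hom x : R) =
        fv.hom x * j a + ∑ l, (ι.hom x : Fin m → R) l * b l + g'.hom x * c := by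
    intro g
    obtain ⟨a, e', he⟩ := H (δ.comp (Ext.mk₀ g) (add_zero i))
    obtain ⟨g', rfl⟩ := (hrep _).1 e'
    have h1 : δ.comp (Ext.mk₀ (g + (-(fv ≫ elemHom (j a)) + -(g' ≫ elemHom c))))
        (add_zero i) = 0 := by
      rw [Ext.mk₀_add, Ext.mk₀_add, Ext.mk₀_neg, Ext.mk₀_neg, Ext.comp_add, Ext.comp_add,
        Ext.comp_neg, Ext.comp_neg, he, extMul, extMul, Ext.comp_assoc_of_third_deg_zero,
        Ext.comp_assoc_of_third_deg_zero, Ext.mk₀_comp_mk₀, Ext.mk₀_comp_mk₀]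
      abel
    obtain ⟨h, hh⟩ := (hrep _).2 _ h1
    -- An equation in Ext holds for morphisms up to a term through ι, that is, a combination of the
    -- m coordinates of ι with right coefficients b. These are summed along with the a's.
    refine ⟨a, fun l => h.hom (Pi.single l (1 : R) : Fin m → R), g', fun x => ?_⟩
    have h2 : (g.hom x : R) + (-(fv.hom x * j a) + -(g'.hom x * c)) = h.hom (ι.hom x) :=
      congrArg (fun (φ : X' ⟶ ModuleCat.of R R) => φ.hom x) hh
    have h3 : (h.hom (ι.hom x) : R) = ∑ l, (ι.hom x : Fin m → R) l *
        h.hom (Pi.single l (1 : R) : Fin m → R) := by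
      refine (h.hom.pi_apply_eq_sum_univ (ι.hom x)).trans (Finset.sum_congr rfl fun l _ => ?_)
      congr 2
      ext l'
      simp [Pi.single_apply, eq_comm]
    rw [← h3, ← h2]
    abel
  choose a b next hstep using step
  let g : ℕ → (X' ⟶ ModuleCat.of R R) := fun k => next^[k] f₀
  have hg : ∀ k, g (k + 1) = next (g k) := fun k => Function.iterate_succ_apply' _ _ _
  obtain ⟨a', ha'⟩ := hj fun k => a (g k)
  choose b' hb' using fun l => hc.lim fun k => b (g k) l
  have hsum : ∀ (k : ℕ) (x : X'), (f₀.hom x : R) =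
      fv.hom x * (∑ i ∈ Finset.range k, c ^ i * j (a (g i))) +
        ∑ l, (ι.hom x : Fin m → R) l * (∑ i ∈ Finset.range k, c ^ i * b (g i) l) +
        (g k).hom x * c ^ k := by
    intro k x
    induction k with
    | zero => simp [g]
    | succ k ih =>
      rw [ih, hstep (g k) x, ← hg]
      simp only [Finset.sum_range_succ, mul_add, Finset.sum_add_distrib, add_mul, pow_succ',
        mul_assoc, Finset.sum_mul, hc.comm_pow k]
      abel
  have hfin : f₀ = fv ≫ elemHom (j a') + ι ≫ ModuleCat.ofHom
      (∑ l, (LinearMap.proj l).smulRight (b' l) : (Fin m → R) →ₗ[R] R) := by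
    ext x
    rw [← sub_eq_zero]
    refine hc.sep _ fun k => ?_
    obtain ⟨t, ht⟩ := ha' k
    choose s hs using fun l => hb' l k
    refine ⟨(g k).hom x - (fv.hom x * t + ∑ l, (ι.hom x : Fin m → R) l * s l), ?_⟩
    have h1 : ((fv ≫ elemHom (j a') + ι ≫ ModuleCat.ofHom
        (∑ l, (LinearMap.proj l).smulRight (b' l) : (Fin m → R) →ₗ[R] R)).hom x : R) =
        fv.hom x * j a' + ∑ l, (ι.hom x : Fin m → R) l * b' l := by
      change fv.hom x * j a' + (∑ l, (LinearMap.proj l).smulRight (b' l) : (Fin m → R) →ₗ[R] R)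
        (ι.hom x) = _
      rw [LinearMap.sum_apply]
      rfl
    rw [h1, hsum k x, ht]
    simp only [hs, mul_add, Finset.sum_add_distrib, hc.comm_pow k, Finset.sum_mul,
      mul_assoc, add_mul, sub_mul]
    abel
  -- The accumulated term through ι disappears because δ followed by ι is zero.
  refine ⟨a', ?_⟩
  rw [hfin, Ext.mk₀_add, Ext.comp_add, ← Ext.mk₀_comp_mk₀, ← Ext.mk₀_comp_mk₀,
    ← Ext.comp_assoc_of_third_deg_zero, ← Ext.comp_assoc_of_third_deg_zero, h0, Ext.zero_comp,
    add_zero]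

end Complete

end HopfDuality

namespace HopfDuality

open Abelian

/-! ### Lifting Ext groups from R/c to R -/

section Lifting

variable {R S : Type u} [Ring R] [Ring S] (f : R →+* S) {c : R}

/-- A ring homomorphism `R → S` as a map of left `R`-modules. -/
noncomputable def reductionHom :
    ModuleCat.of R R ⟶ (ModuleCat.restrictScalars f).obj (ModuleCat.of S S) :=
  homOfSemilinear f.toAddMonoidHom fun r x => map_mul f r x

theorem elemHom_comp_reductionHom (x : R) :
    elemHom (N := ModuleCat.of R R) x ≫ reductionHom f =
      reductionHom f ≫ (ModuleCat.restrictScalars f).map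
        (elemHom (N := ModuleCat.of S S) (f x)) := by
  ext1
  refine LinearMap.ext fun r => ?_
  exact map_mul f r x

variable {f} (hc : CentralComplete c) (hf : Function.Surjective f)
  (hker : ∀ r, f r = 0 ↔ ∃ r', r = c * r')

include hker in
theorem elemHom_comp_reductionHom_eq_zero :
    elemHom (N := ModuleCat.of R R) c ≫ reductionHom f = 0 := by
  rw [elemHom_comp_reductionHom, (hker c).2 ⟨1, (mul_one c).symm⟩]
  ext1
  refine LinearMap.ext fun r => ?_
  change f r * 0 = 0
  rw [mul_zero]

include hc hf in
theorem reduction_shortExact :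
    (ShortComplex.mk _ _ (elemHom_comp_reductionHom_eq_zero hker)).ShortExact := by
  refine ModuleCat.shortComplex_shortExact _ (fun r => ⟨fun hr => ?_, ?_⟩) ?_ hf
  · obtain ⟨r', rfl⟩ := (hker r).1 hr
    exact ⟨r', (hc.comm r').symm⟩
  · rintro ⟨r', rfl⟩
    change f (r' * c) = 0
    rw [← hc.comm, hker]
    exact ⟨r', rfl⟩
  · refine (injective_iff_map_eq_zero (elemHom (N := ModuleCat.of R R) c).hom).2 fun r hr => ?_
    change r * c = 0 at hr
    rw [← hc.comm] at hr
    exact hc.reg r hr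

variable {T : ModuleCat.{u} R → Prop} (hT : SyzygyClosed T) {X : ModuleCat.{u} R} (hX : T X)

include hc hf hker in
-- The kernel of c on Ext^i(X, R) is the image of Ext^{i-1}(X, S). Writing the hypothesis with i' +
-- 1 = i makes it empty in degree zero, where R → R is injective already.
theorem extMul_injective_of_reduction {i : ℕ}
    (h0 : ∀ i', i' + 1 = i → ∀ e : Ext X ((ModuleCat.restrictScalars f).obj (ModuleCat.of S S)) i',
      e = 0)
    (e : Ext X (ModuleCat.of R R) i) (he : extMul e c = 0) : e = 0 := by
  have hS := reduction_shortExact hc hf hker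
  cases i with
  | zero =>
    have := hS.mono_f
    exact Ext.postcomp_mk₀_injective_of_mono X (elemHom (N := ModuleCat.of R R) c)
      (he.trans (Ext.zero_comp X 0 (Ext.mk₀ (elemHom (N := ModuleCat.of R R) c)) 0 (add_zero 0)).symm)
  | succ i =>
    obtain ⟨y, rfl⟩ := Ext.covariant_sequence_exact₁ X hS e he rfl
    rw [h0 i rfl y, Ext.zero_comp]

include hc hf hker in
theorem exists_extMul_of_reduction {i : ℕ} (e : Ext X (ModuleCat.of R R) i)
    (he : e.comp (Ext.mk₀ (reductionHom f)) (add_zero i) = 0) : ∃ e', e = extMul e' c := by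
  obtain ⟨e', he'⟩ := Ext.covariant_sequence_exact₂ X (reduction_shortExact hc hf hker) e he
  exact ⟨e', he'.symm⟩

include hc hf hker hT hX in
-- Every class is divisible by c, and Nakayama applies with the zero class as generator.
theorem ext_eq_zero_of_reduction {i : ℕ}
    (h0 : ∀ e : Ext X ((ModuleCat.restrictScalars f).obj (ModuleCat.of S S)) i, e = 0)
    (e : Ext X (ModuleCat.of R R) i) : e = 0 := by
  obtain ⟨_, h⟩ := ext_nakayama hc hT hX (0 : PUnit.{1} →+ R) (fun _ => ⟨0, fun n => ⟨0, by simp⟩⟩)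
    0 (fun e => by
      obtain ⟨e', he'⟩ := exists_extMul_of_reduction hc hf hker e (h0 _)
      exact ⟨0, e', by rw [he', extMul.eq_def 0, Ext.zero_comp, zero_add]⟩) e
  rw [h, extMul, Ext.zero_comp]

include hc hf hker in
-- The obstruction to lifting lies in Ext^{i+1}(X, R).
theorem exists_lift_of_reduction {i : ℕ}
    (h0 : ∀ e : Ext X (ModuleCat.of R R) (i + 1), e = 0)
    (v : Ext X ((ModuleCat.restrictScalars f).obj (ModuleCat.of S S)) i) :
    ∃ u : Ext X (ModuleCat.of R R) i, u.comp (Ext.mk₀ (reductionHom f)) (add_zero i) = v :=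
  Ext.covariant_sequence_exact₃ X (reduction_shortExact hc hf hker) v rfl (h0 _)

theorem extMul_comp_reductionHom {i : ℕ} (e : Ext X (ModuleCat.of R R) i) (x : R) :
    (extMul e x).comp (Ext.mk₀ (reductionHom f)) (add_zero i) =
      (e.comp (Ext.mk₀ (reductionHom f)) (add_zero i)).comp
        (Ext.mk₀ ((ModuleCat.restrictScalars f).map (elemHom (N := ModuleCat.of S S) (f x))))
        (add_zero i) := by
  rw [Ext.comp_assoc_of_third_deg_zero, Ext.comp_assoc_of_third_deg_zero, Ext.mk₀_comp_mk₀,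
    Ext.mk₀_comp_mk₀, elemHom_comp_reductionHom]

theorem extMul_add {i : ℕ} (e : Ext X (ModuleCat.of R R) i) (x y : R) :
    extMul e (x + y) = extMul e x + extMul e y := by
  rw [extMul, ← Ext.comp_add, ← Ext.mk₀_add]
  congr 2
  ext1
  refine LinearMap.ext fun r => ?_
  exact mul_add r x y

include hc hf hker hT hX in
/-- If `v` freely generates `Ext i X S` over the reduction of `A`, a lift `u` of `v` freely
generates `Ext i X R` over `A`. -/
theorem extMul_bijective_of_reduction {i : ℕ}
    (h0 : ∀ i', i' + 1 = i → ∀ e : Ext X ((ModuleCat.restrictScalars f).obj (ModuleCat.of S S)) i',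
      e = 0)
    (v : Ext X (ModuleCat.of R R) i) {A : Type*} [AddCommGroup A] (j : A →+ R)
    (hinj : Function.Injective j)
    (hj : ∀ a : ℕ → A, ∃ a', ∀ n : ℕ, ∃ t,
      j a' = ∑ i ∈ Finset.range n, c ^ i * j (a i) + c ^ n * t)
    (hgen : ∀ w : Ext X ((ModuleCat.restrictScalars f).obj (ModuleCat.of S S)) i, ∃ a,
      w = (v.comp (Ext.mk₀ (reductionHom f)) (add_zero i)).comp
        (Ext.mk₀ ((ModuleCat.restrictScalars f).map (elemHom (N := ModuleCat.of S S) (f (j a)))))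
        (add_zero i))
    (hfree : ∀ a, (v.comp (Ext.mk₀ (reductionHom f)) (add_zero i)).comp
        (Ext.mk₀ ((ModuleCat.restrictScalars f).map (elemHom (N := ModuleCat.of S S) (f (j a)))))
        (add_zero i) = 0 → ∃ a', j a = c * j a') :
    Function.Bijective fun a => extMul v (j a) := by
  constructor
  -- A relation is divisible by c modulo the reduction, and the quotient is again a relation since c
  -- is injective on Ext. Iterating puts j a in every c^n R, so it vanishes.
  · have h1 : ∀ a, extMul v (j a) = 0 → ∃ a', j a = c * j a' ∧ extMul v (j a') = 0 := by
      intro a ha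
      obtain ⟨a', ha'⟩ := hfree a (by rw [← extMul_comp_reductionHom, ha, Ext.zero_comp])
      refine ⟨a', ha', extMul_injective_of_reduction hc hf hker h0 _ ?_⟩
      rw [extMul_mul, ← hc.comm, ← ha', ha]
    have h2 : ∀ a, extMul v (j a) = 0 → a = 0 := by
      intro a ha
      refine hinj ((hc.sep _ fun n => ?_).trans (map_zero j).symm)
      have : ∃ a', j a = c ^ n * j a' ∧ extMul v (j a') = 0 := by
        induction n with
        | zero => exact ⟨a, by simp, ha⟩
        | succ n ih =>
          obtain ⟨a', h, h'⟩ := ih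
          obtain ⟨a'', h3, h4⟩ := h1 a' h'
          exact ⟨a'', by rw [h, h3, pow_succ, mul_assoc], h4⟩
      obtain ⟨a', h, -⟩ := this
      exact ⟨_, h⟩
    let φ : A →+ Ext X (ModuleCat.of R R) i :=
      AddMonoidHom.mk' (fun a => extMul v (j a)) fun a b => by rw [map_add, extMul_add]
    exact (injective_iff_map_eq_zero φ).2 h2
  · intro e
    obtain ⟨a, ha⟩ := ext_nakayama hc hT hX j hj v (fun e => by
      obtain ⟨a, ha⟩ := hgen (e.comp (Ext.mk₀ (reductionHom f)) (add_zero i))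
      obtain ⟨e', he'⟩ := exists_extMul_of_reduction hc hf hker (e + -extMul v (j a)) (by
        rw [Ext.add_comp, Ext.neg_comp, extMul_comp_reductionHom, ← ha, add_neg_cancel])
      exact ⟨a, e', by rw [← he']; abel⟩) e
    exact ⟨a, ha.symm⟩

end Lifting

/-! ### Vanishing above degree d and right exactness in degree d -/

section Vanishing

variable {R : Type u} [Ring R] {T : ModuleCat.{u} R → Prop} (hT : SyzygyClosed T)
  {X : ModuleCat.{u} R} (hX : T X) {d : ℕ}
  (h0 : ∀ i, i ≠ d → ∀ e : Ext X (ModuleCat.of R R) i, e = 0)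

include hT hX h0

theorem ext_finsupp_eq_zero (M : Type u) {i : ℕ} (hi : i ≠ d)
    (e : Ext X (ModuleCat.of R (M →₀ R)) i) : e = 0 :=
  ext_eq_zero_of_basis hT (N := ModuleCat.of R (M →₀ R)) Finsupp.basisSingleOne hX (h0 i hi) e

/-- Vanishing of `Ext` above the degree `d`, for modules of finite projective dimension. -/
theorem ext_eq_zero_of_lt (hpd : ∃ n : ℕ, HasProjectiveDimensionLT X n) {i : ℕ} (hi : d < i)
    {M : ModuleCat.{u} R} (e : Ext X M i) : e = 0 := by
  obtain ⟨n, hn⟩ := hpd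
  -- Descending induction from the projective dimension: for i > d a free cover F of M has Ext^i(X,
  -- F) = 0, so Ext^i(X, M) embeds in Ext^{i+1} of the kernel. The variable j bounds the distance to
  -- n.
  have key : ∀ j i : ℕ, d < i → n ≤ i + j → ∀ (M : ModuleCat.{u} R) (e : Ext X M i), e = 0 := by
    intro j
    induction j with
    | zero =>
      intro i _ hi M e
      exact Ext.eq_zero_of_hasProjectiveDimensionLT e n hi
    | succ j ih =>
      intro i hi hij M e
      obtain ⟨x, rfl⟩ := Ext.covariant_sequence_exact₃ X
        (LinearMap.shortExact_shortComplexKer (selfPresentation_surjective M)) e rfl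
        (ih (i + 1) (by omega) (by omega) _ _)
      rw [ext_finsupp_eq_zero hT hX h0 M (by omega) x, Ext.zero_comp]
  exact key n i hi (by omega) M e

variable {u : Ext X (ModuleCat.of R R) d} (hu : ∀ e, ∃ x, e = extMul u x)
  (hpd : ∃ n : ℕ, HasProjectiveDimensionLT X n)

include hu

omit h0 in
theorem exists_comp_elemHom_of_basis {N : ModuleCat.{u} R} {I : Type*} (b : Module.Basis I R N)
    (e : Ext X N d) : ∃ m : N, e = u.comp (Ext.mk₀ (elemHom m)) (add_zero d) := by
  induction ext_mem_closure_of_basis hT b d X hX e using AddSubgroup.closure_induction with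
  | mem x hx =>
    obtain ⟨j, v, rfl⟩ := hx
    obtain ⟨x, rfl⟩ := hu v
    exact ⟨x • b j, extMul_comp_elemHom u x (b j)⟩
  | zero =>
    refine ⟨0, ?_⟩
    have : elemHom (0 : N) = 0 := by ext; simp
    rw [this, Ext.mk₀_zero, Ext.comp_zero]
  | add x y _ _ hx hy =>
    obtain ⟨m, rfl⟩ := hx
    obtain ⟨m', rfl⟩ := hy
    refine ⟨m + m', ?_⟩
    rw [← Ext.comp_add, ← Ext.mk₀_add]
    congr 2
    ext; simp
  | neg x _ hx =>
    obtain ⟨m, rfl⟩ := hx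
    refine ⟨-m, ?_⟩
    rw [← Ext.comp_neg, ← Ext.mk₀_neg]
    congr 2
    ext; simp

include hpd in
-- Since Ext^{d+1} vanishes, every class comes from a free cover of M, where u generates.
theorem exists_comp_elemHom {M : ModuleCat.{u} R} (e : Ext X M d) :
    ∃ m : M, e = u.comp (Ext.mk₀ (elemHom m)) (add_zero d) := by
  obtain ⟨x, rfl⟩ := Ext.covariant_sequence_exact₃ X
    (LinearMap.shortExact_shortComplexKer (selfPresentation_surjective M)) e rfl
    (ext_eq_zero_of_lt hT hX h0 hpd (Nat.lt_succ_self d) _)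
  obtain ⟨m, rfl⟩ := exists_comp_elemHom_of_basis hT hX hu
    (N := ModuleCat.of R (M →₀ R)) Finsupp.basisSingleOne x
  exact ⟨selfPresentation M m, by
    rw [Ext.comp_assoc_of_third_deg_zero, Ext.mk₀_comp_mk₀, elemHom_comp]⟩

include hpd in
/-- The kernel of `m ↦ u ∘ (r ↦ r m)` is generated by the elements `x m` with `u x = 0`. -/
theorem mem_closure_of_comp_elemHom_eq_zero {M : ModuleCat.{u} R} (m : M)
    (hm : u.comp (Ext.mk₀ (elemHom m)) (add_zero d) = 0) :
    m ∈ AddSubgroup.closure {m' : M | ∃ (x : R) (y : M), extMul u x = 0 ∧ m' = x • y} := by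
  obtain ⟨p, rfl⟩ := selfPresentation_surjective M m
  have hS := LinearMap.shortExact_shortComplexKer (selfPresentation_surjective M)
  obtain ⟨x, hx⟩ := Ext.covariant_sequence_exact₂ X hS
    (u.comp (Ext.mk₀ (elemHom (N := ModuleCat.of R (M →₀ R)) p)) (add_zero d)) (by
      rw [Ext.comp_assoc_of_third_deg_zero, Ext.mk₀_comp_mk₀, elemHom_comp]
      exact hm)
  -- The class of p comes from the kernel of the cover, where it is again u followed by an element
  -- q. Replacing p by p - q keeps the image in M and makes the class zero on the free module
  -- itself.
  obtain ⟨q, rfl⟩ := exists_comp_elemHom hT hX h0 hu hpd x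
  rw [Ext.comp_assoc_of_third_deg_zero, Ext.mk₀_comp_mk₀, elemHom_comp] at hx
  have h1 : u.comp (Ext.mk₀ (elemHom (N := ModuleCat.of R (M →₀ R)) (p - q.1))) (add_zero d) =
      0 := by
    have : elemHom (N := ModuleCat.of R (M →₀ R)) (p - q.1) =
        elemHom (N := ModuleCat.of R (M →₀ R)) p + -elemHom (N := ModuleCat.of R (M →₀ R)) q.1 := by
      ext1
      refine LinearMap.ext_ring ?_
      change (1 : R) • (p - q.1) = (1 : R) • p + -((1 : R) • q.1)
      simp [sub_eq_add_neg]
    rw [this, Ext.mk₀_add, Ext.mk₀_neg, Ext.comp_add, Ext.comp_neg, add_neg_eq_zero]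
    exact hx.symm
  have h2 : selfPresentation M p = selfPresentation M (p - q.1) := by
    rw [map_sub, LinearMap.mem_ker.1 q.2, sub_zero]
  rw [h2, Finsupp.linearCombination_apply]
  refine sum_mem fun y _ => AddSubgroup.subset_closure ⟨(p - q.1) y, y, ?_, rfl⟩
  -- Projecting to the coordinate y shows that u annihilates each coefficient of p - q.
  have h3 := congrArg (fun e => e.comp (Ext.mk₀ (ModuleCat.ofHom
    (Finsupp.lapply (R := R) y : (M →₀ R) →ₗ[R] R))) (add_zero d)) h1
  rw [Ext.comp_assoc_of_third_deg_zero, Ext.mk₀_comp_mk₀, elemHom_comp, Ext.zero_comp] at h3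
  exact h3

end Vanishing

end HopfDuality

namespace HopfDuality

/-! ### The Hopf isomorphisms B ⊗ B ≃ B ⊗ Bᵒᵖ -/

section Coalgebra

open Coalgebra

variable {k C W : Type*} [CommRing k] [AddCommGroup C] [Module k C] [Coalgebra k C]
  [AddCommGroup W] [Module k W]

/-- The map `b ⊗ w ↦ b₁ ⊗ P(b₂) w`. -/
noncomputable def coactRight (P : C →ₗ[k] Module.End k W) : C ⊗[k] W →ₗ[k] C ⊗[k] W :=
  TensorProduct.lift (LinearMap.mk₂ k (fun b w => (P.flip w).lTensor C (comul b))
    (fun b b' w => by simp) (fun c b w => by simp)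
    (fun b w w' => by simp [LinearMap.lTensor_add]) (fun c b w => by simp [LinearMap.lTensor_smul]))

/-- The map `b ⊗ w ↦ b₂ ⊗ P(b₁) w`. -/
noncomputable def coactLeft (P : C →ₗ[k] Module.End k W) : C ⊗[k] W →ₗ[k] C ⊗[k] W :=
  TensorProduct.lift (LinearMap.mk₂ k
    (fun b w => TensorProduct.comm k W C ((P.flip w).rTensor C (comul b)))
    (fun b b' w => by simp) (fun c b w => by simp)
    (fun b w w' => by simp [LinearMap.rTensor_add]) (fun c b w => by simp [LinearMap.rTensor_smul]))

theorem coactRight_tmul (P : C →ₗ[k] Module.End k W) (b : C) (w : W) :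
    coactRight P (b ⊗ₜ w) = (P.flip w).lTensor C (comul b) := rfl

theorem coactLeft_tmul (P : C →ₗ[k] Module.End k W) (b : C) (w : W) :
    coactLeft P (b ⊗ₜ w) = TensorProduct.comm k W C ((P.flip w).rTensor C (comul b)) := rfl

/-- The map `b ⊗ b' ↦ P(b) Q(b') w`. -/
noncomputable def bilinAct (P Q : C →ₗ[k] Module.End k W) (w : W) : C ⊗[k] C →ₗ[k] W :=
  TensorProduct.lift (P.compl₂ (Q.flip w))

omit [Coalgebra k C] in
theorem bilinAct_tmul (P Q : C →ₗ[k] Module.End k W) (w : W) (b b' : C) :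
    bilinAct P Q w (b ⊗ₜ b') = P b (Q b' w) := rfl

/-- By coassociativity the composite sends b ⊗ w to b₁ ⊗ P(b₂)Q(b₃)w, and `H`, which makes P a
convolution left inverse of Q, collapses it to b ⊗ w. -/
theorem coactRight_coactRight {P Q : C →ₗ[k] Module.End k W}
    (H : ∀ b w, bilinAct P Q w (comul b) = counit (R := k) b • w) (x : C ⊗[k] W) :
    coactRight P (coactRight Q x) = x := by
  induction x with
  | zero => simp
  | add x y hx hy => rw [map_add, map_add, hx, hy]
  | tmul b w =>
    have h1 : ∀ z : C ⊗[k] C, coactRight P ((Q.flip w).lTensor C z) =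
        (bilinAct P Q w).lTensor C (TensorProduct.assoc k C C C (comul.rTensor C z)) := by
      intro z
      induction z with
      | zero => simp
      | add x y hx hy => simp only [map_add, hx, hy]
      | tmul a a' =>
        simp only [LinearMap.lTensor_tmul, LinearMap.rTensor_tmul, coactRight_tmul]
        induction comul (R := k) a with
        | zero => simp
        | add x y hx hy => simp only [map_add, TensorProduct.add_tmul, hx, hy]
        | tmul c c' => rfl
    rw [coactRight_tmul, h1, coassoc_apply, ← LinearMap.comp_apply, ← LinearMap.lTensor_comp]
    have h2 : bilinAct P Q w ∘ₗ comul =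
        (LinearMap.toSpanSingleton k W w) ∘ₗ counit (R := k) (A := C) := LinearMap.ext fun b => H b w
    rw [h2, LinearMap.lTensor_comp, LinearMap.comp_apply, lTensor_counit_comul]
    simp

/-- Here the composite is b₃ ⊗ P(b₂)Q(b₁)w; the factors occur in reversed order, which is why `H`
involves the flipped comultiplication and why S⁻¹ will be required. -/
theorem coactLeft_coactLeft {P Q : C →ₗ[k] Module.End k W}
    (H : ∀ b w, bilinAct P Q w (TensorProduct.comm k C C (comul b)) = counit (R := k) b • w)
    (x : C ⊗[k] W) : coactLeft P (coactLeft Q x) = x := by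
  induction x with
  | zero => simp
  | add x y hx hy => rw [map_add, map_add, hx, hy]
  | tmul b w =>
    have h1 : ∀ z : C ⊗[k] C, coactLeft P (TensorProduct.comm k W C ((Q.flip w).rTensor C z)) =
        TensorProduct.comm k W C (((bilinAct P Q w) ∘ₗ
          (TensorProduct.comm k C C).toLinearMap).rTensor C
          ((TensorProduct.assoc k C C C).symm (comul.lTensor C z))) := by
      intro z
      induction z with
      | zero => simp
      | add x y hx hy => simp only [map_add, hx, hy]
      | tmul a a' =>
        simp only [LinearMap.lTensor_tmul, LinearMap.rTensor_tmul, coactLeft_tmul,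
          TensorProduct.comm_tmul]
        congr 1
        induction comul (R := k) a' with
        | zero => simp
        | add x y hx hy => simp only [map_add, TensorProduct.tmul_add, hx, hy]
        | tmul c c' => rfl
    rw [coactLeft_tmul, h1, coassoc_symm_apply, ← LinearMap.comp_apply (LinearMap.rTensor _ _),
      ← LinearMap.rTensor_comp]
    have h2 : (bilinAct P Q w ∘ₗ (TensorProduct.comm k C C).toLinearMap) ∘ₗ comul =
        (LinearMap.toSpanSingleton k W w) ∘ₗ counit (R := k) (A := C) := LinearMap.ext fun b => H b w
    rw [h2, LinearMap.rTensor_comp, LinearMap.comp_apply, rTensor_counit_comul]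
    simp

end Coalgebra

section Hopf

open Coalgebra HopfAlgebra

variable (k : Type*) (B : Type*) [CommRing k] [Ring B] [HopfAlgebra k B]

/-- The algebra map `B → B ⊗ Bᵒᵖ`, `b ↦ b₁ ⊗ S(b₂)`. -/
noncomputable def hopfDelta : B →ₐ[k] B ⊗[k] Bᵐᵒᵖ :=
  (Algebra.TensorProduct.map (AlgHom.id k B) (antipodeAlgHomOp k B)).comp (Bialgebra.comulAlgHom k B)

theorem hopfDelta_apply (b : B) : hopfDelta k B b =
    TensorProduct.map LinearMap.id ((opLinearEquiv k).toLinearMap ∘ₗ antipode k) (comul b) := rfl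

variable {k B}

theorem bilinAct_antipode_left (b w : B) : bilinAct (LinearMap.mul k B ∘ₗ antipode k)
    (LinearMap.mul k B) w (comul b) = counit (R := k) b • w := by
  have h : ∀ z : B ⊗[k] B, bilinAct (LinearMap.mul k B ∘ₗ antipode k) (LinearMap.mul k B) w z =
      LinearMap.mul' k B ((antipode k).rTensor B z) * w := by
    intro z
    induction z with
    | zero => simp
    | add x y hx hy => simp only [map_add, hx, hy, add_mul]
    | tmul a a' => simp [bilinAct_tmul, mul_assoc]
  rw [h, mul_antipode_rTensor_comul_apply, Algebra.smul_def]

theorem bilinAct_antipode_right (b w : B) : bilinAct (LinearMap.mul k B)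
    (LinearMap.mul k B ∘ₗ antipode k) w (comul b) = counit (R := k) b • w := by
  have h : ∀ z : B ⊗[k] B, bilinAct (LinearMap.mul k B) (LinearMap.mul k B ∘ₗ antipode k) w z =
      LinearMap.mul' k B ((antipode k).lTensor B z) * w := by
    intro z
    induction z with
    | zero => simp
    | add x y hx hy => simp only [map_add, hx, hy, add_mul]
    | tmul a a' => simp [bilinAct_tmul, mul_assoc]
  rw [h, mul_antipode_lTensor_comul_apply, Algebra.smul_def]

/-- For right multiplications w S²(b₂) S(b₁) = w S(b₁ S(b₂)), so S² does the job of an inverse and S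
need not be bijective. -/
theorem bilinAct_antipode_mulRight (b w : B) :
    bilinAct ((LinearMap.mul k B).flip ∘ₗ antipode k)
      ((LinearMap.mul k B).flip ∘ₗ antipode k ∘ₗ antipode k) w (comul b) =
      counit (R := k) b • w := by
  have h : ∀ z : B ⊗[k] B, bilinAct ((LinearMap.mul k B).flip ∘ₗ antipode k)
      ((LinearMap.mul k B).flip ∘ₗ antipode k ∘ₗ antipode k) w z =
      w * antipode k (LinearMap.mul' k B ((antipode k).lTensor B z)) := by
    intro z
    induction z with
    | zero => simp
    | add x y hx hy => simp only [map_add, hx, hy, mul_add]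
    | tmul a a' => simp [bilinAct_tmul, mul_assoc, antipode_mul_antidistrib]
  rw [h, mul_antipode_lTensor_comul_apply, Algebra.algebraMap_eq_smul_one, map_smul, antipode_one,
    mul_smul_comm, mul_one]

theorem bilinAct_mulRight_antipode (b w : B) :
    bilinAct ((LinearMap.mul k B).flip ∘ₗ antipode k ∘ₗ antipode k)
      ((LinearMap.mul k B).flip ∘ₗ antipode k) w (comul b) =
      counit (R := k) b • w := by
  have h : ∀ z : B ⊗[k] B, bilinAct ((LinearMap.mul k B).flip ∘ₗ antipode k ∘ₗ antipode k)
      ((LinearMap.mul k B).flip ∘ₗ antipode k) w z =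
      w * antipode k (LinearMap.mul' k B ((antipode k).rTensor B z)) := by
    intro z
    induction z with
    | zero => simp
    | add x y hx hy => simp only [map_add, hx, hy, mul_add]
    | tmul a a' => simp [bilinAct_tmul, mul_assoc, antipode_mul_antidistrib]
  rw [h, mul_antipode_rTensor_comul_apply, Algebra.algebraMap_eq_smul_one, map_smul, antipode_one,
    mul_smul_comm, mul_one]

section Bijective

variable (hS : Function.Bijective (antipode k (A := B)))

/-- Apply S⁻¹ to S(b₁) b₂ = ε(b): as S⁻¹ reverses products this reads S⁻¹(b₂) b₁ = ε(b). -/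
theorem bilinAct_antipodeInv_left (b w : B) :
    bilinAct (LinearMap.mul k B ∘ₗ (LinearEquiv.ofBijective (antipode k) hS).symm.toLinearMap)
      (LinearMap.mul k B) w (TensorProduct.comm k B B (comul b)) = counit (R := k) b • w := by
  have h : ∀ z : B ⊗[k] B, bilinAct
      (LinearMap.mul k B ∘ₗ (LinearEquiv.ofBijective (antipode k) hS).symm.toLinearMap)
      (LinearMap.mul k B) w (TensorProduct.comm k B B z) =
      (LinearEquiv.ofBijective (antipode k) hS).symm
        (LinearMap.mul' k B ((antipode k).rTensor B z)) * w := by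
    intro z
    induction z with
    | zero => simp
    | add x y hx hy => simp only [map_add, hx, hy, add_mul]
    | tmul a a' =>
      simp only [TensorProduct.comm_tmul, bilinAct_tmul, LinearMap.rTensor_tmul,
        LinearMap.mul'_apply, LinearMap.comp_apply, LinearMap.mul_apply', LinearEquiv.coe_coe]
      rw [← mul_assoc]
      congr 1
      rw [LinearEquiv.eq_symm_apply, LinearEquiv.ofBijective_apply, antipode_mul_antidistrib]
      congr 1
      exact (LinearEquiv.ofBijective (antipode k) hS).apply_symm_apply a'
  rw [h, mul_antipode_rTensor_comul_apply, Algebra.algebraMap_eq_smul_one, map_smul]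
  have : (LinearEquiv.ofBijective (antipode k) hS).symm 1 = 1 := by
    rw [LinearEquiv.symm_apply_eq, LinearEquiv.ofBijective_apply, antipode_one]
  rw [this, smul_mul_assoc, one_mul]

theorem bilinAct_left_antipodeInv (b w : B) :
    bilinAct (LinearMap.mul k B) (LinearMap.mul k B ∘ₗ
      (LinearEquiv.ofBijective (antipode k) hS).symm.toLinearMap)
      w (TensorProduct.comm k B B (comul b)) = counit (R := k) b • w := by
  have h : ∀ z : B ⊗[k] B, bilinAct (LinearMap.mul k B)
      (LinearMap.mul k B ∘ₗ (LinearEquiv.ofBijective (antipode k) hS).symm.toLinearMap)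
      w (TensorProduct.comm k B B z) =
      (LinearEquiv.ofBijective (antipode k) hS).symm
        (LinearMap.mul' k B ((antipode k).lTensor B z)) * w := by
    intro z
    induction z with
    | zero => simp
    | add x y hx hy => simp only [map_add, hx, hy, add_mul]
    | tmul a a' =>
      simp only [TensorProduct.comm_tmul, bilinAct_tmul, LinearMap.lTensor_tmul,
        LinearMap.mul'_apply, LinearMap.comp_apply, LinearMap.mul_apply', LinearEquiv.coe_coe]
      rw [← mul_assoc]
      congr 1
      rw [LinearEquiv.eq_symm_apply, LinearEquiv.ofBijective_apply, antipode_mul_antidistrib]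
      congr 1
      exact (LinearEquiv.ofBijective (antipode k) hS).apply_symm_apply a
  rw [h, mul_antipode_lTensor_comul_apply, Algebra.algebraMap_eq_smul_one, map_smul]
  have : (LinearEquiv.ofBijective (antipode k) hS).symm 1 = 1 := by
    rw [LinearEquiv.symm_apply_eq, LinearEquiv.ofBijective_apply, antipode_one]
  rw [this, smul_mul_assoc, one_mul]

end Bijective

/-- The isomorphism `b ⊗ y ↦ (1 ⊗ y) δ(b)`. -/
theorem exists_equiv_mul_delta : ∃ e : B ⊗[k] B ≃ₗ[k] B ⊗[k] Bᵐᵒᵖ, ∀ b y,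
    e (b ⊗ₜ y) = (1 ⊗ₜ op y) * hopfDelta k B b := by
  let e : B ⊗[k] B ≃ₗ[k] B ⊗[k] B :=
    LinearEquiv.ofLinearMap (coactRight (LinearMap.mul k B ∘ₗ antipode k))
      (coactRight (LinearMap.mul k B))
      (LinearMap.ext (coactRight_coactRight bilinAct_antipode_left))
      (LinearMap.ext (coactRight_coactRight bilinAct_antipode_right))
  refine ⟨e.trans (TensorProduct.congr (LinearEquiv.refl k B) (opLinearEquiv k)), fun b y => ?_⟩
  · simp only [e, LinearEquiv.trans_apply, LinearEquiv.coe_ofLinearMap, coactRight_tmul,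
      hopfDelta_apply]
    induction comul (R := k) b with
    | zero => simp
    | add x y hx hy => simp only [map_add, hx, hy, mul_add]
    | tmul a a' => simp

/-- The isomorphism `b ⊗ y ↦ δ(b) (1 ⊗ y)`. -/
theorem exists_equiv_delta_mul_right : ∃ e : B ⊗[k] B ≃ₗ[k] B ⊗[k] Bᵐᵒᵖ, ∀ b y,
    e (b ⊗ₜ y) = hopfDelta k B b * (1 ⊗ₜ op y) := by
  let e : B ⊗[k] B ≃ₗ[k] B ⊗[k] B :=
    LinearEquiv.ofLinearMap (coactRight ((LinearMap.mul k B).flip ∘ₗ antipode k))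
      (coactRight ((LinearMap.mul k B).flip ∘ₗ antipode k ∘ₗ antipode k))
      (LinearMap.ext (coactRight_coactRight bilinAct_antipode_mulRight))
      (LinearMap.ext (coactRight_coactRight bilinAct_mulRight_antipode))
  refine ⟨e.trans (TensorProduct.congr (LinearEquiv.refl k B) (opLinearEquiv k)), fun b y => ?_⟩
  · simp only [e, LinearEquiv.trans_apply, LinearEquiv.coe_ofLinearMap, coactRight_tmul,
      hopfDelta_apply]
    induction comul (R := k) b with
    | zero => simp
    | add x y hx hy => simp only [map_add, hx, hy, add_mul]
    | tmul a a' => simp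

/-- The isomorphism `b ⊗ x ↦ δ(b) (x ⊗ 1)`. -/
theorem exists_equiv_delta_mul_left (hS : Function.Bijective (antipode k (A := B))) :
    ∃ e : B ⊗[k] B ≃ₗ[k] B ⊗[k] Bᵐᵒᵖ, ∀ b x,
    e (b ⊗ₜ x) = hopfDelta k B b * (x ⊗ₜ 1) := by
  let e : B ⊗[k] B ≃ₗ[k] B ⊗[k] B :=
    LinearEquiv.ofLinearMap (coactLeft (LinearMap.mul k B))
      (coactLeft (LinearMap.mul k B ∘ₗ
        (LinearEquiv.ofBijective (antipode k) hS).symm.toLinearMap))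
      (LinearMap.ext (coactLeft_coactLeft (bilinAct_left_antipodeInv hS)))
      (LinearMap.ext (coactLeft_coactLeft (bilinAct_antipodeInv_left hS)))
  -- δ(b)(x ⊗ 1) = b₁ x ⊗ S(b₂) is `coactLeft` followed by a flip and by S on the second factor, so
  -- S has to be bijective.
  refine ⟨(e.trans (TensorProduct.comm k B B)).trans
    (TensorProduct.congr (LinearEquiv.refl k B)
      ((LinearEquiv.ofBijective (antipode k) hS).trans (opLinearEquiv k))), fun b y => ?_⟩
  · simp only [e, LinearEquiv.trans_apply, LinearEquiv.coe_ofLinearMap, coactLeft_tmul,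
      hopfDelta_apply]
    induction comul (R := k) b with
    | zero => simp
    | add x y hx hy => simp only [map_add, hx, hy, add_mul]
    | tmul a a' => simp

end Hopf

end HopfDuality

namespace HopfDuality

open Abelian

/-! ### Ext of the regular bimodule of a Hopf algebra -/

section Generator

variable {k B : Type u} [Field k] [Ring B] [Algebra k B]

theorem smul_ext_eq_extMul {X : ModuleCat.{u} B} {i : ℕ} (v : Ext X (ModuleCat.of B B) i) (c : k) :
    c • v = extMul v (algebraMap k B c) := by
  rw [Ext.smul_eq_comp_mk₀, extMul]
  congr 2
  ext1
  refine LinearMap.ext_ring ?_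
  change algebraMap k B c * 1 = 1 * algebraMap k B c
  rw [one_mul, mul_one]

/-- If `Ext i X B` is the line spanned by `v`, then `Ext i X N` is freely generated by `v` over
a space `Y` that spans the free module `N` over `B`. -/
theorem comp_elemHom_bijective {T : ModuleCat.{u} B → Prop} (hT : SyzygyClosed T)
    {X : ModuleCat.{u} B} (hX : T X) {i : ℕ} {v : Ext X (ModuleCat.of B B) i}
    (hv : ∀ e : Ext X (ModuleCat.of B B) i, ∃ c : k, e = c • v)
    (hv0 : ∀ c : k, c • v = 0 → c = 0)
    {N : ModuleCat.{u} B} {I Y : Type*} (b : Module.Basis I B N) [AddCommGroup Y] [Module k Y]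
    (y : Module.Basis I k Y) (q : Y →+ N) (hq : ∀ (c : k) y, q (c • y) = algebraMap k B c • q y)
    (hqb : ∀ j, q (y j) = b j) :
    Function.Bijective fun z : Y => v.comp (Ext.mk₀ (elemHom (q z))) (add_zero i) := by
  let φ : Y →+ Ext X N i := AddMonoidHom.mk'
    (fun z : Y => v.comp (Ext.mk₀ (elemHom (q z))) (add_zero i)) fun z z' => by
      rw [← Ext.comp_add, ← Ext.mk₀_add]
      congr 2
      ext1
      refine LinearMap.ext_ring ?_
      change (1 : B) • q (z + z') = (1 : B) • q z + (1 : B) • q z'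
      simp
  change Function.Bijective φ
  constructor
  · rw [injective_iff_map_eq_zero]
    intro z hz
    refine y.repr.injective (Finsupp.ext fun j => ?_)
    rw [map_zero, Finsupp.zero_apply]
    refine hv0 _ ?_
    have h1 := congrArg (fun e => e.comp (Ext.mk₀ (ModuleCat.ofHom (b.coord j))) (add_zero i)) hz
    change (v.comp (Ext.mk₀ (elemHom (q z))) (add_zero i)).comp _ _ = _ at h1
    rw [Ext.comp_assoc_of_third_deg_zero, Ext.mk₀_comp_mk₀, elemHom_comp, Ext.zero_comp] at h1
    rw [smul_ext_eq_extMul, ← h1]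
    have h2 : ∀ z, b.repr (q z) = (y.repr z).mapRange (algebraMap k B) (map_zero _) := by
      intro z
      rw [← y.linearCombination_repr z]
      generalize y.repr z = s
      induction s using Finsupp.induction_linear with
      | zero => simp
      | add s t hs ht => simp only [map_add, hs, ht, Finsupp.mapRange_add (map_add _)]
      | single j c =>
        rw [Finsupp.linearCombination_single, hq, hqb, map_smul, b.repr_self,
          Finsupp.smul_single, smul_eq_mul, mul_one, map_smul, y.repr_self,
          Finsupp.smul_single, smul_eq_mul, mul_one, Finsupp.mapRange_single]
    have h3 : algebraMap k B (y.repr z j) = b.coord j (q z) := (DFunLike.congr_fun (h2 z) j).symm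
    rw [h3]
  · intro e
    change e ∈ φ.range
    refine (AddSubgroup.closure_le _).2 ?_ (ext_mem_closure_of_basis hT b i X hX e)
    rintro _ ⟨j, w, rfl⟩
    obtain ⟨c, rfl⟩ := hv w
    refine ⟨c • y j, ?_⟩
    change v.comp (Ext.mk₀ (elemHom (q (c • y j)))) (add_zero i) = _
    rw [hq, hqb, smul_ext_eq_extMul, extMul_comp_elemHom]

variable (k B) in
/-- `B` as a left module over `B ⊗ Bᵒᵖ`, with `(a ⊗ b) x = a x b`. -/
noncomputable def regularBimodule : ModuleCat.{u} (B ⊗[k] Bᵐᵒᵖ) :=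
  @ModuleCat.of (B ⊗[k] Bᵐᵒᵖ) _ B _ TensorProduct.Algebra.module

/-- An element of `B` in the regular bimodule. -/
def toRegular (x : B) : regularBimodule k B := x

theorem smul_toRegular (a b : B) (x : B) :
    (a ⊗ₜ[k] op b) • toRegular (k := k) x = toRegular (k := k) (a * (x * b)) :=
  TensorProduct.Algebra.smul_def a (op b) x

/-- `y ↦ 1 ⊗ y`. -/
noncomputable def rightIncl : B →ₗ[k] B ⊗[k] Bᵐᵒᵖ :=
  TensorProduct.mk k B Bᵐᵒᵖ 1 ∘ₗ (opLinearEquiv k).toLinearMap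

/-- `x ↦ x ⊗ 1`. -/
noncomputable def leftIncl : B →ₗ[k] B ⊗[k] Bᵐᵒᵖ :=
  (TensorProduct.mk k B Bᵐᵒᵖ).flip 1

theorem extMul_zero_right {R : Type u} [Ring R] {X : ModuleCat.{u} R} {i : ℕ}
    (e : Ext X (ModuleCat.of R R) i) : extMul e 0 = 0 := by
  have h := extMul_add e 0 0
  rwa [add_zero, left_eq_add] at h

end Generator

section HopfExt

open Coalgebra HopfAlgebra

variable (k B : Type u) [Field k] [Ring B] [HopfAlgebra k B]

variable {k B}

/-- The adjoint action on scalars is b₁ c S(b₂) = ε(b) c, so the unit k → B is linear over δ. -/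
theorem hopfDelta_smul (b : B) (c : k) :
    hopfDelta k B b • toRegular (k := k) (algebraMap k B c) =
      toRegular (k := k) (algebraMap k B (counit b * c)) := by
  have h : ∀ z : B ⊗[k] B, (TensorProduct.map LinearMap.id
      ((opLinearEquiv k).toLinearMap ∘ₗ antipode k) z) • toRegular (k := k) (algebraMap k B c) =
      toRegular (k := k)
        (LinearMap.mul' k B ((antipode k).lTensor B z) * algebraMap k B c) := by
    intro z
    induction z with
    | zero =>
      rw [map_zero, map_zero, map_zero, zero_mul]
      exact zero_smul (B ⊗[k] Bᵐᵒᵖ) (toRegular (k := k) (algebraMap k B c))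
    | add x y hx hy =>
      rw [map_add, map_add, map_add, add_mul]
      exact (add_smul (R := B ⊗[k] Bᵐᵒᵖ) _ _ _).trans (congrArg₂ (· + ·) hx hy)
    | tmul a a' =>
      refine (smul_toRegular a (antipode k a') _).trans ?_
      rw [LinearMap.lTensor_tmul, LinearMap.mul'_apply, Algebra.commutes c (antipode k a'),
        mul_assoc]
  rw [hopfDelta_apply, h, mul_antipode_lTensor_comul_apply, map_mul]

/-- The `B`-linear map `k → B`, `c ↦ c`, to `B` with the adjoint action `b₁ x S(b₂)`. -/
noncomputable def unitHom {χ : B →+* k} (hχ : ∀ b, χ b = counit (R := k) b) :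
    (ModuleCat.restrictScalars χ).obj (ModuleCat.of k k) ⟶
      (ModuleCat.restrictScalars (hopfDelta k B).toRingHom).obj (regularBimodule k B) :=
  homOfSemilinear (X := (ModuleCat.restrictScalars χ).obj (ModuleCat.of k k))
    (Y := regularBimodule k B) (f := (hopfDelta k B).toRingHom)
    (algebraMap k B : k →+ B) fun b (c : k) => by
      refine Eq.trans ?_ (hopfDelta_smul b c).symm
      rw [← hχ]
      rfl

/-- Bᵉ is free as a right B-module through δ, by the isomorphism b ⊗ y ↦ (1 ⊗ y) δ(b). -/
theorem scalarBasisMap_delta_bijective {I : Type*} (y : Module.Basis I k B) :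
    Function.Bijective (scalarBasisMap (hopfDelta k B).toRingHom
      fun j => (1 : B) ⊗ₜ[k] op (y j)) := by
  classical
  obtain ⟨e, he⟩ := exists_equiv_mul_delta (k := k) (B := B)
  have h : ∀ r, scalarBasisMap (hopfDelta k B).toRingHom (fun j => (1 : B) ⊗ₜ[k] op (y j)) r =
      e ((TensorProduct.equivFinsuppOfBasisRight y).symm r) := by
    intro r
    induction r using Finsupp.induction_linear with
    | zero => simp
    | add p q hp hq => simp only [map_add, hp, hq]
    | single j b =>
      rw [scalarBasisMap_single, TensorProduct.equivFinsuppOfBasisRight_symm_apply,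
        Finsupp.sum_single_index (by simp), he]
      rfl
  convert (((TensorProduct.equivFinsuppOfBasisRight y).symm.trans e).bijective) using 1
  exact funext h

/-- Since (1 ⊗ y) · 1 = y, the map is the expansion of B in the basis y. Thus B is the module
induced from k along δ. -/
theorem basisMap_unitHom_bijective {χ : B →+* k} (hχ : ∀ b, χ b = counit (R := k) b)
    {I : Type*} (y : Module.Basis I k B) :
    Function.Bijective (basisMap (fun j => (1 : B) ⊗ₜ[k] op (y j)) (unitHom hχ)) := by
  have h : ∀ r : I →₀ k, basisMap (fun j => (1 : B) ⊗ₜ[k] op (y j)) (unitHom hχ) r =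
      y.repr.symm r := by
    intro r
    induction r using Finsupp.induction_linear with
    | zero => exact (map_zero _).trans (map_zero y.repr.symm).symm
    | add p q hp hq =>
      refine ((basisMap (fun j => (1 : B) ⊗ₜ[k] op (y j)) (unitHom hχ)).map_add p q).trans ?_
      rw [hp, hq, map_add]
      rfl
    | single j c =>
      refine (basisMap_single _ (unitHom hχ) j c).trans
        ((smul_toRegular 1 (y j) (algebraMap k B c)).trans ?_)
      rw [one_mul, Module.Basis.repr_symm_single, Algebra.smul_def]
      rfl
  have h' : ⇑(basisMap (fun j => (1 : B) ⊗ₜ[k] op (y j)) (unitHom hχ)) = y.repr.symm := funext h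
  rw [h']
  exact y.repr.symm.bijective

/-- A basis of `B ⊗ Bᵒᵖ` as a left module over `B` through `δ`. -/
theorem exists_basis_delta {q : B →ₗ[k] B ⊗[k] Bᵐᵒᵖ} {e : B ⊗[k] B ≃ₗ[k] B ⊗[k] Bᵐᵒᵖ}
    (he : ∀ b y, e (b ⊗ₜ y) = hopfDelta k B b * q y) {I : Type*} (y : Module.Basis I k B) :
    ∃ b : Module.Basis I B ((ModuleCat.restrictScalars (hopfDelta k B).toRingHom).obj
      (ModuleCat.of (B ⊗[k] Bᵐᵒᵖ) (B ⊗[k] Bᵐᵒᵖ))), ∀ j, b j = q (y j) := by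
  classical
  let N := (ModuleCat.restrictScalars (hopfDelta k B).toRingHom).obj
      (ModuleCat.of (B ⊗[k] Bᵐᵒᵖ) (B ⊗[k] Bᵐᵒᵖ))
  let L : (I →₀ B) →ₗ[B] N := Finsupp.linearCombination B fun j => (q (y j) : N)
  have h : ∀ r, L r = e ((TensorProduct.equivFinsuppOfBasisRight y).symm r) := by
    intro r
    induction r using Finsupp.induction_linear with
    | zero => simp; rfl
    | add p q hp hq =>
      rw [map_add, hp, hq, map_add, map_add]; rfl
    | single j b =>
      rw [TensorProduct.equivFinsuppOfBasisRight_symm_apply,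
        Finsupp.sum_single_index (by simp), he]
      exact Finsupp.linearCombination_single B b j
  have hL : Function.Bijective L := by
    have h' : ⇑L = _ := funext h
    rw [h']
    exact ((TensorProduct.equivFinsuppOfBasisRight y).symm.trans e).bijective
  refine ⟨Module.Basis.ofRepr (LinearEquiv.ofBijective L hL).symm, fun j => ?_⟩
  change L (Finsupp.single j 1) = _
  exact (Finsupp.linearCombination_single B 1 j).trans (one_smul B (show N from q (y j)))

variable {χ : B →+* k} (hχ : ∀ b, χ b = counit (R := k) b) (hB : IsNoetherianRing B) {d : ℕ}
  (hS : Function.Bijective (antipode k (A := B)))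
  (h0 : ∀ i, i ≠ d → ∀ e : Ext ((ModuleCat.restrictScalars χ).obj (ModuleCat.of k k))
    (ModuleCat.of B B) i, e = 0)
  (hd : Nonempty (Ext ((ModuleCat.restrictScalars χ).obj (ModuleCat.of k k))
    (ModuleCat.of B B) d ≃ₗ[k] k))

omit [HopfAlgebra k B] in
theorem finite_restrictScalars (hχ : Function.Surjective χ) :
    Module.Finite B ((ModuleCat.restrictScalars χ).obj (ModuleCat.of k k)) := by
  classical
  refine ⟨⟨{(1 : k)}, ?_⟩⟩
  rw [eq_top_iff]
  rintro c -
  obtain ⟨b, hb⟩ := hχ c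
  have h1 : b • (show (ModuleCat.restrictScalars χ).obj (ModuleCat.of k k) from (1 : k)) = c :=
    (mul_one (χ b)).trans hb
  rw [← h1]
  exact Submodule.smul_mem _ b (Submodule.subset_span (Finset.mem_coe.2 (Finset.mem_singleton_self _)))

theorem counit_surjective (hχ : ∀ b, χ b = counit (R := k) b) : Function.Surjective χ := fun c =>
  ⟨algebraMap k B c, by rw [hχ, Bialgebra.counit_algebraMap]⟩

include hχ hB h0 in
-- Base change turns the group into Ext of k over B with values in Bᵉ, which is free as a left
-- B-module through δ.
theorem ext_regularBimodule_eq_zero {i : ℕ} (hi : i ≠ d)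
    (e : Ext (regularBimodule k B) (ModuleCat.of (B ⊗[k] Bᵐᵒᵖ) (B ⊗[k] Bᵐᵒᵖ)) i) : e = 0 := by
  let y := Module.Basis.ofVectorSpace k B
  refine (extBaseChange_bijective_of_basis (scalarBasisMap_delta_bijective y) (unitHom hχ)
    (basisMap_unitHom_bijective hχ y) _ i).1 ?_
  rw [map_zero]
  obtain ⟨e', he'⟩ := exists_equiv_delta_mul_right (k := k) (B := B)
  obtain ⟨b, -⟩ := exists_basis_delta (q := rightIncl) he' y
  exact ext_eq_zero_of_basis (syzygyClosed_finite hB) b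
    (finite_restrictScalars (counit_surjective hχ)) (h0 i hi) _

include hχ hB hd hS in
-- Two k-subspaces of Bᵉ, B ⊗ 1 and 1 ⊗ B, span it freely over B through δ. One class v, coming from
-- the line Ext^d(k, B), therefore generates freely over either of them.
theorem exists_generator_regularBimodule : ∃ v : Ext (regularBimodule k B)
    (ModuleCat.of (B ⊗[k] Bᵐᵒᵖ) (B ⊗[k] Bᵐᵒᵖ)) d,
    (Function.Bijective fun x : B => extMul v (leftIncl (k := k) x)) ∧
    Function.Bijective fun y : B => extMul v (rightIncl (k := k) y) := by
  let y := Module.Basis.ofVectorSpace k B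
  obtain ⟨φ⟩ := hd
  have hbc := extBaseChange_bijective_of_basis (scalarBasisMap_delta_bijective y) (unitHom hχ)
    (basisMap_unitHom_bijective hχ y) (ModuleCat.of (B ⊗[k] Bᵐᵒᵖ) (B ⊗[k] Bᵐᵒᵖ)) d
  let w := φ.symm 1
  have hw : ∀ e, ∃ c : k, e = c • w := fun e => ⟨φ e, φ.injective (by simp [w])⟩
  have hw0 : ∀ c : k, c • w = 0 → c = 0 := fun c hc => by
    have := congrArg φ hc
    simpa [w] using this
  -- v corresponds to the generator w pushed forward along δ : B → Bᵉ; it is chosen before the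
  -- subspace, so it serves both.
  obtain ⟨v, hv⟩ := hbc.2 (w.comp (Ext.mk₀ (reductionHom (hopfDelta k B).toRingHom)) (add_zero d))
  have key : ∀ (q : B →ₗ[k] B ⊗[k] Bᵐᵒᵖ) (e : B ⊗[k] B ≃ₗ[k] B ⊗[k] Bᵐᵒᵖ),
      (∀ b y, e (b ⊗ₜ y) = hopfDelta k B b * q y) →
      Function.Bijective fun x : B => extMul v (q x) := by
    intro q e he
    obtain ⟨b, hb⟩ := exists_basis_delta he y
    have h1 := comp_elemHom_bijective (syzygyClosed_finite hB)
      (finite_restrictScalars (counit_surjective hχ)) hw hw0 b y q.toAddMonoidHom (fun c x => by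
        change q (c • x) = hopfDelta k B (algebraMap k B c) * q x
        rw [q.map_smul, AlgHom.commutes]
        exact Algebra.smul_def c (q x)) (fun j => (hb j).symm)
    refine (Function.Bijective.of_comp_iff' hbc _).1 ?_
    convert h1 using 1
    funext x
    change extBaseChange _ _ _ d (extMul v (q x)) = _
    rw [extMul, extBaseChange_comp_mk₀, hv, Ext.comp_assoc_of_third_deg_zero, Ext.mk₀_comp_mk₀]
    congr 2
  obtain ⟨e₁, he₁⟩ := exists_equiv_delta_mul_left hS
  obtain ⟨e₂, he₂⟩ := exists_equiv_delta_mul_right (k := k) (B := B)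
  exact ⟨v, key leftIncl e₁ he₁, key rightIncl e₂ he₂⟩

end HopfExt

end HopfDuality

namespace HopfDuality

/-! ### Reduction modulo h of tensor products and completions -/

section Reduction

variable {K k : Type*} [CommRing K] [CommRing k] {σ : K →+* k} {h : K}

/-- `f` identifies `N` with `M / hM`. -/
structure IsReduction {M N : Type*} [AddCommGroup M] [Module K M] [AddCommGroup N] [Module k N]
    (h : K) (f : M →ₛₗ[σ] N) : Prop where
  surj : Function.Surjective f
  ker : ∀ x, f x = 0 ↔ ∃ y, x = h • y

/-- The kernel is found from a map L in the other direction, from N ⊗ N' to (M ⊗ M')/h. -/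
theorem IsReduction.tensor {M N M' N' : Type*} [AddCommGroup M] [Module K M] [AddCommGroup N]
    [Module k N] [AddCommGroup M'] [Module K M'] [AddCommGroup N'] [Module k N']
    (hσ : Function.Surjective σ) {f : M →ₛₗ[σ] N} {g : M' →ₛₗ[σ] N'}
    (hf : IsReduction h f) (hg : IsReduction h g) :
    IsReduction h (TensorProduct.map f g) := by
  have hσh : ∀ n : N, σ h • n = 0 := by
    intro n
    obtain ⟨m, rfl⟩ := hf.surj n
    rw [← map_smulₛₗ, hf.ker]
    exact ⟨m, rfl⟩
  let I : AddSubgroup (M ⊗[K] M') := (DistribSMul.toAddMonoidHom (M ⊗[K] M') h).range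
  have hI : ∀ z, h • z ∈ I := fun z => ⟨z, rfl⟩
  have h1 : ∀ (m₁ m₂ : M) (m' : M'), f m₁ = f m₂ →
      (QuotientAddGroup.mk (m₁ ⊗ₜ[K] m') : (M ⊗[K] M') ⧸ I) = QuotientAddGroup.mk (m₂ ⊗ₜ m') := by
    intro m₁ m₂ m' hm
    rw [← sub_eq_zero, ← map_sub, hf.ker] at hm
    obtain ⟨y, hy⟩ := hm
    rw [QuotientAddGroup.eq_iff_sub_mem, ← TensorProduct.sub_tmul, hy, ← TensorProduct.smul_tmul']
    exact hI _
  have h2 : ∀ (m : M) (m₁ m₂ : M'), g m₁ = g m₂ →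
      (QuotientAddGroup.mk (m ⊗ₜ[K] m₁) : (M ⊗[K] M') ⧸ I) = QuotientAddGroup.mk (m ⊗ₜ m₂) := by
    intro m m₁ m₂ hm
    rw [← sub_eq_zero, ← map_sub, hg.ker] at hm
    obtain ⟨y, hy⟩ := hm
    rw [QuotientAddGroup.eq_iff_sub_mem, ← TensorProduct.tmul_sub, hy, TensorProduct.tmul_smul]
    exact hI _
  -- The sections are only set-theoretic; `h1` and `h2` make the choices irrelevant modulo h, which
  -- yields both additivity and balancedness.
  let s := Function.surjInv hf.surj
  let t := Function.surjInv hg.surj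
  have hs : ∀ n, f (s n) = n := Function.surjInv_eq hf.surj
  have ht : ∀ n, g (t n) = n := Function.surjInv_eq hg.surj
  let G : N →+ N' →+ (M ⊗[K] M') ⧸ I := AddMonoidHom.mk' (fun n => AddMonoidHom.mk'
    (fun n' => QuotientAddGroup.mk (s n ⊗ₜ t n')) (fun a b => by
      rw [← QuotientAddGroup.mk_add, ← TensorProduct.tmul_add]
      exact h2 _ _ _ (by simp only [map_add, ht]))) (fun a b => by
      ext n'
      change (QuotientAddGroup.mk _ : (M ⊗[K] M') ⧸ I) = QuotientAddGroup.mk _ + QuotientAddGroup.mk _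
      rw [← QuotientAddGroup.mk_add, ← TensorProduct.add_tmul]
      exact h1 _ _ _ (by simp only [map_add, hs]))
  let L : N ⊗[k] N' →+ (M ⊗[K] M') ⧸ I := TensorProduct.liftAddHom G (by
    intro c n n'
    obtain ⟨c, rfl⟩ := hσ c
    change (QuotientAddGroup.mk (s _ ⊗ₜ t _) : (M ⊗[K] M') ⧸ I) = QuotientAddGroup.mk (s _ ⊗ₜ t _)
    rw [h1 (s (σ c • n)) (c • s n) _ (by rw [map_smulₛₗ, hs, hs]),
      h2 _ (t (σ c • n')) (c • t n') (by rw [map_smulₛₗ, ht, ht]), TensorProduct.smul_tmul])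
  have hL : ∀ z, L (TensorProduct.map f g z) = QuotientAddGroup.mk z := by
    intro z
    induction z with
    | zero => simp
    | add x y hx hy => rw [map_add, map_add, hx, hy]; rfl
    | tmul x y =>
      change (QuotientAddGroup.mk (s _ ⊗ₜ t _) : (M ⊗[K] M') ⧸ I) = _
      rw [h1 (s (f x)) x _ (hs _), h2 _ (t (g y)) y (ht _)]
  refine ⟨fun z => ?_, fun z => ⟨fun hz => ?_, ?_⟩⟩
  · induction z with
    | zero => exact ⟨0, map_zero _⟩
    | add x y hx hy =>
      obtain ⟨a, rfl⟩ := hx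
      obtain ⟨b, rfl⟩ := hy
      exact ⟨a + b, map_add _ _ _⟩
    | tmul x y => exact ⟨s x ⊗ₜ t y, by rw [TensorProduct.map_tmul, hs, ht]⟩
  · have := hL z
    rw [hz, map_zero, eq_comm, QuotientAddGroup.eq_zero_iff] at this
    obtain ⟨y, hy⟩ := this
    exact ⟨y, hy.symm⟩
  · rintro ⟨y, rfl⟩
    rw [map_smulₛₗ]
    induction TensorProduct.map f g y with
    | zero => simp
    | add x y hx hy => rw [smul_add, hx, hy, add_zero]
    | tmul x y => rw [TensorProduct.smul_tmul', hσh, TensorProduct.zero_tmul]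

/-- A multiplicative pair of semilinear maps, on the tensor product of two algebras. -/
noncomputable def tensorRingHom {A A' B B' : Type*} [Ring A] [Algebra K A] [Ring A'] [Algebra K A'] [Ring B]
    [Algebra k B] [Ring B'] [Algebra k B'] (f : A →ₛₗ[σ] B) (g : A' →ₛₗ[σ] B')
    (hf1 : f 1 = 1) (hf : ∀ x y, f (x * y) = f x * f y)
    (hg1 : g 1 = 1) (hg : ∀ x y, g (x * y) = g x * g y) : A ⊗[K] A' →+* B ⊗[k] B' where
  toFun := TensorProduct.map f g
  map_one' := by
    rw [Algebra.TensorProduct.one_def, TensorProduct.map_tmul, hf1, hg1]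
    rfl
  map_mul' x y := by
    induction x with
    | zero => simp
    | add x x' hx hx' => rw [add_mul, map_add, hx, hx', map_add, add_mul]
    | tmul a b =>
      induction y with
      | zero => simp
      | add y y' hy hy' => rw [mul_add, map_add, hy, hy', map_add, mul_add]
      | tmul a' b' => simp [hf, hg]
  map_zero' := map_zero _
  map_add' := map_add _

end Reduction

namespace Completion

variable {K : Type u} [CommRing K] {h : K} {R : Type u} [Ring R] [Algebra K R]

/-- The ring homomorphism from `R / hR` induced by a ring homomorphism that kills `h`. -/
def residueQuotient {Q : Type*} [Ring Q] (p : R →+* Q) (hp : ∀ x, p (h • x) = 0) :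
    R ⧸ powIdeal h R 1 →+* Q :=
  Ideal.Quotient.lift (powIdeal h R 1) p (by
    rintro _ ⟨y, rfl⟩
    rw [pow_one, hp])

/-- The extension to the completion of a ring homomorphism that kills `h`. -/
noncomputable def residue {Q : Type*} [Ring Q] (p : R →+* Q) (hp : ∀ x, p (h • x) = 0) :
    Completion h R →+* Q :=
  (residueQuotient p hp).comp
    ((Pi.evalRingHom _ 1).comp (completionSubalgebra h R).val.toRingHom)

theorem residue_of_approx {Q : Type*} [Ring Q] (p : R →+* Q) (hp : ∀ x, p (h • x) = 0)
    {x : Completion h R} {r : R} (hr : x.Approx h 1 r) : residue p hp x = p r := by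
  change residueQuotient p hp (x.proj 1) = _
  rw [← hr]
  rfl

theorem residue_of {Q : Type*} [Ring Q] (p : R →+* Q) (hp : ∀ x, p (h • x) = 0) (r : R) :
    residue p hp (of h r) = p r := residue_of_approx p hp (Approx.of r 1)

theorem Approx.extend {S : Type u} [Ring S] [Algebra K S] (φ : R →ₗ[K] Completion h S)
    {x : Completion h R} {n : ℕ} {r : R} (hr : x.Approx h n r) {s : S} (hs : (φ r).Approx h n s) :
    (Completion.extend φ x).Approx h n s := by
  unfold Approx at *
  rw [proj_extend φ hr, hs]

theorem Approx.map {S : Type u} [Ring S] [Algebra K S] (φ : R →ₗ[K] S)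
    {x : Completion h R} {n : ℕ} {r : R} (hr : x.Approx h n r) :
    (Completion.map φ x).Approx h n (φ r) :=
  hr.extend _ (Approx.of _ _)

theorem residue_extend {S : Type u} [Ring S] [Algebra K S] {Q : Type*} [Ring Q] (p : S →+* Q)
    (hp : ∀ x, p (h • x) = 0) (φ : R →ₗ[K] Completion h S)
    {x : Completion h R} {r : R} (hr : x.Approx h 1 r) :
    residue p hp (Completion.extend φ x) = residue p hp (φ r) := by
  exact congrArg (residueQuotient p hp) (proj_extend φ hr)

end Completion

end HopfDuality

namespace HopfDuality

/-! ### The Hopf algebra A/hA -/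

section HopfReduction

variable {k : Type u} [Field k] {A : Type u} [Ring A] [Algebra k A] [Algebra k⟦X⟧ A]
  [IsScalarTower k k⟦X⟧ A]

theorem constantCoeff_surjective : Function.Surjective (PowerSeries.constantCoeff (R := k)) :=
  fun c => ⟨PowerSeries.C c, PowerSeries.constantCoeff_C c⟩

omit [Algebra k A] [IsScalarTower k k⟦X⟧ A] in
theorem mk_powIdeal_one_eq_zero {x : A} :
    Ideal.Quotient.mk (powIdeal (PowerSeries.X : k⟦X⟧) A 1) x = 0 ↔
      ∃ y, x = (PowerSeries.X : k⟦X⟧) • y := by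
  rw [Ideal.Quotient.eq_zero_iff_mem]
  constructor
  · rintro ⟨y, rfl⟩
    exact ⟨y, by rw [pow_one]⟩
  · rintro ⟨y, rfl⟩
    exact ⟨y, by rw [pow_one]⟩

variable (k A) in
/-- The reduction map `A → A / hA`. -/
noncomputable def redMap : A →ₛₗ[PowerSeries.constantCoeff (R := k)] Reduction k A where
  toFun := Ideal.Quotient.mk _
  map_add' := map_add _
  map_smul' c a := by
    -- A power series is its constant term plus X times its shift, so only the constant term acts on
    -- A/hA.
    have h1 : c • a = (PowerSeries.X : k⟦X⟧) • ((PowerSeries.mk fun p => PowerSeries.coeff (p + 1) c) • a) +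
        PowerSeries.constantCoeff c • a := by
      rw [smul_smul, ← algebraMap_smul k⟦X⟧ (PowerSeries.constantCoeff c) a, ← add_smul]
      congr 1
      exact PowerSeries.eq_X_mul_shift_add_const c
    rw [h1, map_add, mk_powIdeal_one_eq_zero.2 ⟨_, rfl⟩, zero_add]
    rfl

theorem redMap_isReduction : IsReduction (PowerSeries.X : k⟦X⟧) (redMap k A) :=
  ⟨Ideal.Quotient.mk_surjective, fun _ => mk_powIdeal_one_eq_zero⟩

theorem redMap_one : redMap k A 1 = 1 := rfl

theorem redMap_mul (x y : A) : redMap k A (x * y) = redMap k A x * redMap k A y := rfl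

theorem IsReduction.map_smul {K k : Type*} [CommRing K] [CommRing k] {σ : K →+* k} {h : K}
    {M N : Type*} [AddCommGroup M] [Module K M] [AddCommGroup N] [Module k N]
    {f : M →ₛₗ[σ] N} (hf : IsReduction h f) (x : M) : f (h • x) = 0 := (hf.ker _).2 ⟨x, rfl⟩

variable (k A) in
/-- The reduction of `A ⊗ A`. -/
noncomputable def redSquare : A ⊗[k⟦X⟧] A →+* Reduction k A ⊗[k] Reduction k A :=
  tensorRingHom (redMap k A) (redMap k A) redMap_one redMap_mul redMap_one redMap_mul

theorem redSquare_smul (x : A ⊗[k⟦X⟧] A) : redSquare k A ((PowerSeries.X : k⟦X⟧) • x) = 0 :=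
  (redMap_isReduction.tensor constantCoeff_surjective redMap_isReduction).map_smul x

variable (k A) in
/-- The reduction of `A ⊗ (A ⊗ A)`. -/
noncomputable def redCube : A ⊗[k⟦X⟧] (A ⊗[k⟦X⟧] A) →+*
    Reduction k A ⊗[k] (Reduction k A ⊗[k] Reduction k A) :=
  tensorRingHom (redMap k A) (TensorProduct.map (redMap k A) (redMap k A)) redMap_one redMap_mul
    (redSquare k A).map_one (redSquare k A).map_mul

theorem redCube_smul (x : A ⊗[k⟦X⟧] (A ⊗[k⟦X⟧] A)) :
    redCube k A ((PowerSeries.X : k⟦X⟧) • x) = 0 :=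
  (redMap_isReduction.tensor constantCoeff_surjective
    (redMap_isReduction.tensor constantCoeff_surjective redMap_isReduction)).map_smul x

variable (k A) in
/-- The reduction of `(A ⊗ A) ⊗ A`. -/
noncomputable def redCube' : (A ⊗[k⟦X⟧] A) ⊗[k⟦X⟧] A →+*
    (Reduction k A ⊗[k] Reduction k A) ⊗[k] Reduction k A :=
  tensorRingHom (TensorProduct.map (redMap k A) (redMap k A)) (redMap k A)
    (redSquare k A).map_one (redSquare k A).map_mul redMap_one redMap_mul

theorem redCube'_smul (x : (A ⊗[k⟦X⟧] A) ⊗[k⟦X⟧] A) :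
    redCube' k A ((PowerSeries.X : k⟦X⟧) • x) = 0 :=
  ((redMap_isReduction.tensor constantCoeff_surjective redMap_isReduction).tensor
    constantCoeff_surjective redMap_isReduction).map_smul x

variable (H : TopologicalHopfAlgebra (PowerSeries.X : k⟦X⟧) A)

/-- The comultiplication of `A / hA`. -/
noncomputable def comulReduction : Reduction k A →ₐ[k] Reduction k A ⊗[k] Reduction k A :=
  { Ideal.Quotient.lift (powIdeal (PowerSeries.X : k⟦X⟧) A 1)
      ((Completion.residue (redSquare k A) redSquare_smul).comp H.comul.toRingHom) (by
        rintro _ ⟨y, rfl⟩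
        obtain ⟨r, hr⟩ := Completion.exists_approx _ (H.comul y) 1
        change Completion.residue (redSquare k A) redSquare_smul (H.comul _) = 0
        rw [map_smul, pow_one, Completion.residue_of_approx _ _ (hr.smul _), redSquare_smul]) with
    commutes' := fun c => by
      change Completion.residue (redSquare k A) redSquare_smul (H.comul (algebraMap k A c)) = _
      rw [IsScalarTower.algebraMap_apply k k⟦X⟧ A, AlgHom.commutes,
        ← (Completion.of (PowerSeries.X : k⟦X⟧)).commutes, Completion.residue_of]
      rw [Algebra.TensorProduct.algebraMap_apply, ← IsScalarTower.algebraMap_apply k k⟦X⟧ A]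
      rfl }

theorem comulReduction_redMap (a : A) : comulReduction H (redMap k A a) =
    Completion.residue (redSquare k A) redSquare_smul (H.comul a) := rfl

/-- The counit of `A / hA`. -/
noncomputable def counitReductionAlgHom : Reduction k A →ₐ[k] k :=
  { counitReduction H with
    commutes' := fun c => by
      change PowerSeries.constantCoeff (H.counit (algebraMap k A c)) = c
      rw [IsScalarTower.algebraMap_apply k k⟦X⟧ A, AlgHom.commutes]
      exact PowerSeries.constantCoeff_C c }

/-- The antipode of `A / hA`. -/
noncomputable def antipodeReduction : Reduction k A →ₗ[k] Reduction k A where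
  toFun := Quotient.lift (fun a => redMap k A (H.antipode a)) (fun a b hab => by
    have h1 : redMap k A (a - b) = 0 := by
      rw [map_sub, sub_eq_zero]
      exact Quotient.sound hab
    obtain ⟨y, hy⟩ := (redMap_isReduction.ker _).1 h1
    rw [← sub_eq_zero, ← map_sub, ← map_sub, hy, map_smul, redMap_isReduction.map_smul])
  map_add' := by
    rintro ⟨a⟩ ⟨b⟩
    exact (congrArg (redMap k A) (map_add H.antipode a b)).trans (map_add _ _ _)
  map_smul' := by
    rintro c ⟨a⟩
    change redMap k A (H.antipode (c • a)) = c • redMap k A (H.antipode a)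
    rw [← algebraMap_smul k⟦X⟧ c a, map_smul, map_smulₛₗ]
    congr 1

theorem antipodeReduction_redMap (a : A) :
    antipodeReduction H (redMap k A a) = redMap k A (H.antipode a) := rfl

theorem antipodeReduction_bijective (hS : Function.Bijective H.antipode) :
    Function.Bijective (antipodeReduction H) := by
  constructor
  · rw [injective_iff_map_eq_zero]
    intro x hx
    obtain ⟨a, rfl⟩ := redMap_isReduction.surj x
    rw [antipodeReduction_redMap, redMap_isReduction.ker] at hx
    obtain ⟨y, hy⟩ := hx
    obtain ⟨z, rfl⟩ := hS.2 y
    rw [← map_smul] at hy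
    rw [hS.1 hy, redMap_isReduction.map_smul]
  · intro x
    obtain ⟨a, rfl⟩ := redMap_isReduction.surj x
    obtain ⟨b, rfl⟩ := hS.2 a
    exact ⟨redMap k A b, rfl⟩

/-- Modulo h the completed map Δ ⊗̂ id is the ordinary one for the reduced comultiplication; it
suffices to evaluate on pure tensors, with an approximation of Δ(a) modulo h. -/
theorem residue_comulTensorId
    (φ : A ⊗[k⟦X⟧] A →ₗ[k⟦X⟧] Completion (PowerSeries.X : k⟦X⟧) ((A ⊗[k⟦X⟧] A) ⊗[k⟦X⟧] A))
    (hφ : ∀ a b, φ (a ⊗ₜ b) = Completion.map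
      ((TensorProduct.mk k⟦X⟧ (A ⊗[k⟦X⟧] A) A).flip b) (H.comul a)) (r : A ⊗[k⟦X⟧] A) :
    Completion.residue (redCube' k A) redCube'_smul (φ r) =
      Algebra.TensorProduct.map (comulReduction H) (.id k _) (redSquare k A r) := by
  induction r with
  | zero => rw [map_zero, map_zero, map_zero, map_zero]
  | add x y hx hy => rw [map_add, map_add, map_add, map_add, hx, hy]
  | tmul a b =>
    obtain ⟨s, hs⟩ := Completion.exists_approx _ (H.comul a) 1
    rw [hφ, Completion.residue_of_approx _ _ (hs.map _)]
    change redSquare k A s ⊗ₜ redMap k A b = comulReduction H (redMap k A a) ⊗ₜ redMap k A b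
    rw [comulReduction_redMap, Completion.residue_of_approx _ _ hs]

theorem residue_idTensorComul
    (φ : A ⊗[k⟦X⟧] A →ₗ[k⟦X⟧] Completion (PowerSeries.X : k⟦X⟧) (A ⊗[k⟦X⟧] (A ⊗[k⟦X⟧] A)))
    (hφ : ∀ a b, φ (a ⊗ₜ b) = Completion.map
      (TensorProduct.mk k⟦X⟧ A (A ⊗[k⟦X⟧] A) a) (H.comul b)) (r : A ⊗[k⟦X⟧] A) :
    Completion.residue (redCube k A) redCube_smul (φ r) =
      Algebra.TensorProduct.map (.id k _) (comulReduction H) (redSquare k A r) := by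
  induction r with
  | zero => rw [map_zero, map_zero, map_zero, map_zero]
  | add x y hx hy => rw [map_add, map_add, map_add, map_add, hx, hy]
  | tmul a b =>
    obtain ⟨s, hs⟩ := Completion.exists_approx _ (H.comul b) 1
    rw [hφ, Completion.residue_of_approx _ _ (hs.map _)]
    change redMap k A a ⊗ₜ redSquare k A s = redMap k A a ⊗ₜ comulReduction H (redMap k A b)
    rw [comulReduction_redMap, Completion.residue_of_approx _ _ hs]

theorem residue_comulTensorId_comul (a : A) :
    Completion.residue (redCube' k A) redCube'_smul
      (comulTensorId H.comul.toLinearMap (H.comul a)) =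
      Algebra.TensorProduct.map (comulReduction H) (.id k _)
        (comulReduction H (redMap k A a)) := by
  obtain ⟨r, hr⟩ := Completion.exists_approx _ (H.comul a) 1
  rw [comulReduction_redMap, Completion.residue_of_approx _ _ hr]
  unfold comulTensorId
  rw [Completion.residue_extend _ _ _ hr]
  refine residue_comulTensorId H _ (fun a b => ?_) r
  rw [TensorProduct.lift.tmul]
  rfl

theorem residue_idTensorComul_comul (a : A) :
    Completion.residue (redCube k A) redCube_smul
      (idTensorComul H.comul.toLinearMap (H.comul a)) =
      Algebra.TensorProduct.map (.id k _) (comulReduction H)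
        (comulReduction H (redMap k A a)) := by
  obtain ⟨r, hr⟩ := Completion.exists_approx _ (H.comul a) 1
  rw [comulReduction_redMap, Completion.residue_of_approx _ _ hr]
  unfold idTensorComul
  rw [Completion.residue_extend _ _ _ hr]
  refine residue_idTensorComul H _ (fun a b => ?_) r
  rw [TensorProduct.lift.tmul]
  rfl

theorem assoc_redCube' (r : (A ⊗[k⟦X⟧] A) ⊗[k⟦X⟧] A) :
    TensorProduct.assoc k (Reduction k A) (Reduction k A) (Reduction k A) (redCube' k A r) =
      redCube k A (TensorProduct.assoc k⟦X⟧ A A A r) := by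
  induction r with
  | zero => simp only [map_zero]
  | add x y hx hy => simp only [map_add, hx, hy]
  | tmul x y =>
    induction x with
    | zero => simp only [map_zero, TensorProduct.zero_tmul]
    | add x y hx hy => simp only [map_add, TensorProduct.add_tmul, hx, hy]
    | tmul x y => rfl

theorem comulReduction_coassoc (x : Reduction k A) :
    TensorProduct.assoc k _ _ _ (Algebra.TensorProduct.map (comulReduction H)
        (.id k _) (comulReduction H x)) = Algebra.TensorProduct.map (.id k _)
          (comulReduction H) (comulReduction H x) := by
  obtain ⟨a, rfl⟩ := redMap_isReduction.surj x
  rw [← residue_comulTensorId_comul, ← residue_idTensorComul_comul, ← H.coassoc]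
  obtain ⟨t, ht⟩ := Completion.exists_approx _
    (comulTensorId H.comul.toLinearMap (H.comul a)) 1
  rw [Completion.residue_of_approx _ _ ht, Completion.residue_of_approx _ _ (ht.map _),
    assoc_redCube']
  rfl

theorem lid_redSquare (r : A ⊗[k⟦X⟧] A) :
    TensorProduct.lid k (Reduction k A) (Algebra.TensorProduct.map (counitReductionAlgHom H)
      (.id k (Reduction k A)) (redSquare k A r)) =
      redMap k A (TensorProduct.lid k⟦X⟧ A (H.counit.toLinearMap.rTensor A r)) := by
  induction r with
  | zero => simp only [map_zero]
  | add x y hx hy => simp only [map_add, hx, hy]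
  | tmul x y =>
    rw [LinearMap.rTensor_tmul, TensorProduct.lid_tmul, map_smulₛₗ]
    rfl

theorem rid_redSquare (r : A ⊗[k⟦X⟧] A) :
    TensorProduct.rid k (Reduction k A) (Algebra.TensorProduct.map (.id k (Reduction k A))
      (counitReductionAlgHom H) (redSquare k A r)) =
      redMap k A (TensorProduct.rid k⟦X⟧ A (H.counit.toLinearMap.lTensor A r)) := by
  induction r with
  | zero => simp only [map_zero]
  | add x y hx hy => simp only [map_add, hx, hy]
  | tmul x y =>
    rw [LinearMap.lTensor_tmul, TensorProduct.rid_tmul, map_smulₛₗ]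
    rfl

theorem mul_rTensor_redSquare (r : A ⊗[k⟦X⟧] A) :
    LinearMap.mul' k (Reduction k A) ((antipodeReduction H).rTensor _ (redSquare k A r)) =
      redMap k A (LinearMap.mul' k⟦X⟧ A (H.antipode.rTensor A r)) := by
  induction r with
  | zero => simp only [map_zero]
  | add x y hx hy => simp only [map_add, hx, hy]
  | tmul x y => rfl

theorem mul_lTensor_redSquare (r : A ⊗[k⟦X⟧] A) :
    LinearMap.mul' k (Reduction k A) ((antipodeReduction H).lTensor _ (redSquare k A r)) =
      redMap k A (LinearMap.mul' k⟦X⟧ A (H.antipode.lTensor A r)) := by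
  induction r with
  | zero => simp only [map_zero]
  | add x y hx hy => simp only [map_add, hx, hy]
  | tmul x y => rfl

/-- The counit and antipode axioms are equalities in a completion; this reads them in degree one,
that is, modulo h. -/
theorem redMap_eq_of_map_eq {ψ : A ⊗[k⟦X⟧] A →ₗ[k⟦X⟧] A} {a b : A} {r : A ⊗[k⟦X⟧] A}
    (hr : (H.comul a).Approx (PowerSeries.X : k⟦X⟧) 1 r)
    (hψ : Completion.map ψ (H.comul a) = Completion.of (PowerSeries.X : k⟦X⟧) b) :
    redMap k A (ψ r) = redMap k A b := by
  have h1 := hr.map ψ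
  rw [hψ] at h1
  exact h1

/-- The Hopf algebra structure on `A / hA` induced by a topological Hopf algebra structure
on `A`. -/
noncomputable abbrev reductionHopfAlgebra : HopfAlgebra k (Reduction k A) :=
  letI B : Bialgebra k (Reduction k A) := Bialgebra.ofAlgHom (comulReduction H)
    (counitReductionAlgHom H)
    (by
      exact AlgHom.ext (comulReduction_coassoc H))
    (by
      refine AlgHom.ext fun x => ?_
      obtain ⟨a, rfl⟩ := redMap_isReduction.surj x
      obtain ⟨r, hr⟩ := Completion.exists_approx _ (H.comul a) 1
      refine (TensorProduct.lid k (Reduction k A)).injective ?_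
      change _ = TensorProduct.lid k (Reduction k A) ((TensorProduct.lid k (Reduction k A)).symm _)
      rw [LinearEquiv.apply_symm_apply, AlgHom.comp_apply, comulReduction_redMap,
        Completion.residue_of_approx _ _ hr, lid_redSquare]
      exact redMap_eq_of_map_eq H hr (H.counit_comul a))
    (by
      refine AlgHom.ext fun x => ?_
      obtain ⟨a, rfl⟩ := redMap_isReduction.surj x
      obtain ⟨r, hr⟩ := Completion.exists_approx _ (H.comul a) 1
      refine (TensorProduct.rid k (Reduction k A)).injective ?_
      change _ = TensorProduct.rid k (Reduction k A) ((TensorProduct.rid k (Reduction k A)).symm _)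
      rw [LinearEquiv.apply_symm_apply, AlgHom.comp_apply, comulReduction_redMap,
        Completion.residue_of_approx _ _ hr, rid_redSquare]
      exact redMap_eq_of_map_eq H hr (H.comul_counit a))
  { toBialgebra := B
    antipode := antipodeReduction H
    mul_antipode_rTensor_comul := by
      refine LinearMap.ext fun x => ?_
      obtain ⟨a, rfl⟩ := redMap_isReduction.surj x
      obtain ⟨r, hr⟩ := Completion.exists_approx _ (H.comul a) 1
      change LinearMap.mul' k (Reduction k A) ((antipodeReduction H).rTensor _
        (comulReduction H (redMap k A a))) = algebraMap k _ (counitReductionAlgHom H (redMap k A a))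
      rw [comulReduction_redMap, Completion.residue_of_approx _ _ hr, mul_rTensor_redSquare]
      refine (redMap_eq_of_map_eq H hr (H.antipode_mul a)).trans ?_
      rw [Algebra.algebraMap_eq_smul_one, map_smulₛₗ, Algebra.algebraMap_eq_smul_one]
      rfl
    mul_antipode_lTensor_comul := by
      refine LinearMap.ext fun x => ?_
      obtain ⟨a, rfl⟩ := redMap_isReduction.surj x
      obtain ⟨r, hr⟩ := Completion.exists_approx _ (H.comul a) 1
      change LinearMap.mul' k (Reduction k A) ((antipodeReduction H).lTensor _
        (comulReduction H (redMap k A a))) = algebraMap k _ (counitReductionAlgHom H (redMap k A a))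
      rw [comulReduction_redMap, Completion.residue_of_approx _ _ hr, mul_lTensor_redSquare]
      refine (redMap_eq_of_map_eq H hr (H.mul_antipode a)).trans ?_
      rw [Algebra.algebraMap_eq_smul_one, map_smulₛₗ, Algebra.algebraMap_eq_smul_one]
      rfl }

end HopfReduction

end HopfDuality

namespace HopfDuality

/-! ### Completeness and torsion-freeness of the completion -/

section AdicSum

variable {K : Type u} [CommRing K] {h : K}

theorem smul_pow_cancel {N : Type*} [AddCommGroup N] [Module K N] (hN : ∀ x : N, h • x = 0 → x = 0)
    (n : ℕ) {x y : N} (hxy : h ^ n • x = h ^ n • y) : x = y := by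
  induction n with
  | zero => simpa using hxy
  | succ n ih =>
    refine ih (sub_eq_zero.1 (hN _ ?_))
    rw [smul_sub, smul_smul, smul_smul, ← pow_succ', hxy, sub_self]

theorem exists_adic_sum {N : Type u} [AddCommGroup N] [Module K N]
    [IsAdicComplete (Ideal.span {h}) N] (a : ℕ → N) :
    ∃ L, ∀ n : ℕ, ∃ z, L = ∑ i ∈ Finset.range n, h ^ i • a i + h ^ n • z := by
  have key : ∀ {m n : ℕ}, m ≤ n → ∃ z : N,
      ∑ i ∈ Finset.range n, h ^ i • a i = ∑ i ∈ Finset.range m, h ^ i • a i + h ^ m • z := by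
    intro m n hmn
    refine ⟨∑ i ∈ Finset.Ico m n, h ^ (i - m) • a i, ?_⟩
    rw [← Finset.sum_range_add_sum_Ico _ hmn, Finset.smul_sum]
    congr 1
    refine Finset.sum_congr rfl fun i hi => ?_
    rw [smul_smul, ← pow_add, Nat.add_sub_cancel' (Finset.mem_Ico.1 hi).1]
  obtain ⟨L, hL⟩ := IsPrecomplete.prec' (I := Ideal.span {h}) (M := N)
    (fun n => ∑ i ∈ Finset.range n, h ^ i • a i) (fun {m n} hmn => by
      rw [SModEq.sub_mem]
      obtain ⟨z, hz⟩ := key hmn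
      refine mem_pow_smul_top.2 ⟨-z, ?_⟩
      rw [hz, smul_neg]
      abel)
  refine ⟨L, fun n => ?_⟩
  obtain ⟨z, hz⟩ := mem_pow_smul_top.1 (SModEq.sub_mem.1 (hL n))
  exact ⟨-z, by rw [smul_neg, ← hz]; abel⟩

end AdicSum

namespace Completion

variable {K : Type u} [CommRing K] {h : K} {R : Type u} [Ring R] [Algebra K R]

theorem mk_powIdeal_eq_zero {n : ℕ} {r : R} :
    Ideal.Quotient.mk (powIdeal h R n) r = 0 ↔ ∃ y, r = h ^ n • y := by
  rw [Ideal.Quotient.eq_zero_iff_mem]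
  exact ⟨fun ⟨y, hy⟩ => ⟨y, hy.symm⟩, fun ⟨y, hy⟩ => ⟨y, hy.symm⟩⟩

/-- The representatives modulo h^{n+m} have the form h^n s_m; cancelling h^n in the torsion-free R
shows that the s_m are compatible modulo h^m. -/
theorem exists_smul_of_proj_eq_zero (hR : ∀ r : R, h • r = 0 → r = 0) {x : Completion h R} {n : ℕ}
    (hx : x.proj n = 0) : ∃ y, x = h ^ n • y := by
  have h1 : ∀ m, ∃ s, x.rep (n + m) = h ^ n • s := by
    intro m
    have := (x.approx_rep (n + m)).mono (Nat.le_add_right n m)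
    rw [Approx, hx] at this
    exact mk_powIdeal_eq_zero.1 this
  choose s hs using h1
  refine ⟨⟨fun m => Ideal.Quotient.mk _ (s m), fun m m' hm => ?_⟩, ext' h fun m => ?_⟩
  · change Ideal.Quotient.mk _ (s m') = Ideal.Quotient.mk _ (s m)
    obtain ⟨t, ht⟩ := ((x.approx_rep (n + m')).mono (Nat.add_le_add_left hm n)).sub_eq
      (x.approx_rep (n + m))
    rw [hs, hs, ← smul_sub, pow_add, mul_smul] at ht
    refine Ideal.Quotient.eq.2 ⟨t, (smul_pow_cancel hR n ht).symm⟩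
  · have := (x.approx_rep (n + m)).mono (Nat.le_add_left m n)
    rw [Approx, hs] at this
    exact this.symm

/-- One extra level of precision is spent: a representative modulo h^{n+1} with h r in h^{n+1} R
lies in h^n R. -/
theorem smul_eq_zero_of_torsionFree (hR : ∀ r : R, h • r = 0 → r = 0) (x : Completion h R)
    (hx : h • x = 0) : x = 0 := by
  refine ext' h fun n => ?_
  have h1 := (x.approx_rep (n + 1)).smul h
  rw [hx] at h1
  obtain ⟨y, hy⟩ := mk_powIdeal_eq_zero.1 (show Ideal.Quotient.mk _ _ = 0 from h1)
  rw [pow_succ', mul_smul, ← sub_eq_zero, ← smul_sub] at hy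
  have h2 := (x.approx_rep (n + 1)).mono (Nat.le_succ n)
  rw [Approx, sub_eq_zero.1 (hR _ hy)] at h2
  rw [← h2]
  exact mk_powIdeal_eq_zero.2 ⟨y, rfl⟩

theorem eq_zero_of_forall_smul {x : Completion h R} (hx : ∀ n : ℕ, ∃ y, x = h ^ n • y) : x = 0 := by
  refine ext' h fun n => ?_
  obtain ⟨y, rfl⟩ := hx n
  refine ((y.approx_rep n).smul (h ^ n)).symm.trans ?_
  exact mk_powIdeal_eq_zero.2 ⟨_, rfl⟩

theorem exists_sum (hR : ∀ r : R, h • r = 0 → r = 0) (a : ℕ → Completion h R) :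
    ∃ x, ∀ n : ℕ, ∃ y, x = ∑ i ∈ Finset.range n, h ^ i • a i + h ^ n • y := by
  have hsum : ∀ n m (s : Finset ℕ), Approx h (∑ i ∈ s, h ^ i • a i) n
      (∑ i ∈ s, h ^ i • (a i).rep m) ∨ ¬ n ≤ m := by
    intro n m s
    by_cases hnm : n ≤ m
    · left
      classical
      induction s using Finset.induction_on with
      | empty => exact Approx.of 0 n
      | insert i s hi ih =>
        rw [Finset.sum_insert hi, Finset.sum_insert hi]
        exact ((((a i).approx_rep m).mono hnm).smul _).add ih
    · exact Or.inr hnm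
  have htail : ∀ {m n : ℕ}, m ≤ n → (∑ i ∈ Finset.range n, h ^ i • a i).proj m =
      (∑ i ∈ Finset.range m, h ^ i • a i).proj m := by
    intro m n hmn
    have h1 := (hsum m n (Finset.range n)).resolve_right (not_not_intro hmn)
    have h2 := (hsum m n (Finset.range m)).resolve_right (not_not_intro hmn)
    rw [← h1, ← h2]
    refine Ideal.Quotient.eq.2 ⟨∑ i ∈ Finset.Ico m n, h ^ (i - m) • (a i).rep n, ?_⟩
    rw [← Finset.sum_range_add_sum_Ico _ hmn, Finset.smul_sum, add_sub_cancel_left]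
    refine Finset.sum_congr rfl fun i hi => ?_
    rw [smul_smul, ← pow_add, Nat.add_sub_cancel' (Finset.mem_Ico.1 hi).1]
  let x : Completion h R := ⟨fun n => (∑ i ∈ Finset.range n, h ^ i • a i).proj n,
    fun m n hmn => ((∑ i ∈ Finset.range n, h ^ i • a i).2 m n hmn).trans (htail hmn)⟩
  refine ⟨x, fun n => ?_⟩
  obtain ⟨y, hy⟩ := exists_smul_of_proj_eq_zero hR
    (x := x - ∑ i ∈ Finset.range n, h ^ i • a i) (n := n) (sub_self _)
  exact ⟨y, by rw [← hy]; abel⟩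

theorem isAdicComplete (hR : ∀ r : R, h • r = 0 → r = 0) :
    IsAdicComplete (Ideal.span {h}) (Completion h R) where
  haus' x hx := eq_zero_of_forall_smul fun n => mem_pow_smul_top.1 (SModEq.zero.1 (hx n))
  prec' f hf := by
    have h1 : ∀ n : ℕ, ∃ z, f (n + 1) - f n = h ^ n • z := by
      intro n
      obtain ⟨z, hz⟩ := mem_pow_smul_top.1 (SModEq.sub_mem.1 (hf (Nat.le_succ n)))
      exact ⟨-z, by rw [smul_neg, ← hz]; abel⟩
    choose z hz using h1
    obtain ⟨x, hx⟩ := exists_sum hR z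
    refine ⟨f 0 + x, fun n => ?_⟩
    obtain ⟨y, hy⟩ := hx n
    rw [SModEq.sub_mem]
    refine mem_pow_smul_top.2 ⟨-y, ?_⟩
    have h2 : ∑ i ∈ Finset.range n, h ^ i • z i = f n - f 0 := by
      rw [← Finset.sum_range_sub]
      exact Finset.sum_congr rfl fun i _ => (hz i).symm
    rw [hy, h2, smul_neg]
    abel

theorem centralComplete (hR : ∀ r : R, h • r = 0 → r = 0) :
    CentralComplete (algebraMap K (Completion h R) h) where
  comm r := Algebra.commutes h r
  reg r hr := smul_eq_zero_of_torsionFree hR r (by rwa [Algebra.smul_def])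
  sep r hr := eq_zero_of_forall_smul fun n => by
    obtain ⟨t, ht⟩ := hr n
    exact ⟨t, by rw [Algebra.smul_def, map_pow, ht]⟩
  lim a := by
    obtain ⟨x, hx⟩ := exists_sum hR a
    refine ⟨x, fun n => ?_⟩
    obtain ⟨y, hy⟩ := hx n
    refine ⟨y, ?_⟩
    rw [hy]
    simp only [Algebra.smul_def, map_pow]

theorem residue_eq_zero_iff (hR : ∀ r : R, h • r = 0 → r = 0) {Q : Type*} [Ring Q] (p : R →+* Q)
    (hp : ∀ x, p (h • x) = 0) (hker : ∀ x, p x = 0 → ∃ y, x = h • y) (x : Completion h R) :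
    residue p hp x = 0 ↔ ∃ y, x = algebraMap K _ h * y := by
  obtain ⟨r, hr⟩ := exists_approx h x 1
  rw [residue_of_approx p hp hr]
  constructor
  · intro h1
    obtain ⟨y, rfl⟩ := hker r h1
    obtain ⟨z, hz⟩ := exists_smul_of_proj_eq_zero hR (x := x) (n := 1)
      (hr.symm.trans (mk_powIdeal_eq_zero.2 ⟨y, by rw [pow_one]⟩))
    exact ⟨z, by rw [hz, pow_one, Algebra.smul_def]⟩
  · rintro ⟨y, rfl⟩
    obtain ⟨s, hs⟩ := exists_approx h y 1
    have h1 := hs.smul h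
    rw [Algebra.smul_def] at h1
    rw [← residue_of_approx p hp hr, residue_of_approx p hp h1, hp]

end Completion

section Env

variable {k : Type u} [Field k] {A : Type u} [Ring A] [Algebra k⟦X⟧ A]

/-- Over the discrete valuation ring k⟦X⟧ flat means torsion-free, and a nonzero scalar is a unit
times a power of X. -/
theorem flat_of_torsionFree {N : Type u} [AddCommGroup N] [Module k⟦X⟧ N]
    (hN : ∀ x : N, (PowerSeries.X : k⟦X⟧) • x = 0 → x = 0) : Module.Flat k⟦X⟧ N := by
  rw [IsDedekindDomain.flat_iff_torsion_eq_bot, eq_bot_iff]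
  rintro x ⟨⟨c, hc⟩, hx⟩
  change c • x = 0 at hx
  obtain ⟨n, v, hcv⟩ := IsDiscreteValuationRing.eq_unit_mul_pow_irreducible
    (nonZeroDivisors.ne_zero hc) (PowerSeries.X_irreducible (R := k))
  rw [hcv, mul_smul, ← Units.smul_def, smul_eq_zero_iff_eq] at hx
  exact smul_pow_cancel hN n (hx.trans (smul_zero _).symm)

theorem tensor_torsionFree {N N' : Type u} [AddCommGroup N] [Module k⟦X⟧ N] [AddCommGroup N']
    [Module k⟦X⟧ N'] (hN : ∀ x : N, (PowerSeries.X : k⟦X⟧) • x = 0 → x = 0)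
    (hN' : ∀ x : N', (PowerSeries.X : k⟦X⟧) • x = 0 → x = 0) (z : N ⊗[k⟦X⟧] N')
    (hz : (PowerSeries.X : k⟦X⟧) • z = 0) : z = 0 := by
  have := flat_of_torsionFree hN
  have h1 : Function.Injective (LinearMap.lsmul k⟦X⟧ N' PowerSeries.X) := by
    rw [injective_iff_map_eq_zero]
    exact hN'
  have h2 := Module.Flat.lTensor_preserves_injective_linearMap (M := N) _ h1
  refine h2 ?_
  rw [map_zero, ← hz]
  clear hz h2 h1
  induction z with
  | zero => simp
  | add x y hx hy => rw [map_add, hx, hy, smul_add]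
  | tmul x y => rw [LinearMap.lTensor_tmul, LinearMap.lsmul_apply, TensorProduct.tmul_smul]

end Env

end HopfDuality

namespace HopfDuality

open Abelian

/-! ### The completed enveloping algebra modulo h -/

section EnvReduction

variable {k : Type u} [Field k] {A : Type u} [Ring A] [Algebra k A] [Algebra k⟦X⟧ A]
  [IsScalarTower k k⟦X⟧ A]

variable (k A) in
/-- The reduction map of the opposite algebra. -/
noncomputable def redOp : Aᵐᵒᵖ →ₛₗ[PowerSeries.constantCoeff (R := k)] (Reduction k A)ᵐᵒᵖ where
  toFun x := op (redMap k A x.unop)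
  map_add' _ _ := congrArg op (map_add _ _ _)
  map_smul' c x := congrArg op (map_smulₛₗ _ c x.unop)

theorem redOp_isReduction : IsReduction (PowerSeries.X : k⟦X⟧) (redOp k A) where
  surj x := by
    obtain ⟨a, ha⟩ := redMap_isReduction.surj x.unop
    exact ⟨op a, congrArg op ha⟩
  ker x := by
    rw [← op_unop x]
    refine (op_eq_zero_iff _).trans ((redMap_isReduction.ker x.unop).trans ⟨?_, ?_⟩)
    · rintro ⟨y, hy⟩
      exact ⟨op y, congrArg op hy⟩
    · rintro ⟨y, hy⟩
      exact ⟨y.unop, congrArg unop hy⟩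

variable (k A) in
/-- The reduction of `A ⊗ Aᵒᵖ`. -/
noncomputable def redEnv : A ⊗[k⟦X⟧] Aᵐᵒᵖ →+* Reduction k A ⊗[k] (Reduction k A)ᵐᵒᵖ :=
  tensorRingHom (redMap k A) (redOp k A) redMap_one redMap_mul rfl fun _ _ => rfl

theorem redEnv_isReduction : IsReduction (PowerSeries.X : k⟦X⟧)
    (TensorProduct.map (redMap k A) (redOp k A)) :=
  redMap_isReduction.tensor constantCoeff_surjective redOp_isReduction

variable (k A) in
/-- The reduction of the completed enveloping algebra. -/
noncomputable def resEnv :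
    Env (PowerSeries.X : k⟦X⟧) A →+* Reduction k A ⊗[k] (Reduction k A)ᵐᵒᵖ :=
  Completion.residue (redEnv k A) redEnv_isReduction.map_smul

theorem resEnv_of_approx {x : Env (PowerSeries.X : k⟦X⟧) A} {r : A ⊗[k⟦X⟧] Aᵐᵒᵖ}
    (hr : x.Approx PowerSeries.X 1 r) : resEnv k A x = redEnv k A r :=
  Completion.residue_of_approx _ _ hr

theorem resEnv_surjective : Function.Surjective (resEnv k A) := fun y => by
  obtain ⟨x, hx⟩ := redEnv_isReduction.surj y
  exact ⟨Completion.of _ x, (Completion.residue_of _ _ x).trans hx⟩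

theorem resEnv_inclLeft (a : A) :
    resEnv k A (inclLeft PowerSeries.X a) = leftIncl (k := k) (redMap k A a) :=
  Completion.residue_of _ _ _

theorem resEnv_inclRight (a : A) :
    resEnv k A (inclRight PowerSeries.X (op a)) = rightIncl (k := k) (redMap k A a) :=
  Completion.residue_of _ _ _

end EnvReduction

section EnvTorsionFree

variable {k : Type u} [Field k] {A : Type u} [Ring A] [Algebra k⟦X⟧ A]
  [IsTopologicallyFree (PowerSeries.X : k⟦X⟧) A]

theorem env_base_torsionFree (z : A ⊗[k⟦X⟧] Aᵐᵒᵖ) (hz : (PowerSeries.X : k⟦X⟧) • z = 0) : z = 0 :=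
  tensor_torsionFree IsTopologicallyFree.eq_zero_of_smul (fun x hx =>
    unop_injective (IsTopologicallyFree.eq_zero_of_smul (h := (PowerSeries.X : k⟦X⟧)) x.unop
      (congrArg unop hx))) z hz

variable (k A) in
theorem env_centralComplete : CentralComplete
    (algebraMap k⟦X⟧ (Env (PowerSeries.X : k⟦X⟧) A) PowerSeries.X) :=
  Completion.centralComplete env_base_torsionFree

end EnvTorsionFree

section EnvAction

variable {K : Type u} [CommRing K] {h : K} {A : Type u} [Ring A] [Algebra K A]
  [IsAdicComplete (Ideal.span {h}) A]

theorem of_smul (r : A ⊗[K] Aᵐᵒᵖ) (m : A) : Completion.of h r • m = leftAction A r m :=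
  extendEnd_unique _ fun n => ⟨r, Completion.Approx.of r n, 0, by simp⟩

theorem inclLeft_smul (a m : A) : inclLeft h a • m = a * m := by
  refine (of_smul _ m).trans ?_
  exact congrArg (a * ·) (mul_one m)

theorem inclRight_smul (a m : A) : inclRight h (op a) • m = m * a := by
  refine (of_smul _ m).trans ?_
  exact one_mul (m * a)

theorem op_of_smul (r : A ⊗[K] Aᵐᵒᵖ) (m : A) :
    op (Completion.of h r) • m = rightAction A r m :=
  extendEnd_unique _ fun n => ⟨r, Completion.Approx.of r n, 0, by simp⟩

theorem op_inclLeft_smul (a m : A) : op (inclLeft h a) • m = m * a := by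
  refine (op_of_smul _ m).trans ?_
  exact one_mul (m * a)

theorem algebraMap_env_smul (c : K) (m : A) : algebraMap K (Env h A) c • m = c • m := by
  rw [env_smul_def, Algebra.algebraMap_eq_smul_one, map_smul, LinearMap.smul_apply]
  congr 1
  exact one_smul (Env h A) m

theorem algebraMap_op_env_smul (c : K) (m : A) : op (algebraMap K (Env h A) c) • m = c • m := by
  rw [env_op_smul_def, Algebra.algebraMap_eq_smul_one, map_smul, LinearMap.smul_apply]
  congr 1
  exact one_smul (Env h A)ᵐᵒᵖ m

end EnvAction

/-! ### Ext of A over its completed enveloping algebra -/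

section EnvDuality

variable {k : Type u} [Field k] {A : Type u} [Ring A] [Algebra k A] [Algebra k⟦X⟧ A]
  [IsScalarTower k k⟦X⟧ A] [IsTopologicallyFree (PowerSeries.X : k⟦X⟧) A]

theorem resEnv_eq_zero_iff (x : Env (PowerSeries.X : k⟦X⟧) A) : resEnv k A x = 0 ↔
    ∃ y, x = algebraMap k⟦X⟧ (Env (PowerSeries.X : k⟦X⟧) A) PowerSeries.X * y :=
  Completion.residue_eq_zero_iff env_base_torsionFree _ _
    (fun x => (redEnv_isReduction.ker x).1) x

variable (k A) in
/-- The algebra `A` as a left module over its completed enveloping algebra. -/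
noncomputable abbrev envRegular : ModuleCat.{u} (Env (PowerSeries.X : k⟦X⟧) A) :=
  ModuleCat.of (Env (PowerSeries.X : k⟦X⟧) A) A

theorem redMap_env_smul (x : Env (PowerSeries.X : k⟦X⟧) A) (m : A) :
    toRegular (k := k) (redMap k A (x • m)) = resEnv k A x • toRegular (k := k) (redMap k A m) := by
  obtain ⟨r, hr⟩ := Completion.exists_approx _ x 1
  obtain ⟨z, hz⟩ := extendEnd_spec (leftAction A) hr m
  rw [pow_one] at hz
  rw [resEnv_of_approx hr, env_smul_def, sub_eq_iff_eq_add.1 hz, map_add,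
    redMap_isReduction.map_smul, zero_add]
  clear hz hr
  induction r with
  | zero =>
    rw [map_zero, map_zero, LinearMap.zero_apply, map_zero]
    exact (zero_smul (Reduction k A ⊗[k] (Reduction k A)ᵐᵒᵖ) (toRegular (k := k) (redMap k A m))).symm
  | add r s hr hs =>
    rw [map_add, map_add, LinearMap.add_apply, map_add]
    exact (congrArg₂ (· + ·) hr hs).trans
      (add_smul (redEnv k A r) (redEnv k A s) (toRegular (k := k) (redMap k A m))).symm
  | tmul a b => exact (smul_toRegular (k := k) (redMap k A a) (redMap k A b.unop) (redMap k A m)).symm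

variable (k A) in
/-- The reduction map of `A`, over the reduction of the completed enveloping algebra. -/
noncomputable def redBimodule :
    envRegular k A ⟶ (ModuleCat.restrictScalars (resEnv k A)).obj (regularBimodule k (Reduction k A)) :=
  homOfSemilinear (X := A) (Y := regularBimodule k (Reduction k A)) (f := resEnv k A)
    (redMap k A).toAddMonoidHom redMap_env_smul

/-- A and E have no h-torsion and reduce to B and Bᵉ, so Ext into modules killed by h is computed
over Bᵉ. -/
theorem extBaseChange_redBimodule_bijective
    (N : ModuleCat.{u} (Reduction k A ⊗[k] (Reduction k A)ᵐᵒᵖ)) (i : ℕ) :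
    Function.Bijective (extBaseChange (resEnv k A) (redBimodule k A) N i) :=
  extBaseChange_bijective_of_reduction (env_centralComplete k A).reg resEnv_surjective
    resEnv_eq_zero_iff (redBimodule k A)
    (fun x hx => IsTopologicallyFree.eq_zero_of_smul (h := (PowerSeries.X : k⟦X⟧)) (x : A)
      ((algebraMap_env_smul _ _).symm.trans hx))
    redMap_isReduction.surj
    (fun x => (redMap_isReduction.ker (x : A)).trans
      (exists_congr fun y => by
        rw [← algebraMap_env_smul (h := (PowerSeries.X : k⟦X⟧)) PowerSeries.X (y : A)])) N i

omit [Algebra k A] [IsScalarTower k k⟦X⟧ A] in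
variable (k A) in
theorem envRegular_torsionFreeClass : TorsionFreeClass
    (algebraMap k⟦X⟧ (Env (PowerSeries.X : k⟦X⟧) A) PowerSeries.X) (envRegular k A) := by
  refine ⟨⟨⟨{(1 : A)}, ?_⟩⟩, fun x hx => IsTopologicallyFree.eq_zero_of_smul
    (h := (PowerSeries.X : k⟦X⟧)) (x : A) ((algebraMap_env_smul _ _).symm.trans hx), fun x hx => ?_⟩
  · rw [eq_top_iff]
    rintro (a : A) -
    have h1 : inclLeft (PowerSeries.X : k⟦X⟧) a • (1 : A) = a := by rw [inclLeft_smul, mul_one]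
    rw [← h1]
    exact Submodule.smul_mem _ _ (Submodule.subset_span (Finset.mem_coe.2 (Finset.mem_singleton_self _)))
  · refine eq_of_forall_sub (h := (PowerSeries.X : k⟦X⟧)) (N := A) (x := x) (y := 0) fun n => ?_
    obtain ⟨y, hy⟩ := hx n
    refine ⟨y, ?_⟩
    rw [sub_zero, hy, ← map_pow]
    exact algebraMap_env_smul _ _

variable (k A) in
/-- `A ⊗̂ Aᵒᵖ` as a left module over itself. -/
noncomputable abbrev envFree : ModuleCat.{u} (Env (PowerSeries.X : k⟦X⟧) A) :=
  ModuleCat.of (Env (PowerSeries.X : k⟦X⟧) A) (Env (PowerSeries.X : k⟦X⟧) A)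

variable (hN : IsNoetherianRing (Reduction k A ⊗[k] (Reduction k A)ᵐᵒᵖ))

include hN in
theorem env_syzygyClosed : SyzygyClosed (TorsionFreeClass
    (algebraMap k⟦X⟧ (Env (PowerSeries.X : k⟦X⟧) A) PowerSeries.X)) :=
  syzygyClosed_torsionFreeClass (env_centralComplete k A) resEnv_surjective resEnv_eq_zero_iff hN

include hN in
theorem ext_envFree_eq_zero {i : ℕ} (h0 : ∀ e : Ext (regularBimodule k (Reduction k A))
      (ModuleCat.of _ (Reduction k A ⊗[k] (Reduction k A)ᵐᵒᵖ)) i, e = 0)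
    (e : Ext (envRegular k A) (envFree k A) i) : e = 0 := by
  refine ext_eq_zero_of_reduction (env_centralComplete k A) resEnv_surjective resEnv_eq_zero_iff
    (env_syzygyClosed hN) (envRegular_torsionFreeClass k A) (fun e => ?_) e
  obtain ⟨e, rfl⟩ := (extBaseChange_redBimodule_bijective _ i).2 e
  rw [h0 e, map_zero]

include hN in
-- A lift u of v exists because Ext^{d+1}(A, E) = 0. Its freeness over A on each side is inherited
-- from that of v, by completeness of A and vanishing in degree d - 1.
theorem exists_generator_env {d : ℕ} (h0 : ∀ i, i ≠ d → ∀ e : Ext (regularBimodule k (Reduction k A))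
      (ModuleCat.of _ (Reduction k A ⊗[k] (Reduction k A)ᵐᵒᵖ)) i, e = 0)
    (hv : ∃ v : Ext (regularBimodule k (Reduction k A))
        (ModuleCat.of _ (Reduction k A ⊗[k] (Reduction k A)ᵐᵒᵖ)) d,
      (Function.Bijective fun x : Reduction k A => extMul v (leftIncl (k := k) x)) ∧
      Function.Bijective fun y : Reduction k A => extMul v (rightIncl (k := k) y)) :
    ∃ u : Ext (envRegular k A) (envFree k A) d,
      (Function.Bijective fun a : A => extMul u (inclLeft PowerSeries.X a)) ∧
      Function.Bijective fun a : A => extMul u (inclRight PowerSeries.X (op a)) := by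
  obtain ⟨v, hvl, hvr⟩ := hv
  obtain ⟨u, hu⟩ := exists_lift_of_reduction (env_centralComplete k A) resEnv_surjective
    resEnv_eq_zero_iff (ext_envFree_eq_zero hN (h0 (d + 1) (Nat.succ_ne_self d)))
    (extBaseChange (resEnv k A) (redBimodule k A) _ d v)
  have key : ∀ (j : A →ₗ[k⟦X⟧] Env (PowerSeries.X : k⟦X⟧) A)
      (q : Reduction k A →ₗ[k] Reduction k A ⊗[k] (Reduction k A)ᵐᵒᵖ),
      Function.Injective j → (∀ a, resEnv k A (j a) = q (redMap k A a)) →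
      (Function.Bijective fun x : Reduction k A => extMul v (q x)) →
      Function.Bijective fun a : A => extMul u (j a) := by
    intro j q hj hjq hq
    have h1 : ∀ a, (u.comp (Ext.mk₀ (reductionHom (resEnv k A))) (add_zero d)).comp
        (Ext.mk₀ ((ModuleCat.restrictScalars (resEnv k A)).map (elemHom
          (N := ModuleCat.of (Reduction k A ⊗[k] (Reduction k A)ᵐᵒᵖ)
            (Reduction k A ⊗[k] (Reduction k A)ᵐᵒᵖ)) (resEnv k A (j a))))) (add_zero d) =
        extBaseChange (resEnv k A) (redBimodule k A) _ d (extMul v (q (redMap k A a))) := by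
      intro a
      rw [hu, extMul, extBaseChange_comp_mk₀, hjq]
    refine extMul_bijective_of_reduction (env_centralComplete k A) resEnv_surjective
      resEnv_eq_zero_iff (env_syzygyClosed hN) (envRegular_torsionFreeClass k A) (fun i hi e => ?_)
      u j.toAddMonoidHom hj (fun a => ?_) (fun w => ?_) fun a ha => ?_
    · obtain ⟨e, rfl⟩ := (extBaseChange_redBimodule_bijective _ i).2 e
      rw [h0 i (by omega) e, map_zero]
    · obtain ⟨L, hL⟩ := exists_adic_sum (h := (PowerSeries.X : k⟦X⟧)) a
      refine ⟨L, fun n => ?_⟩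
      obtain ⟨z, hz⟩ := hL n
      refine ⟨j z, ?_⟩
      change j L = ∑ i ∈ Finset.range n, _ * j (a i) + _
      rw [hz, map_add, map_sum]
      simp only [j.map_smul]
      simp only [Algebra.smul_def, map_pow]
    · obtain ⟨w, rfl⟩ := (extBaseChange_redBimodule_bijective _ d).2 w
      obtain ⟨x, rfl⟩ := hq.2 w
      obtain ⟨a, rfl⟩ := redMap_isReduction.surj x
      exact ⟨a, (h1 a).symm⟩
    · have h2 := (h1 a).symm.trans ha
      rw [← map_zero (extBaseChange (resEnv k A) (redBimodule k A) _ d)] at h2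
      have h3 := (extBaseChange_redBimodule_bijective _ d).1 h2
      have h4 : redMap k A a = 0 := hq.1 (h3.trans (by
        change 0 = extMul v (q 0)
        rw [map_zero, extMul_zero_right]))
      obtain ⟨y, rfl⟩ := (redMap_isReduction.ker a).1 h4
      refine ⟨y, ?_⟩
      change j _ = _ * j y
      rw [map_smul, Algebra.smul_def]
  refine ⟨u, key (inclLeft PowerSeries.X).toLinearMap leftIncl ?_ resEnv_inclLeft hvl,
    key ((inclRight PowerSeries.X).toLinearMap ∘ₗ (opLinearEquiv k⟦X⟧).toLinearMap) rightIncl ?_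
      resEnv_inclRight hvr⟩
  -- Each embedding of A in E is injective: acting on 1 recovers the element.
  · intro a b hab
    have := congrArg (fun x : Env (PowerSeries.X : k⟦X⟧) A => x • (1 : A)) hab
    change inclLeft PowerSeries.X a • (1 : A) = inclLeft PowerSeries.X b • (1 : A) at this
    rwa [inclLeft_smul, inclLeft_smul, mul_one, mul_one] at this
  · intro a b hab
    have := congrArg (fun x : Env (PowerSeries.X : k⟦X⟧) A => x • (1 : A)) hab
    change inclRight PowerSeries.X (op a) • (1 : A) = inclRight PowerSeries.X (op b) • (1 : A) at this
    rwa [inclRight_smul, inclRight_smul, one_mul, one_mul] at this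

end EnvDuality

end HopfDuality

namespace HopfDuality

open Abelian

section Reduction

variable {k : Type u} [Field k] {A : Type u} [Ring A] [Algebra k A] [Algebra k⟦X⟧ A]
  [IsScalarTower k k⟦X⟧ A] [IsTopologicallyFree (PowerSeries.X : k⟦X⟧) A]

/-- The Hopf structure enters only up to here; the duality is deduced from u, the vanishing and
finiteness. -/
theorem exists_dualizing_generator (H : TopologicalHopfAlgebra (PowerSeries.X : k⟦X⟧) A)
    (hS : Function.Bijective H.antipode) (hA₀ : IsNoetherianRing (Reduction k A)) {d : ℕ}
    (hExt : ∀ i : ℕ, i ≠ d → Subsingleton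
      (Ext (trivialModule H) (ModuleCat.of (Reduction k A) (Reduction k A)) i))
    (hExtd : Nonempty
      (Ext (trivialModule H) (ModuleCat.of (Reduction k A) (Reduction k A)) d ≃ₗ[k] k))
    (hA₀e : IsNoetherianRing (Reduction k A ⊗[k] (Reduction k A)ᵐᵒᵖ)) :
    (∀ i, i ≠ d → ∀ e : Ext (envRegular k A) (envFree k A) i, e = 0) ∧
    ∃ u : Ext (envRegular k A) (envFree k A) d,
      (Function.Bijective fun a : A => extMul u (inclLeft PowerSeries.X a)) ∧
      Function.Bijective fun a : A => extMul u (inclRight PowerSeries.X (op a)) := by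
  let := reductionHopfAlgebra H
  have hχ : ∀ b, counitReduction H b = Coalgebra.counit (R := k) b := fun b => rfl
  have h0 : ∀ i, i ≠ d → ∀ e : Ext (regularBimodule k (Reduction k A))
      (ModuleCat.of _ (Reduction k A ⊗[k] (Reduction k A)ᵐᵒᵖ)) i, e = 0 := fun i hi e =>
    ext_regularBimodule_eq_zero hχ hA₀ (fun i hi e => (hExt i hi).elim e 0) hi e
  exact ⟨fun i hi e => ext_envFree_eq_zero hA₀e (h0 i hi) e, exists_generator_env hA₀e h0
    (exists_generator_regularBimodule hχ hA₀ (antipodeReduction_bijective H hS) hExtd)⟩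

end Reduction

namespace Completion

variable {K : Type u} [CommRing K] {h : K} {R S : Type u} [Ring R] [Algebra K R] [Ring S]
  [Algebra K S]

theorem eq_of_approx {x y : Completion h R} (H : ∀ n, ∃ r, x.Approx h n r ∧ y.Approx h n r) :
    x = y :=
  ext' h fun n => by
    obtain ⟨r, hx, hy⟩ := H n
    exact hx.symm.trans hy

theorem exists_eq_of_add_smul (hR : ∀ r : R, h • r = 0 → r = 0) {x : Completion h R} {n : ℕ} {r : R}
    (hr : x.Approx h n r) : ∃ y, x = of h r + h ^ n • y := by
  obtain ⟨y, hy⟩ := exists_smul_of_proj_eq_zero hR (x := x - of h r) (n := n)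
    (sub_eq_zero.2 hr.symm)
  exact ⟨y, by rw [← hy]; abel⟩

/-- The completion of a homomorphism of algebras. -/
noncomputable def mapAlgHom (f : R →ₐ[K] S) : Completion h R →ₐ[K] Completion h S :=
  AlgHom.ofLinearMap (map f.toLinearMap)
    (eq_of_approx fun n => ⟨1, by
      have := (Approx.of (h := h) (1 : R) n).map f.toLinearMap
      rwa [AlgHom.toLinearMap_apply, map_one (of h), map_one f] at this, Approx.of 1 n⟩)
    fun x y => eq_of_approx fun n => ⟨f (x.rep n * y.rep n),
      ((x.approx_rep n).mul (y.approx_rep n)).map f.toLinearMap, by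
        rw [map_mul]
        exact ((x.approx_rep n).map f.toLinearMap).mul ((y.approx_rep n).map f.toLinearMap)⟩

theorem Approx.mapAlgHom (f : R →ₐ[K] S) {x : Completion h R} {n : ℕ} {r : R}
    (hr : x.Approx h n r) : (Completion.mapAlgHom f x).Approx h n (f r) := hr.map f.toLinearMap

theorem mapAlgHom_of (f : R →ₐ[K] S) (r : R) : mapAlgHom f (of h r) = of h (f r) :=
  eq_of_approx fun n => ⟨f r, (Approx.of r n).mapAlgHom f, Approx.of _ n⟩

/-- The completion of an isomorphism of algebras. -/
noncomputable def congr (f : R ≃ₐ[K] S) : Completion h R ≃ₐ[K] Completion h S :=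
  AlgEquiv.ofAlgHom (mapAlgHom f.toAlgHom) (mapAlgHom f.symm.toAlgHom)
    (AlgHom.ext fun x => eq_of_approx fun n => ⟨x.rep n, by
      have := ((x.approx_rep n).mapAlgHom f.symm.toAlgHom).mapAlgHom f.toAlgHom
      rwa [show f.toAlgHom (f.symm.toAlgHom (x.rep n)) = x.rep n from f.apply_symm_apply _] at this,
      x.approx_rep n⟩)
    (AlgHom.ext fun x => eq_of_approx fun n => ⟨x.rep n, by
      have := ((x.approx_rep n).mapAlgHom f.toAlgHom).mapAlgHom f.symm.toAlgHom
      rwa [show f.symm.toAlgHom (f.toAlgHom (x.rep n)) = x.rep n from f.symm_apply_apply _] at this,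
      x.approx_rep n⟩)

theorem congr_of (f : R ≃ₐ[K] S) (r : R) : congr f (of h r) = of h (f r) :=
  mapAlgHom_of f.toAlgHom r

end Completion

/-! ### The automorphism τ and the bimodule U as a twist of A -/

section Twist

variable {K : Type u} [CommRing K] {h : K} {A : Type u} [Ring A] [Algebra K A]

theorem inclLeft_mul_inclRight (a b : A) :
    inclLeft h a * inclRight h (op b) = Completion.of h (a ⊗ₜ[K] op b) := by
  refine ((Completion.of h).map_mul _ _).symm.trans (congrArg _ ?_)
  exact (Algebra.TensorProduct.tmul_mul_tmul _ _ _ _).trans (by rw [mul_one, one_mul])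

theorem inclRight_mul_inclLeft (a b : A) :
    inclRight h (op b) * inclLeft h a = Completion.of h (a ⊗ₜ[K] op b) := by
  refine ((Completion.of h).map_mul _ _).symm.trans (congrArg _ ?_)
  exact (Algebra.TensorProduct.tmul_mul_tmul _ _ _ _).trans (by rw [mul_one, one_mul])

variable {U : Type u} [AddCommGroup U] [Module K U] [Module (Env h A)ᵐᵒᵖ U]
  [IsScalarTower K (Env h A)ᵐᵒᵖ U] (u : U)

/-- `a ↦ u (a ⊗ 1)`. -/
noncomputable def leftGen : A →ₗ[K] U where
  toFun a := op (inclLeft h a) • u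
  map_add' a b := by rw [map_add, MulOpposite.op_add, add_smul]
  map_smul' c a := by rw [map_smul, MulOpposite.op_smul, smul_assoc, RingHom.id_apply]

/-- `b ↦ u (1 ⊗ b)`. -/
noncomputable def rightGen : A →ₗ[K] U where
  toFun b := op (inclRight h (op b)) • u
  map_add' a b := by rw [MulOpposite.op_add, map_add, MulOpposite.op_add, add_smul]
  map_smul' c a := by rw [MulOpposite.op_smul, map_smul, MulOpposite.op_smul, smul_assoc, RingHom.id_apply]

theorem leftGen_apply (a : A) : leftGen (h := h) u a = op (inclLeft h a) • u := rfl

theorem rightGen_apply (a : A) : rightGen (h := h) u a = op (inclRight h (op a)) • u := rfl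

theorem op_inclLeft_smul_leftGen (a b : A) :
    op (inclLeft h b) • leftGen (h := h) u a = leftGen (h := h) u (a * b) := by
  rw [leftGen_apply, leftGen_apply, smul_smul, ← MulOpposite.op_mul, map_mul]

/-- τ compares the two free generations by u. It is multiplicative: u(1 ⊗ ab) = u(1 ⊗ b)(1 ⊗ a) =
u(τ(b) ⊗ 1)(1 ⊗ a) = u(1 ⊗ a)(τ(b) ⊗ 1) = u(τ(a)τ(b) ⊗ 1), the products in the second factor being
those of Aᵒᵖ. -/
theorem exists_twist (hl : Function.Bijective (leftGen (h := h) (A := A) u))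
    (hr : Function.Bijective (rightGen (h := h) (A := A) u)) :
    ∃ τ : A ≃ₐ[K] A, ∀ b, rightGen (h := h) u b = leftGen (h := h) u (τ b) := by
  let L := LinearEquiv.ofBijective _ hl
  let R := LinearEquiv.ofBijective _ hr
  have hLR : ∀ b, leftGen (h := h) u ((R.trans L.symm) b) = rightGen (h := h) u b := fun b =>
    L.apply_symm_apply _
  refine ⟨AlgEquiv.ofLinearEquiv (R.trans L.symm) (hl.1 ?_) fun a b => hl.1 ?_,
    fun b => (hLR b).symm⟩
  · rw [hLR, leftGen_apply, rightGen_apply, MulOpposite.op_one, map_one, map_one]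
  · rw [hLR, ← op_inclLeft_smul_leftGen, hLR, rightGen_apply, rightGen_apply, smul_smul,
      ← MulOpposite.op_mul, inclRight_mul_inclLeft, ← inclLeft_mul_inclRight, MulOpposite.op_mul,
      MulOpposite.op_mul, mul_smul, ← leftGen_apply, hLR, rightGen_apply, map_mul,
      MulOpposite.op_mul, mul_smul]

/-- The automorphism `τ ⊗̂ id` of the completed enveloping algebra. -/
noncomputable def envTwist (τ : A ≃ₐ[K] A) : Env h A ≃ₐ[K] Env h A :=
  Completion.congr (Algebra.TensorProduct.congr τ AlgEquiv.refl)

theorem envTwist_of (τ : A ≃ₐ[K] A) (a b : A) : envTwist τ (Completion.of h (a ⊗ₜ[K] op b)) =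
    Completion.of h (τ a ⊗ₜ[K] op b) := Completion.congr_of _ _

variable {u} {τ : A ≃ₐ[K] A} (hτ : ∀ b, rightGen (h := h) u b = leftGen (h := h) u (τ b))

include hτ in
-- In the coordinate a ↦ u(a ⊗ 1), the right action of 1 ⊗ b is left multiplication by τ(b).
theorem op_inclRight_smul_leftGen (a b : A) :
    op (inclRight h (op b)) • leftGen (h := h) u a = leftGen (h := h) u (τ b * a) := by
  rw [← op_inclLeft_smul_leftGen, ← hτ, leftGen_apply, rightGen_apply, smul_smul, smul_smul,
    ← MulOpposite.op_mul, ← MulOpposite.op_mul, inclLeft_mul_inclRight, inclRight_mul_inclLeft]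

variable [IsAdicComplete (Ideal.span {h}) A]

include hτ in
theorem op_envTwist_of_smul (r : A ⊗[K] Aᵐᵒᵖ) :
    op (envTwist τ (Completion.of h r)) • u =
      leftGen (h := h) u (τ (op (Completion.of h r) • (1 : A))) := by
  induction r with
  | zero => simp only [map_zero, MulOpposite.op_zero, zero_smul]
  | add x y hx hy => simp only [map_add, MulOpposite.op_add, add_smul, hx, hy]
  | tmul a b =>
    rw [← op_unop b, envTwist_of, op_of_smul, rightAction_tmul, one_mul, unop_op, map_mul,
      ← inclLeft_mul_inclRight, MulOpposite.op_mul, mul_smul, ← leftGen_apply,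
      op_inclRight_smul_leftGen hτ]

include hτ in
-- The identity on A ⊗ Aᵒᵖ extends by continuity: an error h^n y in x changes both sides by h^n
-- multiples, and in the coordinate given by u the comparison takes place in the separated module A.
-- In effect U is the right E-module A twisted by τ.
theorem op_envTwist_smul (hl : Function.Bijective (leftGen (h := h) (A := A) u))
    (hR : ∀ r : A ⊗[K] Aᵐᵒᵖ, h • r = 0 → r = 0) (x : Env h A) :
    op (envTwist τ x) • u = leftGen (h := h) u (τ (op x • (1 : A))) := by
  obtain ⟨a, ha⟩ := hl.2 (op (envTwist τ x) • u)
  rw [← ha]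
  refine congrArg _ (eq_of_forall_sub (h := h) fun n => ?_)
  obtain ⟨y, hy⟩ := Completion.exists_eq_of_add_smul hR (x.approx_rep n)
  obtain ⟨b, hb⟩ := hl.2 (op (envTwist τ y) • u)
  refine ⟨b - τ (op y • (1 : A)), hl.1 ?_⟩
  have h1 : op (h ^ n • y) • (1 : A) = h ^ n • (op y • (1 : A)) := by
    rw [Algebra.smul_def, Algebra.commutes, MulOpposite.op_mul, mul_smul, algebraMap_op_env_smul]
  have h2 : op x • (1 : A) = op (Completion.of h (x.rep n)) • (1 : A) + h ^ n • (op y • (1 : A)) := by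
    rw [← h1, ← add_smul, ← MulOpposite.op_add, ← hy]
  have h3 : leftGen (h := h) u a = leftGen (h := h) u (τ (op (Completion.of h (x.rep n)) • (1 : A))) +
      h ^ n • leftGen (h := h) u b := by
    rw [ha, ← op_envTwist_of_smul hτ, hb, ← smul_assoc, ← add_smul, ← MulOpposite.op_smul,
      ← MulOpposite.op_add, ← map_smul, ← map_add, ← hy]
  rw [map_sub, LinearMap.map_smul, map_sub, h2, h3, map_add, map_add, map_smul τ (h ^ n), LinearMap.map_smul,
    smul_sub]
  abel

end Twist

end HopfDuality

namespace HopfDuality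

/-! ### Tensor products as quotients and the canonical action -/

namespace BalancedTensor

variable {K : Type u} [CommRing K] {S B : Type u} [Ring S] [Algebra K S] [Ring B] [Algebra K B]
  (f : S →ₐ[K] B) {N : Type u} [AddCommGroup N] [Module K N] [Module Bᵐᵒᵖ N]
  {M : Type u} [AddCommGroup M] [Module K M] [Module B M]

theorem tmul_smul (n : N) (s : S) (m : M) :
    tmul f n (f s • m) = tmul f (op (f s) • n) m :=
  ((Submodule.Quotient.eq (balancedRelations f N M)).2
    (Submodule.subset_span ⟨s, n, m, rfl⟩)).symm

variable (M) in
/-- The map `m ↦ n ⊗ m`. -/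
def mk (n : N) : M →ₗ[K] BalancedTensor f N M :=
  (balancedRelations f N M).mkQ ∘ₗ TensorProduct.mk K N M n

theorem mk_apply (n : N) (m : M) : mk f M n m = tmul f n m := rfl

/-- If every `n` is `n₀ f(σ n)`, then every tensor is of the form `n₀ ⊗ m`. -/
theorem mk_surjective {n₀ : N} (H : ∀ n : N, ∃ s, n = op (f s) • n₀) :
    Function.Surjective (mk f M n₀) := by
  rintro ⟨z⟩
  change ∃ a, mk f M n₀ a = (balancedRelations f N M).mkQ z
  induction z with
  | zero => exact ⟨0, by rw [map_zero, map_zero]⟩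
  | add x y hx hy =>
    obtain ⟨a, ha⟩ := hx
    obtain ⟨b, hb⟩ := hy
    exact ⟨a + b, by rw [map_add, map_add, ha, hb]⟩
  | tmul n m =>
    obtain ⟨s, rfl⟩ := H n
    exact ⟨f s • m, tmul_smul f n₀ s m⟩

/-- A balanced bilinear map on the tensor product. -/
def lift {P : Type u} [AddCommGroup P] [Module K P] (g : N →ₗ[K] M →ₗ[K] P)
    (hg : ∀ s n m, g (op (f s) • n) m = g n (f s • m)) : BalancedTensor f N M →ₗ[K] P :=
  (balancedRelations f N M).liftQ (TensorProduct.lift g) (by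
    rw [balancedRelations, Submodule.span_le]
    rintro _ ⟨s, n, m, rfl⟩
    rw [SetLike.mem_coe, LinearMap.mem_ker, map_sub, TensorProduct.lift.tmul,
      TensorProduct.lift.tmul, hg, sub_self])

theorem lift_tmul {P : Type u} [AddCommGroup P] [Module K P] (g : N →ₗ[K] M →ₗ[K] P)
    (hg : ∀ s n m, g (op (f s) • n) m = g n (f s • m)) (n : N) (m : M) :
    lift f g hg (tmul f n m) = g n m := rfl

end BalancedTensor

section Twist

variable {K : Type u} [CommRing K] {h : K} {A : Type u} [Ring A] [Algebra K A]

section Annihilated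

variable (W : Type u) [AddCommGroup W] [Module K W] [Module (Env h A) W]
  [IsScalarTower K (Env h A) W]
  {N : Type u} [AddCommGroup N] [Module (Env h A)ᵐᵒᵖ N] (n₀ : N)

variable (h A) in
/-- The sums of elements `x w` with `n₀ x = 0`. -/
def annihilated : Submodule K W where
  toAddSubmonoid := (AddSubgroup.closure
    {z : W | ∃ (x : Env h A) (w : W), op x • n₀ = 0 ∧ z = x • w}).toAddSubmonoid
  smul_mem' c z hz := by
    change c • z ∈ AddSubgroup.closure _
    change z ∈ AddSubgroup.closure _ at hz
    induction hz using AddSubgroup.closure_induction with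
    | mem z hz =>
      obtain ⟨x, w, hx, rfl⟩ := hz
      refine AddSubgroup.subset_closure ⟨x, algebraMap K (Env h A) c • w, hx, ?_⟩
      rw [smul_smul, ← Algebra.commutes, mul_smul, algebraMap_smul]
    | zero => rw [smul_zero]; exact zero_mem _
    | add x y _ _ hx hy => rw [smul_add]; exact add_mem hx hy
    | neg x _ hx => rw [smul_neg]; exact neg_mem hx

theorem mem_annihilated {w : W} : w ∈ annihilated h A W n₀ ↔ w ∈ AddSubgroup.closure
    {z : W | ∃ (x : Env h A) (w : W), op x • n₀ = 0 ∧ z = x • w} := Iff.rfl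

end Annihilated

section Regular

variable [IsAdicComplete (Ideal.span {h}) A]
  {W : Type u} [AddCommGroup W] [Module K W] [Module (Env h A) W] [IsScalarTower K (Env h A) W]

omit [IsScalarTower K (Env h A) W] in
theorem mk_one_surjective :
    Function.Surjective (BalancedTensor.mk (AlgHom.id K (Env h A)) W (1 : A)) :=
  BalancedTensor.mk_surjective _ fun n => ⟨inclLeft h n, by
    rw [AlgHom.id_apply, op_inclLeft_smul, one_mul]⟩

/-- The map `a ⊗ w ↦ (a ⊗ 1) w`, with values in the quotient of `W` by the submodule generated by
the annihilator of `1`. -/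
noncomputable def tensorToQuotient :
    BalancedTensor (AlgHom.id K (Env h A)) A W →ₗ[K] W ⧸ annihilated h A W (1 : A) :=
  BalancedTensor.lift _ (LinearMap.mk₂ K
    (fun a w => (annihilated h A W (1 : A)).mkQ (inclLeft h a • w))
    (fun a b w => by rw [map_add, add_smul, map_add])
    (fun c a w => by rw [map_smul (inclLeft h), smul_assoc, LinearMap.map_smul])
    (fun a w w' => by rw [smul_add, map_add])
    (fun c a w => by
      rw [← algebraMap_smul (Env h A) c w, smul_smul, ← Algebra.commutes, mul_smul, algebraMap_smul,
        LinearMap.map_smul])) (fun x a w => by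
      rw [AlgHom.id_apply, LinearMap.mk₂_apply, LinearMap.mk₂_apply]
      refine (Submodule.Quotient.eq _).2 ?_
      rw [smul_smul, ← sub_smul, mem_annihilated]
      refine AddSubgroup.subset_closure ⟨_, w, ?_, rfl⟩
      rw [MulOpposite.op_sub, sub_smul, op_inclLeft_smul, one_mul, MulOpposite.op_mul, mul_smul,
        op_inclLeft_smul, one_mul, sub_self])

/-- A is cyclic as a right E-module, generated by 1, so A ⊗ W is W modulo the elements that the
annihilator of 1 produces; `tensorToQuotient` detects this. -/
theorem mk_one_eq_zero_iff (w : W) :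
    BalancedTensor.mk (AlgHom.id K (Env h A)) W (1 : A) w = 0 ↔ w ∈ annihilated h A W (1 : A) := by
  constructor
  · intro hw
    have h1 := congrArg tensorToQuotient hw
    rw [map_zero, BalancedTensor.mk_apply, tensorToQuotient, BalancedTensor.lift_tmul,
      LinearMap.mk₂_apply, map_one, one_smul] at h1
    exact (Submodule.Quotient.mk_eq_zero _).1 h1
  · intro hw
    rw [mem_annihilated] at hw
    induction hw using AddSubgroup.closure_induction with
    | mem z hz =>
      obtain ⟨x, w, hx, rfl⟩ := hz
      have h1 := BalancedTensor.tmul_smul (AlgHom.id K (Env h A)) (1 : A) x w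
      rw [AlgHom.id_apply, hx] at h1
      exact h1.trans ((congrArg _ (TensorProduct.zero_tmul _ _)).trans (map_zero _))
    | zero => exact map_zero _
    | add x y _ _ hx hy => rw [map_add, hx, hy, add_zero]
    | neg x _ hx => rw [map_neg, hx, neg_zero]

end Regular

section Dualizing

variable {U : Type u} [AddCommGroup U] [Module K U] [Module (Env h A)ᵐᵒᵖ U]
  [IsScalarTower K (Env h A)ᵐᵒᵖ U] {u : U} (hl : Function.Bijective (leftGen (h := h) (A := A) u))
  {W : Type u} [AddCommGroup W] [Module K W] [Module (Env h A) W] [IsScalarTower K (Env h A) W]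

omit [IsScalarTower K (Env h A) W] in
theorem tmul_leftGen (a : A) (w : W) :
    BalancedTensor.tmul (inclLeft (A := A) h) (leftGen (h := h) u a) w =
      BalancedTensor.tmul (inclLeft (A := A) h) u (inclLeft h a • w) :=
  (BalancedTensor.tmul_smul (inclLeft h) u a w).symm

variable (W) in
/-- `W ≃ U ⊗_A W`, `w ↦ u ⊗ w`, for a bimodule `U` freely generated by `u` as a right module. -/
noncomputable def dualTensorEquiv : W ≃ₗ[K] BalancedTensor (inclLeft (A := A) h) U W :=
  LinearEquiv.ofBijective (BalancedTensor.mk (inclLeft h) W u) ⟨by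
    let e := LinearEquiv.ofBijective _ hl
    -- The left inverse sends u(a ⊗ 1) ⊗ w to (a ⊗ 1)w.
    let g : BalancedTensor (inclLeft (A := A) h) U W →ₗ[K] W :=
      BalancedTensor.lift _ (LinearMap.mk₂ K
        (fun v w => inclLeft h (e.symm v) • w)
        (fun a b w => by rw [map_add, map_add, add_smul])
        (fun c a w => by rw [map_smul, map_smul, smul_assoc])
        (fun a w w' => by rw [smul_add])
        (fun c a w => by
          rw [← algebraMap_smul (Env h A) c w, smul_smul, ← Algebra.commutes, mul_smul,
            algebraMap_smul])) (fun s v w => by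
          rw [LinearMap.mk₂_apply, LinearMap.mk₂_apply, smul_smul, ← map_mul]
          congr 2
          refine e.injective ?_
          rw [e.apply_symm_apply]
          obtain ⟨a, rfl⟩ := e.surjective v
          rw [e.symm_apply_apply]
          exact op_inclLeft_smul_leftGen u a s)
    refine Function.LeftInverse.injective (g := g) fun w => ?_
    rw [BalancedTensor.mk_apply, BalancedTensor.lift_tmul, LinearMap.mk₂_apply]
    have h1 : e.symm u = (1 : A) := e.injective (by
      rw [e.apply_symm_apply]
      change u = op (inclLeft h (1 : A)) • u
      rw [map_one, MulOpposite.op_one, one_smul])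
    rw [h1, map_one, one_smul],
  BalancedTensor.mk_surjective _ fun n => by
    obtain ⟨a, rfl⟩ := hl.2 n
    exact ⟨a, rfl⟩⟩

end Dualizing

/-- The automorphism `τ ⊗̂ id`, as a ring homomorphism. -/
noncomputable def envTwistHom (τ : A ≃ₐ[K] A) : Env h A →+* Env h A :=
  RingHomClass.toRingHom (envTwist (h := h) τ)

section Canonical

variable [IsAdicComplete (Ideal.span {h}) A] {d : ℕ} {u : DualizingBimodule h A d}
  (hl : Function.Bijective (leftGen (h := h) (A := A) u)) {τ : A ≃ₐ[K] A}
  (hτ : ∀ b, rightGen (h := h) u b = leftGen (h := h) u (τ b))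

include hτ in
-- Under w ↦ u ⊗ w the action on generators becomes left multiplication by the twisted element,
-- which makes sense on all of E and so provides the limits.
theorem actOnGenerator_leftGen (a : A) (r : A ⊗[K] Aᵐᵒᵖ) :
    actOnGenerator (leftGen (h := h) u a) r =
      BalancedTensor.mk (inclLeft h) (Env h A) u
        (envTwist τ (Completion.of h r) * inclLeft h a) := by
  induction r with
  | zero => simp only [map_zero, zero_mul]
  | add x y hx hy => simp only [map_add, add_mul, hx, hy]
  | tmul a' b =>
    rw [← op_unop b, envTwist_of, ← inclRight_mul_inclLeft]
    change BalancedTensor.tmul (inclLeft h) (op (inclRight h (op a')) • leftGen u a)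
      (inclRight h (op b.unop)) = BalancedTensor.tmul _ _ _
    rw [op_inclRight_smul_leftGen hτ, tmul_leftGen]
    rw [smul_eq_mul, inclLeft_mul_inclRight, ← inclRight_mul_inclLeft, map_mul, mul_assoc]

include hτ in
theorem isActionLimit_twist (hR : ∀ r : A ⊗[K] Aᵐᵒᵖ, h • r = 0 → r = 0) (x : Env h A) (a : A) :
    IsActionLimit x (leftGen (h := h) u a)
      (BalancedTensor.tmul (inclLeft h) u (envTwist τ x * inclLeft h a)) := by
  intro n r hr
  obtain ⟨y, rfl⟩ := Completion.exists_eq_of_add_smul hR hr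
  refine ⟨BalancedTensor.mk (inclLeft h) (Env h A) u (envTwist τ y * inclLeft h a), ?_⟩
  rw [actOnGenerator_leftGen hτ, ← BalancedTensor.mk_apply, ← map_sub, ← map_smul, map_add, add_mul,
    add_sub_cancel_left, map_smul, smul_mul_assoc]

include hτ hl in
-- Limits are unique because U ⊗_A E is isomorphic to E, which is h-adically separated.
theorem eq_of_isActionLimit (hR : ∀ r : A ⊗[K] Aᵐᵒᵖ, h • r = 0 → r = 0) (x : Env h A) (a : A)
    {w : DualizingTensor (h := h) (A := A) d (Env h A)}
    (hw : IsActionLimit x (leftGen (h := h) u a) w) :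
    w = BalancedTensor.tmul (inclLeft h) u (envTwist τ x * inclLeft h a) := by
  have := Completion.isAdicComplete (h := h) (R := A ⊗[K] Aᵐᵒᵖ) hR
  let e := dualTensorEquiv hl (Env h A)
  refine e.symm.injective (eq_of_forall_sub (h := h) fun n => ?_)
  obtain ⟨v, hv⟩ := hw n _ (x.approx_rep n)
  obtain ⟨v', hv'⟩ := isActionLimit_twist hτ hR x a n _ (x.approx_rep n)
  refine ⟨e.symm (v - v'), ?_⟩
  rw [← map_sub, ← map_smul, smul_sub, ← hv, ← hv', sub_sub_sub_cancel_right]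

variable (M : ModuleCat.{u} (Env h A))

/-- The module structure on `U ⊗_A M` transported from the twist of `M`. -/
noncomputable abbrev twistAction (τ : A ≃ₐ[K] A) :
    Module (Env h A) (DualizingTensor (h := h) (A := A) d M) :=
  let e := (dualTensorEquiv hl M).symm.toAddEquiv
  letI := Module.compHom M (envTwistHom (h := h) τ)
  e.module (Env h A)

theorem twistAction_tmul (x : Env h A) (m : M) :
    (twistAction hl M τ).smul x (BalancedTensor.tmul (inclLeft h) u m) =
      BalancedTensor.tmul (inclLeft h) u (envTwist τ x • m) := by
  change dualTensorEquiv hl M (envTwist τ x • (dualTensorEquiv hl M).symm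
    (dualTensorEquiv hl M m)) = _
  rw [LinearEquiv.symm_apply_apply]
  rfl

include hl hτ in
-- The limits exist, are unique and are known explicitly. As every tensor is some u ⊗ m, the formula
-- on the right determines the action, and transport from the twist of M realizes it.
theorem isCanonicalAction_iff (hR : ∀ r : A ⊗[K] Aᵐᵒᵖ, h • r = 0 → r = 0)
    (inst : Module (Env h A) (DualizingTensor (h := h) (A := A) d M)) :
    IsCanonicalAction d M inst ↔ ∀ (x : Env h A) (m : M),
      inst.smul x (BalancedTensor.tmul (inclLeft h) u m) =
        BalancedTensor.tmul (inclLeft h) u (envTwist τ x • m) := by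
  constructor
  · intro H x m
    have h1 := isActionLimit_twist hτ hR x 1
    have h2 : leftGen (h := h) u (1 : A) = u := by
      rw [leftGen_apply, map_one, MulOpposite.op_one, one_smul]
    rw [h2, map_one, mul_one] at h1
    exact H x u _ h1 m
  · intro H x u' w hw m
    obtain ⟨a, rfl⟩ := hl.2 u'
    rw [eq_of_isActionLimit hl hτ hR x a hw, tmul_leftGen, H, smul_smul]
    rfl

include hl hτ in
theorem existsUnique_canonicalAction (hR : ∀ r : A ⊗[K] Aᵐᵒᵖ, h • r = 0 → r = 0) :
    ∃! inst : Module (Env h A) (DualizingTensor (h := h) (A := A) d M),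
      IsCanonicalAction d M inst := by
  refine ⟨twistAction hl M τ, (isCanonicalAction_iff hl hτ M hR _).2 (twistAction_tmul hl M),
    fun inst H => ?_⟩
  replace H := (isCanonicalAction_iff hl hτ M hR inst).1 H
  refine Module.ext' inst _ fun x z => ?_
  obtain ⟨m, rfl⟩ := (dualTensorEquiv hl M).surjective z
  exact (H x m).trans (twistAction_tmul hl M x m).symm

/-- A canonical action identifies `U ⊗_A M` with the twist of `M`. -/
theorem nonempty_iso_of_isCanonicalAction (hl : Function.Bijective (leftGen (h := h) (A := A) u))
    (hτ : ∀ b, rightGen (h := h) u b = leftGen (h := h) u (τ b))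
    (hR : ∀ r : A ⊗[K] Aᵐᵒᵖ, h • r = 0 → r = 0)
    (inst : Module (Env h A) (DualizingTensor (h := h) (A := A) d M))
    (H : IsCanonicalAction d M inst) :
    Nonempty ((ModuleCat.restrictScalars (envTwistHom τ)).obj M ≅
      ModuleCat.of (Env h A) (DualizingTensor (h := h) (A := A) d M)) := by
  rw [isCanonicalAction_iff hl hτ M hR] at H
  let N := (ModuleCat.restrictScalars (envTwistHom (h := h) τ)).obj M
  let e : N →ₗ[Env h A] DualizingTensor (h := h) (A := A) d M :=
    { toFun := dualTensorEquiv hl M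
      map_add' := map_add _
      map_smul' := fun x m => (H x m).symm }
  exact ⟨(LinearEquiv.ofBijective e (dualTensorEquiv hl M).bijective).toModuleIso⟩

end Canonical

end Twist

end HopfDuality

namespace HopfDuality

open Abelian

/-- With φ a cokernel of the incoming map, homology is the kernel induced on that cokernel. Only the
kernel of the outgoing map matters, so ψ may take values anywhere. -/
theorem nonempty_homology_equiv_ker {K : Type u} [CommRing K] (S : ShortComplex (ModuleCat.{u} K))
    {Y Z : Type*} [AddCommGroup Y] [Module K Y] [AddCommGroup Z] [Module K Z] (φ : S.X₂ →ₗ[K] Y)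
    (ψ : Y →ₗ[K] Z) (hφ : Function.Surjective φ) (hker : ∀ z, φ z = 0 ↔ ∃ y, S.f.hom y = z)
    (hg : ∀ z, S.g.hom z = 0 ↔ ψ (φ z) = 0) : Nonempty (S.homology ≃ₗ[K] LinearMap.ker ψ) := by
  let χ : LinearMap.ker S.g.hom →ₗ[K] LinearMap.ker ψ :=
    (φ ∘ₗ (LinearMap.ker S.g.hom).subtype).codRestrict _ fun z => (hg z.1).1 z.2
  have hχ : Function.Surjective χ := by
    rintro ⟨y, hy⟩
    obtain ⟨z, rfl⟩ := hφ y
    exact ⟨⟨z, (hg z).2 hy⟩, rfl⟩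
  have hk : LinearMap.range S.moduleCatToCycles = LinearMap.ker χ := by
    ext z
    constructor
    · rintro ⟨y, rfl⟩
      exact Subtype.ext ((hker _).2 ⟨y, rfl⟩)
    · intro hz
      obtain ⟨y, hy⟩ := (hker z.1).1 (congrArg Subtype.val hz)
      exact ⟨y, Subtype.ext hy⟩
  exact ⟨S.moduleCatHomologyIso.toLinearEquiv.trans
    ((Submodule.quotEquivOfEq _ _ hk).trans (χ.quotKerEquivOfSurjective hχ))⟩

section ExtLinear

variable {K : Type u} [CommRing K] {R : Type u} [Ring R] [Algebra K R]

/-- The linear map on `Ext` induced by a morphism of the coefficients. -/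
noncomputable def extPost (X : ModuleCat.{u} R) {N N' : ModuleCat.{u} R} (g : N ⟶ N') (i : ℕ) :
    Ext X N i →ₗ[K] Ext X N' i where
  toFun e := e.comp (Ext.mk₀ g) (add_zero i)
  map_add' _ _ := Ext.add_comp _ _ _ _
  map_smul' _ _ := Ext.smul_comp _ _ _ _

theorem extPost_apply (X : ModuleCat.{u} R) {N N' : ModuleCat.{u} R} (g : N ⟶ N') (i : ℕ)
    (e : Ext X N i) : extPost (K := K) X g i e = e.comp (Ext.mk₀ g) (add_zero i) := rfl

theorem extPost_comp (X : ModuleCat.{u} R) {N N' N'' : ModuleCat.{u} R} (g : N ⟶ N') (g' : N' ⟶ N'')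
    (i : ℕ) (e : Ext X N i) :
    extPost (K := K) X (g ≫ g') i e = extPost (K := K) X g' i (extPost (K := K) X g i e) := by
  rw [extPost_apply, extPost_apply, extPost_apply, Ext.comp_assoc_of_third_deg_zero,
    Ext.mk₀_comp_mk₀]

/-- The connecting homomorphism, as a linear map. -/
noncomputable def extConnecting (X : ModuleCat.{u} R) {S : ShortComplex (ModuleCat.{u} R)}
    (hS : S.ShortExact) (i : ℕ) : Ext X S.X₃ i →ₗ[K] Ext X S.X₁ (i + 1) where
  toFun e := e.comp hS.extClass rfl
  map_add' _ _ := Ext.add_comp _ _ _ _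
  map_smul' _ _ := Ext.smul_comp _ _ _ _

/-- The isomorphism of dimension shifting. -/
noncomputable def extShift (X : ModuleCat.{u} R) {S : ShortComplex (ModuleCat.{u} R)}
    (hS : S.ShortExact) {i : ℕ} (h0 : ∀ e : Ext X S.X₂ i, e = 0) :
    Ext X S.X₃ i ≃ₗ[K] LinearMap.ker (extPost (K := K) X S.f (i + 1)) :=
  LinearEquiv.ofBijective
    ((extConnecting X hS i).codRestrict _ fun e => by
      rw [LinearMap.mem_ker, extPost_apply]
      change (e.comp hS.extClass rfl).comp _ _ = 0
      rw [Ext.comp_assoc_of_third_deg_zero, hS.extClass_comp, Ext.comp_zero])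
    ⟨(injective_iff_map_eq_zero _).2 fun e he => by
      obtain ⟨x, rfl⟩ := Ext.covariant_sequence_exact₃ X hS e rfl (congrArg Subtype.val he)
      rw [h0 x, Ext.zero_comp], fun ⟨e, he⟩ => by
      obtain ⟨x, rfl⟩ := Ext.covariant_sequence_exact₁ X hS e he rfl
      exact ⟨x, rfl⟩⟩

end ExtLinear

/-! ### Dimension shifting along a resolution -/

section Resolution

variable {R : Type u} [Ring R] (C : ChainComplex (ModuleCat.{u} R) ℕ)
  (hC : ∀ n, (ShortComplex.mk _ _ (C.d_comp_d (n + 2) (n + 1) n)).Exact)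

/-- The cokernel of `C (n + 1) → C n`. -/
noncomputable def coker (n : ℕ) : ModuleCat.{u} R :=
  ModuleCat.of R (C.X n ⧸ LinearMap.range (C.d (n + 1) n).hom)

/-- The projection from `C n` to the cokernel of `C (n + 1) → C n`. -/
noncomputable def cokerProj (n : ℕ) : C.X n ⟶ coker C n :=
  ModuleCat.ofHom (LinearMap.range (C.d (n + 1) n).hom).mkQ

/-- The map from the cokernel of `C (n + 2) → C (n + 1)` to `C n`. -/
noncomputable def cokerIncl (n : ℕ) : coker C (n + 1) ⟶ C.X n :=
  ModuleCat.ofHom ((LinearMap.range (C.d (n + 2) (n + 1)).hom).liftQ (C.d (n + 1) n).hom (by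
    rintro _ ⟨x, rfl⟩
    exact DFunLike.congr_fun (congrArg ModuleCat.Hom.hom (C.d_comp_d (n + 2) (n + 1) n)) x))

theorem cokerProj_comp_cokerIncl (n : ℕ) : cokerProj C (n + 1) ≫ cokerIncl C n = C.d (n + 1) n :=
  ModuleCat.hom_ext (LinearMap.ext fun _ => rfl)

theorem cokerIncl_comp_cokerProj (n : ℕ) : cokerIncl C n ≫ cokerProj C n = 0 := by
  ext1
  refine Submodule.linearMap_qext _ (LinearMap.ext fun x => ?_)
  exact (Submodule.Quotient.mk_eq_zero _).2 ⟨x, rfl⟩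

theorem d_comp_cokerProj (n : ℕ) : C.d (n + 1) n ≫ cokerProj C n = 0 := by
  rw [← cokerProj_comp_cokerIncl, Category.assoc, cokerIncl_comp_cokerProj, Limits.comp_zero]

include hC in
theorem coker_shortExact (n : ℕ) :
    (ShortComplex.mk _ _ (cokerIncl_comp_cokerProj C n)).ShortExact := by
  refine ModuleCat.shortComplex_shortExact _ (fun x => ⟨fun hx => ?_, ?_⟩) ?_
    (Submodule.mkQ_surjective _)
  · obtain ⟨y, rfl⟩ := (Submodule.Quotient.mk_eq_zero _).1 hx
    exact ⟨Submodule.Quotient.mk y, rfl⟩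
  · rintro ⟨y, rfl⟩
    exact DFunLike.congr_fun (congrArg ModuleCat.Hom.hom (cokerIncl_comp_cokerProj C n)) y
  · refine (injective_iff_map_eq_zero (cokerIncl C n).hom).2 ?_
    rintro ⟨x⟩ hx
    obtain ⟨y, rfl⟩ := (ShortComplex.moduleCat_exact_iff _).1 (hC n) x hx
    exact (Submodule.Quotient.mk_eq_zero _).2 ⟨y, rfl⟩

variable {K : Type u} [CommRing K] [Algebra K R] {X : ModuleCat.{u} R} {d : ℕ}
  (hP : ∀ n i, i ≠ d → ∀ e : Ext X (C.X n) i, e = 0)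

include hC hP in
-- Lowering i and n together along coker (n+1) → C n → coker n ends in degree zero with a submodule
-- of some C n, and Hom(X, C n) = 0; the bound i < n guarantees that such a term remains.
theorem ext_coker_eq_zero {i n : ℕ} (hin : i < n) (hid : i < d) (e : Ext X (coker C n) i) :
    e = 0 := by
  induction i generalizing n with
  | zero =>
    obtain ⟨n, rfl⟩ := Nat.exists_eq_succ_of_ne_zero hin.ne'
    have := (coker_shortExact C hC n).mono_f
    refine Ext.postcomp_mk₀_injective_of_mono X (cokerIncl C n) ?_
    exact (hP n 0 hid.ne _).trans (Ext.zero_comp X 0 (Ext.mk₀ (cokerIncl C n)) 0 (add_zero 0)).symm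
  | succ i ih =>
    obtain ⟨n, rfl⟩ := Nat.exists_eq_succ_of_ne_zero (Nat.ne_of_gt (Nat.zero_lt_of_lt hin))
    obtain ⟨x, rfl⟩ := Ext.covariant_sequence_exact₁ X (coker_shortExact C hC n) e
      (hP n _ hid.ne _) rfl
    rw [ih (Nat.lt_of_succ_lt_succ hin) (Nat.lt_of_succ_lt hid) x, Ext.zero_comp]

include hC hP in
-- Strictly below degree d both neighbouring terms Ext(X, C n) vanish, so each connecting map is
-- bijective.
theorem nonempty_ext_coker_equiv (m : ℕ) {i n : ℕ} (hi : i + m < d) :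
    Nonempty (Ext X (coker C n) i ≃ₗ[K] Ext X (coker C (n + m)) (i + m)) := by
  induction m with
  | zero => exact ⟨LinearEquiv.refl K _⟩
  | succ m ih =>
    obtain ⟨e⟩ := ih (by omega)
    have h1 := extShift (K := K) X (coker_shortExact C hC (n + m)) (hP (n + m) (i + m) (by omega))
    have h2 : LinearMap.ker (extPost (K := K) X (cokerIncl C (n + m)) (i + m + 1)) = ⊤ :=
      eq_top_iff.2 fun x _ => hP (n + m) (i + m + 1) (by omega) _
    exact ⟨e.trans (h1.trans ((LinearEquiv.ofEq _ _ h2).trans Submodule.topEquiv))⟩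

variable (hright : ∀ (N : ModuleCat.{u} R) (e : Ext X N (d + 1)), e = 0)
  (D : ChainComplex (ModuleCat.{u} K) ℕ) (η : ∀ n, Ext X (C.X n) d ≃ₗ[K] D.X n)
  (hη : ∀ n e, (D.d (n + 1) n).hom (η (n + 1) e) = η n (extPost (K := K) X (C.d (n + 1) n) d e))

include hC hright in
-- Ext^d(X, -) is right exact since Ext^{d+1}(X, -) vanishes.
theorem extPost_cokerProj_surjective (n : ℕ) :
    Function.Surjective (extPost (K := K) X (cokerProj C n) d) := fun e => by
  obtain ⟨x, hx⟩ := Ext.covariant_sequence_exact₃ X (coker_shortExact C hC n) e rfl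
    (hright _ _)
  exact ⟨x, hx⟩

include hC hright hη in
theorem extPost_cokerProj_eq_zero_iff (n : ℕ) (z : D.X n) :
    extPost (K := K) X (cokerProj C n) d ((η n).symm z) = 0 ↔
      ∃ y, (D.d (n + 1) n).hom y = z := by
  constructor
  · intro hz
    obtain ⟨x, hx⟩ := Ext.covariant_sequence_exact₂ X (coker_shortExact C hC n) ((η n).symm z) hz
    obtain ⟨y, rfl⟩ := extPost_cokerProj_surjective C hC (K := K) hright (n + 1) x
    refine ⟨η (n + 1) y, ?_⟩
    rw [hη, ← cokerProj_comp_cokerIncl, extPost_comp]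
    exact (congrArg (η n) hx).trans ((η n).apply_symm_apply z)
  · rintro ⟨y, rfl⟩
    obtain ⟨x, rfl⟩ := (η (n + 1)).surjective y
    rw [hη, LinearEquiv.symm_apply_apply, ← extPost_comp, d_comp_cokerProj, extPost_apply,
      Ext.mk₀_zero, Ext.comp_zero]

include hC hright hη in
theorem nonempty_homology_succ_equiv (n : ℕ) :
    Nonempty (D.homology (n + 1) ≃ₗ[K]
      LinearMap.ker (extPost (K := K) X (cokerIncl C n) d)) := by
  obtain ⟨e⟩ := nonempty_homology_equiv_ker (D.sc' (n + 2) (n + 1) n)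
    (extPost (K := K) X (cokerProj C (n + 1)) d ∘ₗ (η (n + 1)).symm.toLinearMap)
    (extPost (K := K) X (cokerIncl C n) d)
    ((extPost_cokerProj_surjective (K := K) C hC hright (n + 1)).comp (η (n + 1)).symm.surjective)
    (extPost_cokerProj_eq_zero_iff C hC hright D η hη (n + 1)) fun z => by
      obtain ⟨x, rfl⟩ := (η (n + 1)).surjective z
      change (D.d (n + 1) n).hom (η (n + 1) x) = 0 ↔ extPost (K := K) X (cokerIncl C n) d
        (extPost (K := K) X (cokerProj C (n + 1)) d ((η (n + 1)).symm (η (n + 1) x))) = 0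
      rw [hη, LinearEquiv.symm_apply_apply, ← extPost_comp, cokerProj_comp_cokerIncl,
        LinearEquiv.map_eq_zero_iff]
  exact ⟨(ShortComplex.homologyMapIso (D.isoSc' (n + 2) (n + 1) n
    (ChainComplex.prev ℕ (n + 1)) (ChainComplex.next_nat_succ n))).toLinearEquiv.trans e⟩

include hC hright hη in
theorem nonempty_homology_zero_equiv :
    Nonempty (D.homology 0 ≃ₗ[K] Ext X (coker C 0) d) := by
  obtain ⟨e⟩ := nonempty_homology_equiv_ker (D.sc' 1 0 0)
    (extPost (K := K) X (cokerProj C 0) d ∘ₗ (η 0).symm.toLinearMap)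
    (0 : Ext X (coker C 0) d →ₗ[K] K)
    ((extPost_cokerProj_surjective (K := K) C hC hright 0).comp (η 0).symm.surjective)
    (extPost_cokerProj_eq_zero_iff C hC hright D η hη 0) fun z => by
      refine iff_of_true ?_ rfl
      change (D.d 0 0).hom z = 0
      rw [D.shape 0 0 (by simp)]
      rfl
  exact ⟨((ShortComplex.homologyMapIso (D.isoSc' 1 0 0
    (ChainComplex.prev ℕ 0) ChainComplex.next_nat_zero)).toLinearEquiv.trans e).trans
    ((LinearEquiv.ofEq _ _ LinearMap.ker_zero).trans Submodule.topEquiv)⟩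

include hC hP hright hη in
-- For j + 1 in place of j, shifting j times reaches Ext^{d-1}(X, coker j). The last shift meets
-- Ext^d(X, C j), which need not vanish, so it only yields the kernel of Ext^d(X, coker (j+1)) →
-- Ext^d(X, C j), which is the homology.
theorem nonempty_homology_equiv_ext {i j : ℕ} (hij : i + j = d) :
    Nonempty (Ext X (coker C 0) i ≃ₗ[K] D.homology j) := by
  cases j with
  | zero =>
    obtain rfl : i = d := hij
    obtain ⟨e⟩ := nonempty_homology_zero_equiv C hC hright D η hη
    exact ⟨e.symm⟩
  | succ j =>
    subst hij
    obtain ⟨e₁⟩ := nonempty_homology_succ_equiv C hC hright D η hη j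
    obtain ⟨e₂⟩ := nonempty_ext_coker_equiv (K := K) C hC hP j (n := 0)
      (show i + j < i + (j + 1) by omega)
    rw [zero_add] at e₂
    have e₃ := extShift (K := K) X (coker_shortExact C hC j) (hP j (i + j) (by omega))
    exact ⟨e₂.trans (e₃.trans e₁.symm)⟩

include hC hP hright hη in
-- The same kernel is the image of Ext^{d-1}(X, coker (j-1)), zero because d - 1 < j - 1; for d = 0
-- it is zero by left exactness of Hom.
theorem subsingleton_homology {j : ℕ} (hj : d < j) : Subsingleton (D.homology j) := by
  obtain ⟨j, rfl⟩ := Nat.exists_eq_succ_of_ne_zero (Nat.ne_of_gt (Nat.zero_lt_of_lt hj))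
  obtain ⟨e⟩ := nonempty_homology_succ_equiv C hC hright D η hη j
  have h1 : ∀ x : LinearMap.ker (extPost (K := K) X (cokerIncl C j) d), x = 0 := by
    rintro ⟨x, hx⟩
    refine Subtype.ext ?_
    cases d with
    | zero =>
      have := (coker_shortExact C hC j).mono_f
      refine Ext.postcomp_mk₀_injective_of_mono X (cokerIncl C j) ?_
      exact hx.trans (Ext.zero_comp X 0 (Ext.mk₀ (cokerIncl C j)) 0 (add_zero 0)).symm
    | succ d =>
      obtain ⟨y, rfl⟩ := Ext.covariant_sequence_exact₁ X (coker_shortExact C hC j) x hx rfl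
      have h2 : y = 0 := ext_coker_eq_zero C hC hP (by omega) (by omega) y
      subst h2
      exact Ext.zero_comp _ _ _ _ rfl
  have : Subsingleton (LinearMap.ker (extPost (K := K) X (cokerIncl C j) d)) :=
    ⟨fun x y => (h1 x).trans (h1 y).symm⟩
  exact e.toEquiv.subsingleton

end Resolution

section ProjectiveVanishing

variable {R : Type u} [Ring R] {T : ModuleCat.{u} R → Prop} (hT : SyzygyClosed T)
  {X : ModuleCat.{u} R} (hX : T X) {d : ℕ}
  (h0 : ∀ i, i ≠ d → ∀ e : Ext X (ModuleCat.of R R) i, e = 0)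

include hT hX h0 in
-- A projective module is a retract of a free one.
theorem ext_projective_eq_zero (P : ModuleCat.{u} R) [Projective P] {i : ℕ} (hi : i ≠ d)
    (e : Ext X P i) : e = 0 := by
  let f : ModuleCat.of R (P →₀ R) ⟶ P := ModuleCat.ofHom (selfPresentation P)
  have : Epi f := (ModuleCat.epi_iff_surjective f).2 (selfPresentation_surjective P)
  have h1 : Ext.mk₀ (Projective.factorThru (𝟙 P) f ≫ f) = Ext.mk₀ (𝟙 P) := by
    rw [Projective.factorThru_comp]
  rw [← Ext.comp_mk₀_id e, ← h1, ← Ext.mk₀_comp_mk₀, ← Ext.comp_assoc_of_third_deg_zero,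
    ext_finsupp_eq_zero hT hX h0 P hi (e.comp _ _), Ext.zero_comp]

end ProjectiveVanishing

end HopfDuality

namespace HopfDuality

open Abelian

/-! ### The duality between Ext and Tor -/

section KerEquiv

variable {K : Type*} [Ring K] {M N P : Type*} [AddCommGroup M] [Module K M] [AddCommGroup N]
  [Module K N] [AddCommGroup P] [Module K P] {f : M →ₗ[K] N} {g : M →ₗ[K] P}
  (hf : Function.Surjective f) (hg : Function.Surjective g)
  (hfg : LinearMap.ker f = LinearMap.ker g)

/-- Two quotients of a module by the same kernel are isomorphic. -/
noncomputable def equivOfKerEq : N ≃ₗ[K] P :=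
  (f.quotKerEquivOfSurjective hf).symm.trans
    ((Submodule.quotEquivOfEq _ _ hfg).trans (g.quotKerEquivOfSurjective hg))

theorem equivOfKerEq_apply (m : M) : equivOfKerEq hf hg hfg (f m) = g m := by
  have h1 : (f.quotKerEquivOfSurjective hf).symm (f m) = Submodule.Quotient.mk m :=
    (LinearEquiv.symm_apply_eq _).2 rfl
  rw [equivOfKerEq, LinearEquiv.trans_apply, h1]
  rfl

end KerEquiv

section Resolution

variable {R : Type u} [Ring R] {M : ModuleCat.{u} R} (P : ProjectiveResolution M)

/-- The `0`-th cokernel of a projective resolution is the resolved module. -/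
theorem nonempty_coker_iso : Nonempty (coker P.complex 0 ≅ M) := by
  have h1 : LinearMap.range (P.complex.d 1 0).hom = LinearMap.ker (P.π.f 0).hom :=
    (ShortComplex.moduleCat_exact_iff_range_eq_ker _).1 P.exact₀
  exact ⟨((Submodule.quotEquivOfEq _ _ h1).trans ((P.π.f 0).hom.quotKerEquivOfSurjective
    ((ModuleCat.epi_iff_surjective _).1 inferInstance))).toModuleIso⟩

end Resolution

section TwistFunctor

variable {K : Type u} [CommRing K] {h : K} {A : Type u} [Ring A] [Algebra K A]

variable (h) in
/-- The restriction of scalars along `τ ⊗̂ id`. -/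
noncomputable abbrev envTwistFunctor (τ : A ≃ₐ[K] A) :
    ModuleCat.{u} (Env h A) ⥤ ModuleCat.{u} (Env h A) :=
  ModuleCat.restrictScalars (envTwistHom τ)

/-- Being an equivalence, the twist carries projective resolutions to projective resolutions. -/
instance (τ : A ≃ₐ[K] A) : (envTwistFunctor h τ).IsEquivalence :=
  ModuleCat.restrictScalars_isEquivalence_of_ringEquiv (envTwist τ).toRingEquiv

/-- The identity map from a module to its twist. -/
noncomputable def twistEquiv (τ : A ≃ₐ[K] A) (M : ModuleCat.{u} (Env h A)) :
    M ≃ₗ[K] (envTwistFunctor h τ).obj M where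
  toFun m := m
  invFun m := m
  left_inv _ := rfl
  right_inv _ := rfl
  map_add' _ _ := rfl
  map_smul' c m := by
    change algebraMap K (Env h A) c • m = envTwist τ (algebraMap K (Env h A) c) • m
    rw [AlgEquiv.commutes]

variable [IsAdicComplete (Ideal.span {h}) A] {d : ℕ} (u : DualizingBimodule h A d) {τ : A ≃ₐ[K] A}

/-- The map `m ↦ u ∘ (x ↦ x m)`. -/
noncomputable def extGen (M : ModuleCat.{u} (Env h A)) :
    M →ₗ[K] Ext (ModuleCat.of (Env h A) A) M d where
  toFun m := u.comp (Ext.mk₀ (elemHom m)) (add_zero d)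
  map_add' m m' := by
    rw [← Ext.comp_add, ← Ext.mk₀_add]
    congr 2
    ext; simp
  map_smul' c m := by
    refine Eq.trans ?_ (Ext.comp_smul ..)
    rw [← Ext.mk₀_smul]
    congr 2
    ext
    change (1 : Env h A) • algebraMap K (Env h A) c • m =
      algebraMap K (Env h A) c • (1 : Env h A) • m
    rw [one_smul, one_smul]

theorem extGen_apply (M : ModuleCat.{u} (Env h A)) (m : M) :
    extGen u M m = u.comp (Ext.mk₀ (elemHom m)) (add_zero d) := rfl

theorem extPost_extGen {M N : ModuleCat.{u} (Env h A)} (g : M ⟶ N) (m : M) :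
    extPost (K := K) _ g d (extGen u M m) = extGen u N (g.hom m) := by
  rw [extPost_apply, extGen_apply, extGen_apply, Ext.comp_assoc_of_third_deg_zero,
    Ext.mk₀_comp_mk₀, elemHom_comp]

/-- The map `m ↦ 1 ⊗ m` to the tensor product with the twist of `M`. -/
noncomputable def twistGen (τ : A ≃ₐ[K] A) (M : ModuleCat.{u} (Env h A)) :
    M →ₗ[K] (tensorFunctor (K := K) (B := Env h A) A).obj ((envTwistFunctor h τ).obj M) :=
  BalancedTensor.mk (AlgHom.id K (Env h A)) ((envTwistFunctor h τ).obj M) (1 : A) ∘ₗ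
    (twistEquiv τ M).toLinearMap

theorem twistGen_surjective (M : ModuleCat.{u} (Env h A)) :
    Function.Surjective (twistGen (h := h) τ M) :=
  (mk_one_surjective (W := (envTwistFunctor h τ).obj M)).comp (twistEquiv τ M).surjective

theorem map_twistGen {M N : ModuleCat.{u} (Env h A)} (g : M ⟶ N) (m : M) :
    ((tensorFunctor (K := K) (B := Env h A) A).map ((envTwistFunctor h τ).map g)).hom
      (twistGen τ M m) = twistGen τ N (g.hom m) := rfl

variable {u} (hl : Function.Bijective (leftGen (h := h) (A := A) u))
  (hτ : ∀ b, rightGen (h := h) u b = leftGen (h := h) u (τ b))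
  (hR : ∀ r : A ⊗[K] Aᵐᵒᵖ, h • r = 0 → r = 0)

include hl hτ hR in
theorem op_envTwist_smul_eq_zero_iff (x : Env h A) :
    op (envTwist τ x) • u = 0 ↔ op x • (1 : A) = 0 := by
  rw [op_envTwist_smul hτ hl hR, ← map_zero (leftGen (h := h) (A := A) u), hl.1.eq_iff,
    EmbeddingLike.map_eq_zero_iff]

include hl hτ hR in
-- The annihilator of u in E is the image under τ ⊗̂ id of the annihilator of 1 in A, so the two
-- submodules of M coincide.
theorem annihilated_twist (M : ModuleCat.{u} (Env h A)) (m : M) :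
    twistEquiv τ M m ∈ annihilated h A ((envTwistFunctor h τ).obj M) (1 : A) ↔
      m ∈ annihilated h A M u := by
  rw [mem_annihilated, mem_annihilated]
  have : {z : M | ∃ (x : Env h A) (w : M), op x • u = 0 ∧ z = x • w} =
      {z : M | ∃ (x : Env h A) (w : M), op x • (1 : A) = 0 ∧ z = envTwist τ x • w} := by
    ext z
    constructor
    · rintro ⟨x, w, hx, hz⟩
      refine ⟨(envTwist τ).symm x, w, (op_envTwist_smul_eq_zero_iff hl hτ hR _).1 ?_, ?_⟩
      · rwa [AlgEquiv.apply_symm_apply]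
      · rwa [AlgEquiv.apply_symm_apply]
    · rintro ⟨x, w, hx, hz⟩
      exact ⟨envTwist τ x, w, (op_envTwist_smul_eq_zero_iff hl hτ hR _).2 hx, hz⟩
  rw [this]
  rfl

variable {T : ModuleCat.{u} (Env h A) → Prop} (hT : SyzygyClosed T)
  (hX : T (ModuleCat.of (Env h A) A))
  (h0 : ∀ i, i ≠ d → ∀ e : Ext (ModuleCat.of (Env h A) A) (ModuleCat.of (Env h A) (Env h A)) i,
    e = 0)
  (hpd : ∃ n : ℕ, HasProjectiveDimensionLT (ModuleCat.of (Env h A) A) n)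

include hl in
theorem exists_eq_extMul (e : DualizingBimodule h A d) : ∃ x, e = extMul u x := by
  obtain ⟨a, rfl⟩ := hl.2 e
  exact ⟨inclLeft h a, rfl⟩

include hl hT hX h0 hpd in
theorem extGen_surjective (M : ModuleCat.{u} (Env h A)) : Function.Surjective (extGen u M) :=
  fun e => by
    obtain ⟨m, rfl⟩ := exists_comp_elemHom hT hX h0 (exists_eq_extMul hl) hpd e
    exact ⟨m, rfl⟩

include hl hT hX h0 hpd in
theorem extGen_eq_zero_iff (M : ModuleCat.{u} (Env h A)) (m : M) :
    extGen u M m = 0 ↔ m ∈ annihilated h A M u := by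
  refine ⟨fun hm => mem_closure_of_comp_elemHom_eq_zero hT hX h0 (exists_eq_extMul hl) hpd m hm,
    fun hm => ?_⟩
  rw [mem_annihilated] at hm
  induction hm using AddSubgroup.closure_induction with
  | mem z hz =>
    obtain ⟨x, w, hx, rfl⟩ := hz
    rw [extGen_apply, ← extMul_comp_elemHom]
    exact (congrArg (fun e : DualizingBimodule h A d =>
      e.comp (Ext.mk₀ (elemHom w)) (add_zero d)) hx).trans (Ext.zero_comp _ _ _ _ (add_zero d))
  | zero => exact map_zero _
  | add x y _ _ hx hy => rw [map_add, hx, hy, add_zero]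
  | neg x _ hx => rw [map_neg, hx, neg_zero]

/-- The isomorphism of `Ext^d(A, M)` with the tensor product of `A` and the twist of `M`. -/
noncomputable def extTopEquiv (M : ModuleCat.{u} (Env h A)) :
    Ext (ModuleCat.of (Env h A) A) M d ≃ₗ[K]
      (tensorFunctor (K := K) (B := Env h A) A).obj ((envTwistFunctor h τ).obj M) :=
  -- Both sides are quotients of M, by the sums of elements xm with ux = 0.
  equivOfKerEq (extGen_surjective hl hT hX h0 hpd M) (twistGen_surjective (τ := τ) M) (by
    ext m
    rw [LinearMap.mem_ker, LinearMap.mem_ker, extGen_eq_zero_iff hl hT hX h0 hpd,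
      ← annihilated_twist hl hτ hR]
    exact (mk_one_eq_zero_iff _).symm)

theorem map_extTopEquiv {M N : ModuleCat.{u} (Env h A)} (g : M ⟶ N)
    (e : Ext (ModuleCat.of (Env h A) A) M d) :
    ((tensorFunctor (K := K) (B := Env h A) A).map ((envTwistFunctor h τ).map g)).hom
      (extTopEquiv hl hτ hR hT hX h0 hpd M e) =
    extTopEquiv hl hτ hR hT hX h0 hpd N (extPost (K := K) _ g d e) := by
  obtain ⟨m, rfl⟩ := extGen_surjective hl hT hX h0 hpd M e
  rw [extPost_extGen, extTopEquiv, extTopEquiv, equivOfKerEq_apply, equivOfKerEq_apply,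
    map_twistGen]

variable (M : ModuleCat.{u} (Env h A))

variable (τ) in
/-- The complex which computes the Hochschild homology of the twist of `M`. -/
noncomputable abbrev twistComplex {M : ModuleCat.{u} (Env h A)} (P : ProjectiveResolution M) :
    ChainComplex (ModuleCat.{u} K) ℕ :=
  ((tensorFunctor (K := K) (B := Env h A) A).mapHomologicalComplex _).obj
    (((envTwistFunctor h τ).mapHomologicalComplex _).obj P.complex)

theorem nonempty_hhhom_iso {M : ModuleCat.{u} (Env h A)} (P : ProjectiveResolution M) (j : ℕ) :
    Nonempty (HHhom h A j ((envTwistFunctor h τ).obj M) ≅ (twistComplex τ P).homology j) :=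
  ⟨((envTwistFunctor h τ).mapProjectiveResolution P).isoLeftDerivedObj
    (tensorFunctor (K := K) (B := Env h A) A) j⟩

include hl hτ hR hT hX h0 hpd in
-- By naturality of `extTopEquiv` the complex Ext^d(A, P) of a projective resolution P of M is the
-- complex computing Tor of the twist of M.
theorem nonempty_hhcoh_equiv_hhhom_twist {i j : ℕ} (hij : i + j = d) :
    Nonempty (HHcoh h A i M ≃ₗ[K] HHhom h A j ((envTwistFunctor h τ).obj M)) := by
  let P := projectiveResolution M
  obtain ⟨e⟩ := nonempty_homology_equiv_ext (K := K) P.complex P.exact_succ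
    (fun n i hi e => ext_projective_eq_zero hT hX h0 _ hi e)
    (fun N e => ext_eq_zero_of_lt hT hX h0 hpd (Nat.lt_succ_self d) e) (twistComplex τ P)
    (fun n => extTopEquiv hl hτ hR hT hX h0 hpd (P.complex.X n))
    (fun n e => map_extTopEquiv hl hτ hR hT hX h0 hpd (P.complex.d (n + 1) n) e) hij
  obtain ⟨f⟩ := nonempty_coker_iso P
  obtain ⟨g⟩ := nonempty_hhhom_iso (τ := τ) P j
  let f' : HHcoh h A i (coker P.complex 0) ≃ₗ[K] HHcoh h A i M :=
    LinearEquiv.ofLinearMap (extPost (K := K) _ f.hom i) (extPost (K := K) _ f.inv i)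
      (LinearMap.ext fun x => by
        rw [LinearMap.comp_apply, ← extPost_comp, f.inv_hom_id, extPost_apply, Ext.comp_mk₀_id]
        rfl)
      (LinearMap.ext fun x => by
        rw [LinearMap.comp_apply, ← extPost_comp, f.hom_inv_id, extPost_apply, Ext.comp_mk₀_id]
        rfl)
  exact ⟨f'.symm.trans (e.trans g.toLinearEquiv.symm)⟩

include hl hτ hR hT hX h0 hpd in
theorem subsingleton_hhhom_twist {j : ℕ} (hj : d < j) :
    Subsingleton (HHhom h A j ((envTwistFunctor h τ).obj M)) := by
  let P := projectiveResolution M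
  have := subsingleton_homology (K := K) P.complex P.exact_succ
    (fun n i hi e => ext_projective_eq_zero hT hX h0 _ hi e)
    (fun N e => ext_eq_zero_of_lt hT hX h0 hpd (Nat.lt_succ_self d) e) (twistComplex τ P)
    (fun n => extTopEquiv hl hτ hR hT hX h0 hpd (P.complex.X n))
    (fun n e => map_extTopEquiv hl hτ hR hT hX h0 hpd (P.complex.d (n + 1) n) e) hj
  obtain ⟨g⟩ := nonempty_hhhom_iso (τ := τ) P j
  exact g.toLinearEquiv.toEquiv.subsingleton

end TwistFunctor

end HopfDuality

open HopfDuality in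
theorem mainTheorem6 {k : Type u} [Field k] [CharZero k]
    {A : Type u} [Ring A] [Algebra k A] [Algebra k⟦X⟧ A] [IsScalarTower k k⟦X⟧ A]
    [IsTopologicallyFree (PowerSeries.X : k⟦X⟧) A]
    (H : TopologicalHopfAlgebra (PowerSeries.X : k⟦X⟧) A)
    (hS : Function.Bijective H.antipode)
    (hA₀ : IsNoetherianRing (Reduction k A))
    (d : ℕ)
    (hExt : ∀ i : ℕ, i ≠ d → Subsingleton
      (Abelian.Ext (trivialModule H) (ModuleCat.of (Reduction k A) (Reduction k A)) i))
    (hExtd : Nonempty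
      (Abelian.Ext (trivialModule H) (ModuleCat.of (Reduction k A) (Reduction k A)) d ≃ₗ[k] k))
    (hA₀e : IsNoetherianRing (Reduction k A ⊗[k] (Reduction k A)ᵐᵒᵖ))
    (hpd : ∃ n : ℕ, HasProjectiveDimensionLT
      (ModuleCat.of (Env (PowerSeries.X : k⟦X⟧) A) A) n)
    (M : ModuleCat.{u} (Env (PowerSeries.X : k⟦X⟧) A)) :
    (∃! inst : Module (Env (PowerSeries.X : k⟦X⟧) A)
        (DualizingTensor (h := (PowerSeries.X : k⟦X⟧)) (A := A) d M),
      IsCanonicalAction d M inst) ∧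
    ∀ inst : Module (Env (PowerSeries.X : k⟦X⟧) A)
        (DualizingTensor (h := (PowerSeries.X : k⟦X⟧)) (A := A) d M),
      IsCanonicalAction d M inst →
      (∀ i j : ℕ, i + j = d →
        Nonempty (HHcoh (PowerSeries.X : k⟦X⟧) A i M ≃ₗ[k⟦X⟧]
          HHhom (PowerSeries.X : k⟦X⟧) A j
            (ModuleCat.of (Env (PowerSeries.X : k⟦X⟧) A)
              (DualizingTensor (h := (PowerSeries.X : k⟦X⟧)) (A := A) d M)))) ∧
      (∀ i : ℕ, d < i → Subsingleton (HHcoh (PowerSeries.X : k⟦X⟧) A i M)) ∧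
      (∀ j : ℕ, d < j → Subsingleton (HHhom (PowerSeries.X : k⟦X⟧) A j
            (ModuleCat.of (Env (PowerSeries.X : k⟦X⟧) A)
              (DualizingTensor (h := (PowerSeries.X : k⟦X⟧)) (A := A) d M)))) := by
  obtain ⟨h0, u, hl, hr⟩ := exists_dualizing_generator H hS hA₀ hExt hExtd hA₀e
  obtain ⟨τ, hτ⟩ := exists_twist (h := (PowerSeries.X : k⟦X⟧)) u hl hr
  have hR := env_base_torsionFree (k := k) (A := A)
  have hT := env_syzygyClosed (A := A) hA₀e
  have hX := envRegular_torsionFreeClass k A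
  -- The pairs i + j = d of natural numbers and the two vanishing ranges together account for every
  -- integer degree.
  refine ⟨existsUnique_canonicalAction hl hτ M hR, fun inst hinst => ⟨fun i j hij => ?_,
    fun i hi => ⟨fun x y => ?_⟩, fun j hj => ?_⟩⟩
  · obtain ⟨e⟩ := nonempty_iso_of_isCanonicalAction M hl hτ hR inst hinst
    obtain ⟨f⟩ := nonempty_hhcoh_equiv_hhhom_twist hl hτ hR hT hX h0 hpd M hij
    exact ⟨f.trans (((tensorFunctor (K := k⟦X⟧)
      (B := Env (PowerSeries.X : k⟦X⟧) A) A).leftDerived j).mapIso e).toLinearEquiv⟩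
  · rw [ext_eq_zero_of_lt hT hX h0 hpd hi x, ext_eq_zero_of_lt hT hX h0 hpd hi y]
  · obtain ⟨e⟩ := nonempty_iso_of_isCanonicalAction M hl hτ hR inst hinst
    exact @Equiv.subsingleton _ _ (((tensorFunctor (K := k⟦X⟧)
      (B := Env (PowerSeries.X : k⟦X⟧) A) A).leftDerived j).mapIso e).toLinearEquiv.symm.toEquiv
      (subsingleton_hhhom_twist hl hτ hR hT hX h0 hpd M hj)
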